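/- Let $n,m,k$ be integers with $2\le m\le n-1$ and $2\le k\le \binom{n-1}{m-1}$, and let $\Omega\subset\mathbb R^n$ be a bounded domain with $C^4$ boundary. Denote by $\nu$ the outer unit normal of $\partial\Omega$ and by $\kappa_{\min}(x)$ the minimum principal curvature of $\partial\Omega$ at $x\in\partial\Omega$ with respect to the inner normal (so that $\kappa_{\min}=1$ for the unit ball). For a $C^2$ function $u$ let $W=(w_{\alpha\beta})$ be the symmetric $\binom nm\times\binom nm$ matrix, indexed by multi-indices $\alpha=(\alpha_1<\dots<\alpha_m)$, $\beta=(\beta_1<\dots<\beta_m)$ in $\{1,\dots,n\}$, with entries $$w_{\alpha\beta}=\sum_{i=1}^m\sum_{j=1}^n u_{\alpha_i j}\,\delta^{\alpha_1\cdots\alpha_{i-1}\,j\,\alpha_{i+1}\cdots\alpha_m}_{\beta_1\cdots\beta_m},$$ where $\delta$ is the generalized Kronecker symbol, and let $S_k(W)$ be the $k$-th elementary symmetric function of the eigenvalues of $W$. The function $u$ is called $k$-admissible in $\Omega$ if for every $x\in\Omega$ the eigenvalues $\mu=(\mu_1,\dots,\mu_n)$ of $D^2u(x)$ are such that the elementary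 symmetric functions $S_1,\dots,S_k$ of the $\binom nm$ numbers $\mu_{i_1}+\dots+\mu_{i_m}$ $(i_1<\dots<i_m)$ are all positive. Let $f\in C^2(\overline\Omega\times\mathbb R)$ be positive and let $\phi\in C^3(\overline\Omega\times\mathbb R)$ satisfy $\phi_z(x,z)-2\kappa_{\min}(x)<0$ for all $x\in\partial\Omega$, $z\in\mathbb R$. If $u\in C^4(\Omega)\cap C^3(\overline\Omega)$ is a $k$-admissible solution of the Neumann problem $$S_k(W)=f(x,u)\ \text{ in }\Omega,\qquad u_\nu=\phi(x,u)\ \text{ on }\partial\Omega,$$ then $$\sup_{\overline\Omega}|D^2u|\le C.$$ Here, with $M_0=\sup_\Omega|u|$, the constant $C$ depends only on $n$, $m$, $k$, $\Omega$, an upper bound for $|u|_{C^1(\overline\Omega)}$, upper bounds for $|f|_{C^2(\overline\Omega\times[-M_0,M_0])}$ and $|\phi|_{C^3(\overline\Omega\times[-M_0,M_0])}$, and a positive lower bound for $\min_{\overline\Omega\times[-M_0,M_0]}f$. -/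

import Mathlib

open Set Filter Topology
open scoped ENNReal

noncomputable section

namespace HessianNeumann

/-! ### The equation -/

/-- The generalized Kronecker symbol `δ^{a₁…aₘ}_{b₁…bₘ} = det (δ_{aᵢ bⱼ})`: it is the sign of the
permutation carrying `b` to `a` if `a` has distinct entries and is a rearrangement of `b`, and `0`
otherwise. -/
def genKronecker {n m : ℕ} (a b : Fin m → Fin n) : ℝ :=
  Matrix.det (Matrix.of fun i j : Fin m => if a i = b j then (1 : ℝ) else 0)

/-- Increasing multi-indices `α₁ < ⋯ < αₘ` in `{1, …, n}`, as the `m`-element subsets. -/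
abbrev MultiIndex (n m : ℕ) : Type := {s : Finset (Fin n) // s.card = m}

/-- The entries `α₁ < ⋯ < αₘ` of a multi-index. -/
def MultiIndex.entries {n m : ℕ} (α : MultiIndex n m) : Fin m → Fin n :=
  α.1.orderEmbOfFin α.2

/-- The matrix `W` of the derivation on `⋀ᵐ ℝⁿ` induced by the symmetric matrix `A`:
`w_{αβ} = ∑ᵢ ∑ⱼ A_{αᵢ j} δ^{α₁ … αᵢ₋₁ j αᵢ₊₁ … αₘ}_{β₁ … βₘ}`. -/
def wMatrix {n : ℕ} (m : ℕ) (A : Matrix (Fin n) (Fin n) ℝ) :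
    Matrix (MultiIndex n m) (MultiIndex n m) ℝ :=
  Matrix.of fun α β => ∑ i : Fin m, ∑ j : Fin n,
    A (α.entries i) j * genKronecker (Function.update α.entries i j) β.entries

/-- The eigenvalues, with multiplicity, of a real symmetric matrix. -/
def eigenvalues {ι : Type} [Fintype ι] [DecidableEq ι] (A : Matrix ι ι ℝ) : Multiset ℝ :=
  A.charpoly.roots

/-- `S_k(W) = S_k(λ(W))`, the `k`-th elementary symmetric function of the eigenvalues. -/
def sigma {ι : Type} [Fintype ι] [DecidableEq ι] (k : ℕ) (A : Matrix ι ι ℝ) : ℝ :=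
  (eigenvalues A).esymm k

/-- Gårding's cone `Γ_k`; being invariant under permutations of the entries it is a set of
multisets. -/
def gardingCone (k : ℕ) : Set (Multiset ℝ) :=
  {l | ∀ i : ℕ, 1 ≤ i → i ≤ k → 0 < l.esymm i}

/-- The generalized Gårding cone `Γ_k^{(m)}`: the family of all sums `μ_{i₁} + ⋯ + μ_{iₘ}`,
`i₁ < ⋯ < iₘ`, lies in `Γ_k`. -/
def genGardingCone (m k : ℕ) : Set (Multiset ℝ) :=
  {μ | (μ.powersetCard m).map Multiset.sum ∈ gardingCone k}

/-- The Hessian matrix `D²u(x) = (u_{ij}(x))` at an interior point. -/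
def hessian {n : ℕ} (u : EuclideanSpace ℝ (Fin n) → ℝ) (x : EuclideanSpace ℝ (Fin n)) :
    Matrix (Fin n) (Fin n) ℝ :=
  Matrix.of fun i j => iteratedFDeriv ℝ 2 u x
    ![EuclideanSpace.single i (1 : ℝ), EuclideanSpace.single j (1 : ℝ)]

/-- `u` is `k`-admissible in `Ω`: `μ(D²u(x)) ∈ Γ_k^{(m)}` for every `x ∈ Ω`. -/
def IsAdmissible {n : ℕ} (m k : ℕ) (Ω : Set (EuclideanSpace ℝ (Fin n)))
    (u : EuclideanSpace ℝ (Fin n) → ℝ) : Prop :=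
  ∀ x ∈ Ω, eigenvalues (hessian u x) ∈ genGardingCone m k

/-! ### The domain -/

/-- Near `p` the function `ρ` is of class `C^r`, has nonzero gradient, and `Ω = {ρ < 0}`. -/
structure IsLocalDefiningFunction {n : ℕ} (r : ℕ) (Ω : Set (EuclideanSpace ℝ (Fin n)))
    (p : EuclideanSpace ℝ (Fin n)) (ρ : EuclideanSpace ℝ (Fin n) → ℝ) : Prop where
  contDiffAt : ContDiffAt ℝ r ρ p
  gradient_ne_zero : gradient ρ p ≠ 0
  mem_iff : ∀ᶠ x in 𝓝 p, (x ∈ Ω ↔ ρ x < 0)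

/-- `∂Ω` is of class `C^r`, with `Ω` locally on one side of it. -/
def HasCkBoundary {n : ℕ} (r : ℕ) (Ω : Set (EuclideanSpace ℝ (Fin n))) : Prop :=
  ∀ p ∈ frontier Ω, ∃ ρ, IsLocalDefiningFunction r Ω p ρ

/-- `ν` is the outer unit normal vector `∇ρ / |∇ρ|` of `∂Ω` at `p`; it does not depend on the
local defining function `ρ`. -/
def IsOuterUnitNormal {n : ℕ} (Ω : Set (EuclideanSpace ℝ (Fin n)))
    (p ν : EuclideanSpace ℝ (Fin n)) : Prop :=
  ∃ ρ, IsLocalDefiningFunction 1 Ω p ρ ∧ ν = ‖gradient ρ p‖⁻¹ • gradient ρ p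

/-- `κ` is a principal curvature of `∂Ω` at `p` with respect to the inner normal, that is, an
eigenvalue of the second fundamental form `D²ρ(X, Y) / |∇ρ|` on the tangent space `(∇ρ)^⊥`,
with respect to the induced metric (for the unit ball, `κ = 1`). It does not depend on the local
defining function `ρ`. -/
def IsPrincipalCurvature {n : ℕ} (Ω : Set (EuclideanSpace ℝ (Fin n)))
    (p : EuclideanSpace ℝ (Fin n)) (κ : ℝ) : Prop :=
  ∃ ρ, IsLocalDefiningFunction 2 Ω p ρ ∧
    ∃ X : EuclideanSpace ℝ (Fin n), X ≠ 0 ∧ inner ℝ (gradient ρ p) X = 0 ∧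
      ∀ Y : EuclideanSpace ℝ (Fin n), inner ℝ (gradient ρ p) Y = 0 →
        iteratedFDeriv ℝ 2 ρ p ![X, Y] / ‖gradient ρ p‖ = κ * inner ℝ X Y

/-- The minimum principal curvature `κ_min(p)` of `∂Ω`. -/
def kappaMin {n : ℕ} (Ω : Set (EuclideanSpace ℝ (Fin n)))
    (p : EuclideanSpace ℝ (Fin n)) : ℝ :=
  sInf {κ | IsPrincipalCurvature Ω p κ}

/-! ### Norms and the boundary value problem -/

/-- The norm `∑_{j ≤ r} sup_K |D^j g|`, where the derivatives are those of `g` as a function on the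
set `D ⊇ K` (one-sided at boundary points of `D`). -/
def ckNorm {E : Type} [NormedAddCommGroup E] [NormedSpace ℝ E] (r : ℕ) (g : E → ℝ)
    (D K : Set E) : ℝ≥0∞ :=
  ∑ j ∈ Finset.range (r + 1), ⨆ x ∈ K, ‖iteratedFDerivWithin ℝ j g D x‖ₑ

/-- `sup_Ω |u|`. -/
def supAbs {E : Type} (u : E → ℝ) (Ω : Set E) : ℝ :=
  sSup ((fun x => |u x|) '' Ω)

/-- `u` solves `S_k(W) = f(x, u)` in `Ω` and `u_ν = φ(x, u)` on `∂Ω`, where `ν` is the outer unit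
normal. -/
structure IsNeumannSolution {n : ℕ} (m k : ℕ) (Ω : Set (EuclideanSpace ℝ (Fin n)))
    (f φ : EuclideanSpace ℝ (Fin n) × ℝ → ℝ) (u : EuclideanSpace ℝ (Fin n) → ℝ) : Prop where
  equation : ∀ x ∈ Ω, sigma k (wMatrix m (hessian u x)) = f (x, u x)
  boundary : ∀ x ∈ frontier Ω, ∀ ν, IsOuterUnitNormal Ω x ν →
    fderivWithin ℝ u (closure Ω) x ν = φ (x, u x)

end HessianNeumann

end

/-!
# The global second derivative estimate for a Neumann problem of Hessian type

The eigenvalues of `W` are the sums `μ_{i₁} + ⋯ + μ_{iₘ}` of eigenvalues of `D²u`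
(`sigma_wMatrix`: `W` is the derivative at `t = 0` of the `m`-th compound matrix of `1 + t D²u`).
By Newton's inequalities the quotients `e_{k+1} / e_k` are concave on Gårding's cone, hence so is
`log e_k` (`concaveOn_log_esym`), and therefore `log S_k(W)` is a concave function of `D²u`. As
`k ≤ C(n-1, m-1)`, the admissible cone contains a full neighbourhood of the vectors `e_j`, and this
makes the linearized operator `∑ F_j D²w(q_j, q_j)` uniformly elliptic relative to its trace
`∑ F_j`, which is bounded below (`exists_linearization`).

The equation `log S_k(W) = log f(x, u)` is differentiated through its supporting functionals: the
difference of the operator frozen at `x₀`, applied to `D²u`, and of `log f(x, u)` has a minimum at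
`x₀`. The first order condition controls the operator on `Du`, and the second order condition shows
that it is bounded below on `D²u(ξ, ξ)` (`EllipticFamily.derivatives`). All estimates are made for
the family of all solutions with the given bounds at once; `Tame₀` and `Tame₁` are the two classes
of functions whose derivatives grow in a controlled way with `|D²u|`, and they are stable under the
required products and compositions.

Let `M = sup |D²u|`. A barrier `1 - e^{ρ/ε}`, where `ρ` is a defining function of `Ω`, shows
`u_νν ≤ C_η + η M` on the boundary for every `η > 0` (`NeumannFamily.double_normal_le`). The
remaining bound follows by maximizing, over points `x` of the closure and unit vectors `ξ`,
`D²u(ξ, ξ) - v' + |Du|² + κ (1 - e^{ρ/ε})`, `κ = k M ε`, where the correction `v'` cancels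
`2 ⟨ξ, ν⟩ D²u(ξ - ⟨ξ, ν⟩ ν, ν)` on the boundary, by the tangentially differentiated boundary
condition. At an interior maximum `|Du|²` contributes a term of order `|D²u|²` which dominates. At a
boundary maximum `ξ` may be taken normal, where the double normal estimate applies, or it is
tangential: then differentiating the boundary condition twice along the boundary gives
`u_ξξν ≤ C (1 + M)`, which is incompatible with the slope of the barrier unless `M` is bounded
(`NeumannFamily.exists_hessNorm_le`).
-/

noncomputable section

namespace HessianNeumann

/-! ### Elementary symmetric functions and Gårding's cones -/

section Garding

variable {ι : Type*}

/-- The elementary symmetric function of degree `k` of the numbers `x i`, `i ∈ s`. -/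
def esym (s : Finset ι) (k : ℕ) (x : ι → ℝ) : ℝ :=
  ∑ t ∈ s.powersetCard k, ∏ i ∈ t, x i

/-- Gårding's cone `Γ_k` in the variables indexed by `s`. -/
def posCone (s : Finset ι) (k : ℕ) : Set (ι → ℝ) :=
  {x | ∀ j, 1 ≤ j → j ≤ k → 0 < esym s j x}

@[simp]
lemma esym_zero (s : Finset ι) (x : ι → ℝ) : esym s 0 x = 1 := by
  simp [esym]

lemma esym_one (s : Finset ι) (x : ι → ℝ) : esym s 1 x = ∑ i ∈ s, x i := by
  simp [esym, Finset.powersetCard_one]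

open Polynomial in
lemma splits_derivative_real {p : ℝ[X]} (hp : p.Splits) : p.derivative.Splits := by
  rw [splits_iff_card_roots] at hp ⊢
  rcases Nat.eq_zero_or_pos p.natDegree with h0 | h0
  · rw [eq_C_of_natDegree_eq_zero h0]
    simp
  · have h1 := card_roots_le_derivative p
    have h2 := p.derivative.card_roots'
    have h3 := natDegree_derivative_lt h0.ne'
    omega

open Polynomial in
lemma coeff_newton_of_splits {p : ℝ[X]} (hp : p.Splits) :
    2 * (p.coeff 0 * p.coeff 2) ≤ p.coeff 1 ^ 2 := by
  have main : ∀ s : Multiset ℝ, ∀ q : ℝ[X], q = (s.map fun a => X - C a).prod →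
      2 * (q.coeff 0 * q.coeff 2) ≤ q.coeff 1 ^ 2 := by
    intro s
    induction s using Multiset.induction_on with
    | empty =>
      rintro q rfl
      simp [coeff_one]
    | cons a s ih =>
      rintro q rfl
      have := ih _ rfl
      set r := (s.map fun a => X - C a).prod
      rw [Multiset.map_cons, Multiset.prod_cons, sub_mul]
      simp only [coeff_sub, coeff_C_mul, coeff_X_mul, coeff_X_mul_zero]
      nlinarith [sq_nonneg a, sq_nonneg (r.coeff 0), mul_le_mul_of_nonneg_left this (sq_nonneg a)]
  have h := main p.roots _ rfl
  have hp' := hp.eq_prod_roots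
  set r := (p.roots.map fun a => X - C a).prod
  rw [hp']
  simp only [coeff_C_mul]
  nlinarith [mul_le_mul_of_nonneg_left h (sq_nonneg p.leadingCoeff)]

/-- Newton's inequality, without the best constant: the iterated derivative of a real-rooted
polynomial is real-rooted, and for a real-rooted `p` one has `p p'' ≤ p' ^ 2`. -/
lemma esym_newton (s : Finset ι) (k : ℕ) (x : ι → ℝ) :
    esym s k x * esym s (k + 2) x ≤ esym s (k + 1) x ^ 2 := by
  open Polynomial in
  rcases lt_or_ge s.card (k + 2) with h | h
  · have : esym s (k + 2) x = 0 := by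
      rw [esym, Finset.powersetCard_eq_empty.2 h, Finset.sum_empty]
    rw [this]
    nlinarith [sq_nonneg (esym s (k + 1) x)]
  · obtain ⟨d, hd⟩ := Nat.exists_eq_add_of_le h
    set p : ℝ[X] := ∏ i ∈ s, (X + C (x i)) with hp
    have hc : ∀ j, j ≤ s.card → p.coeff (s.card - j) = esym s j x := by
      intro j hj
      rw [hp, Finset.prod_X_add_C_coeff s x (Nat.sub_le _ _), Nat.sub_sub_self hj, esym]
    have hsp : p.Splits := by
      refine Polynomial.Splits.prod fun i _ => ?_
      exact Polynomial.Splits.X_add_C _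
    have hder : ∀ n, ((derivative^[n]) p).Splits := by
      intro n
      induction n with
      | zero => exact hsp
      | succ n ih =>
        rw [Function.iterate_succ_apply']
        exact splits_derivative_real ih
    have h2 := coeff_newton_of_splits (hder d)
    simp only [coeff_iterate_derivative, zero_add] at h2
    have e0 : p.coeff d = esym s (k + 2) x := by
      rw [← hc _ h]; congr 1; omega
    have e1 : p.coeff (1 + d) = esym s (k + 1) x := by
      rw [← hc _ (by omega)]; congr 1; omega
    have e2 : p.coeff (2 + d) = esym s k x := by
      rw [← hc _ (by omega)]; congr 1; omega
    rw [e0, e1, e2, nsmul_eq_mul, nsmul_eq_mul, nsmul_eq_mul, Nat.descFactorial_self] at h2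
    have f1 : ((1 + d).descFactorial d : ℝ) = (d + 1) * d.factorial := by
      have := Nat.factorial_mul_descFactorial (show d ≤ 1 + d by omega)
      rw [show 1 + d - d = 1 by omega, Nat.factorial_one, one_mul] at this
      rw [this, add_comm 1 d, Nat.factorial_succ]
      push_cast; ring
    have f2 : 2 * ((2 + d).descFactorial d : ℝ) = (d + 2) * (d + 1) * d.factorial := by
      have := Nat.factorial_mul_descFactorial (show d ≤ 2 + d by omega)
      rw [show 2 + d - d = 2 by omega, Nat.factorial_two] at this
      have h' : (2 : ℝ) * ((2 + d).descFactorial d : ℝ) = ((2 + d).factorial : ℝ) := by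
        exact_mod_cast this
      rw [h', add_comm 2 d, Nat.factorial_succ, Nat.factorial_succ]
      push_cast; ring
    have hf : (0 : ℝ) < d.factorial := by exact_mod_cast d.factorial_pos
    set a := esym s k x
    set b := esym s (k + 1) x
    set c := esym s (k + 2) x
    by_cases hac : a * c ≤ 0
    · nlinarith [sq_nonneg b]
    · push Not at hac
      have h3 : (d + 2 : ℝ) * (d + 1) * (a * c) * (d.factorial : ℝ) ^ 2
          ≤ (d + 1) ^ 2 * b ^ 2 * (d.factorial : ℝ) ^ 2 := by
        rw [f1] at h2
        calc _ = (d.factorial : ℝ) * c * ((2 * ((2 + d).descFactorial d : ℝ)) * a) := by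
                rw [f2]; ring
          _ ≤ _ := by nlinarith [h2]
      have h4 : (d + 2 : ℝ) * (d + 1) * (a * c) ≤ (d + 1) ^ 2 * b ^ 2 :=
        le_of_mul_le_mul_right h3 (by positivity)
      have h5 : (d + 1 : ℝ) ^ 2 * (a * c) ≤ (d + 1) ^ 2 * b ^ 2 := by
        have : (0 : ℝ) ≤ (d + 1) * (a * c) := by positivity
        nlinarith
      exact le_of_mul_le_mul_left h5 (by positivity)

lemma posCone_anti (s : Finset ι) {k l : ℕ} (h : k ≤ l) : posCone s l ⊆ posCone s k :=
  fun _ hx j h1 h2 => hx j h1 (h2.trans h)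

lemma posCone_esym_pos {s : Finset ι} {k : ℕ} {x : ι → ℝ} (hx : x ∈ posCone s k) :
    0 < esym s k x := by
  rcases k with _ | k
  · simp
  · exact hx _ (by omega) le_rfl

variable [DecidableEq ι]

lemma esym_insert {s : Finset ι} {a : ι} (ha : a ∉ s) (k : ℕ) (x : ι → ℝ) :
    esym (insert a s) (k + 1) x = esym s (k + 1) x + x a * esym s k x := by
  unfold esym
  rw [Finset.powersetCard_succ_insert ha, Finset.sum_union, Finset.sum_image, Finset.mul_sum]
  · congr 1
    refine Finset.sum_congr rfl fun t ht => ?_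
    rw [Finset.prod_insert]
    exact fun h => ha ((Finset.mem_powersetCard.1 ht).1 h)
  · intro t ht t' ht' h
    have h1 : a ∉ t := fun h => ha ((Finset.mem_powersetCard.1 ht).1 h)
    have h2 : a ∉ t' := fun h => ha ((Finset.mem_powersetCard.1 ht').1 h)
    rw [← Finset.erase_insert h1, ← Finset.erase_insert h2, h]
  · rw [Finset.disjoint_left]
    intro t ht ht'
    obtain ⟨t', -, rfl⟩ := Finset.mem_image.1 ht'
    exact ha ((Finset.mem_powersetCard.1 ht).1 (Finset.mem_insert_self _ _))

lemma esym_eq_erase {s : Finset ι} {i : ι} (hi : i ∈ s) (k : ℕ) (x : ι → ℝ) :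
    esym s (k + 1) x = esym (s.erase i) (k + 1) x + x i * esym (s.erase i) k x := by
  conv_lhs => rw [← Finset.insert_erase hi]
  exact esym_insert (Finset.notMem_erase i s) k x

lemma sum_mul_esym_erase (s : Finset ι) (k : ℕ) (x : ι → ℝ) :
    ∑ i ∈ s, x i * esym (s.erase i) k x = (k + 1) * esym s (k + 1) x := by
  induction s using Finset.induction_on generalizing k with
  | empty =>
    rw [esym, Finset.powersetCard_eq_empty.2 (by simp)]
    simp
  | insert a s ha ih =>
    rw [Finset.sum_insert ha, Finset.erase_insert ha, esym_insert ha]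
    have key : ∀ i ∈ s, (insert a s).erase i = insert a (s.erase i) := fun i hi =>
      Finset.erase_insert_of_ne (fun h => ha (h ▸ hi))
    rcases k with _ | k
    · simp [esym_one]
      ring
    · have : ∑ i ∈ s, x i * esym ((insert a s).erase i) (k + 1) x
          = ∑ i ∈ s, x i * esym (s.erase i) (k + 1) x
            + x a * ∑ i ∈ s, x i * esym (s.erase i) k x := by
        rw [Finset.mul_sum, ← Finset.sum_add_distrib]
        refine Finset.sum_congr rfl fun i hi => ?_
        rw [key i hi, esym_insert (fun h => ha (Finset.mem_of_mem_erase h))]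
        ring
      rw [this, ih, ih]
      push_cast
      ring

lemma posCone_erase {s : Finset ι} {k : ℕ} {x : ι → ℝ} (hx : x ∈ posCone s (k + 1)) {i : ι}
    (hi : i ∈ s) : x ∈ posCone (s.erase i) k := by
  induction k with
  | zero => intro j h1 h2; omega
  | succ k ih =>
    have hk := ih (posCone_anti s (by omega) hx)
    intro j h1 h2
    rcases Nat.lt_or_ge j (k + 1) with h | h
    · exact hk j h1 (by omega)
    obtain rfl : j = k + 1 := by omega
    have ha := posCone_esym_pos hk
    have hb := hx (k + 1) (by omega) (by omega)
    have hc := hx (k + 2) (by omega) (by omega)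
    rw [esym_eq_erase hi] at hb hc
    have hN := esym_newton (s.erase i) k x
    set a := esym (s.erase i) k x
    set b := esym (s.erase i) (k + 1) x
    set c := esym (s.erase i) (k + 2) x
    by_contra! hneg
    have h3 : 0 < a * (c + x i * b) := mul_pos ha hc
    nlinarith [mul_nonneg (neg_nonneg.2 hneg) hb.le]

lemma sq_div_le_add {p q A B : ℝ} (hA : 0 < A) (hB : 0 < B) :
    (p + q) ^ 2 / (A + B) ≤ p ^ 2 / A + q ^ 2 / B := by
  rw [div_add_div _ _ hA.ne' hB.ne', div_le_div_iff₀ (by positivity) (by positivity)]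
  nlinarith [sq_nonneg (p * B - q * A), mul_pos hA hB]

lemma convexOn_sq_div {V : Type*} [AddCommGroup V] [Module ℝ V] {S : Set V} (l : V →ₗ[ℝ] ℝ)
    {y : V → ℝ} (hy : ConcaveOn ℝ S y) (hpos : ∀ v ∈ S, 0 < y v) :
    ConvexOn ℝ S (fun v => l v ^ 2 / y v) := by
  refine ⟨hy.1, fun v hv w hw a b ha hb hab => ?_⟩
  rcases ha.eq_or_lt with rfl | ha'
  · obtain rfl : b = 1 := by linarith
    simp
  rcases hb.eq_or_lt with rfl | hb'
  · obtain rfl : a = 1 := by linarith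
    simp
  have h1 := hy.2 hv hw ha hb hab
  have hv' := hpos v hv
  have hw' := hpos w hw
  simp only [smul_eq_mul] at h1 ⊢
  calc l (a • v + b • w) ^ 2 / y (a • v + b • w)
      ≤ (a * l v + b * l w) ^ 2 / (a * y v + b * y w) := by
        rw [map_add, map_smul, map_smul, smul_eq_mul, smul_eq_mul]
        exact div_le_div_of_nonneg_left (sq_nonneg _) (by positivity) h1
    _ ≤ (a * l v) ^ 2 / (a * y v) + (b * l w) ^ 2 / (b * y w) :=
        sq_div_le_add (by positivity) (by positivity)
    _ = _ := by
        field_simp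

/-- The quotients `e_{k+1} / e_k` are concave on Gårding's cone `Γ_k`, which is convex. The
induction rests on the identity
`(k + 2) e_{k+2} / e_{k+1} = ∑ᵢ (xᵢ - xᵢ² / (xᵢ + e_{k+1} (x|i) / e_k (x|i)))`, in which every
summand is concave. -/
theorem concaveOn_esym_div (k : ℕ) : ∀ s : Finset ι,
    ConcaveOn ℝ (posCone s k) (fun x => esym s (k + 1) x / esym s k x) := by
  induction k with
  | zero =>
    intro s
    have h0 : posCone s 0 = univ := by
      ext x
      refine ⟨fun _ => mem_univ x, fun _ => ?_⟩
      intro j h1 h2; omega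
    rw [h0]
    refine ⟨convex_univ, fun x _ y _ a b _ _ _ => le_of_eq ?_⟩
    simp [esym_one, Finset.sum_add_distrib, Finset.mul_sum]
  | succ k ih =>
    intro s
    have hset : posCone s (k + 1) = {x ∈ posCone s k | 0 < esym s (k + 1) x / esym s k x} := by
      ext x
      constructor
      · intro hx
        have hx' := posCone_anti s (Nat.le_succ k) hx
        exact ⟨hx', div_pos (posCone_esym_pos hx) (posCone_esym_pos hx')⟩
      · rintro ⟨hx, hpos⟩ j h1 h2
        rcases Nat.lt_or_ge j (k + 1) with h | h
        · exact hx j h1 (by omega)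
        · obtain rfl : j = k + 1 := by omega
          have := posCone_esym_pos hx
          exact (div_pos_iff_of_pos_right this).1 hpos
    have hconv : Convex ℝ (posCone s (k + 1)) := by
      rw [hset]
      exact (ih s).convex_gt 0
    have hterm : ∀ i ∈ s, ConcaveOn ℝ (posCone s (k + 1)) (fun x : ι → ℝ =>
        x i - x i ^ 2 / (x i + esym (s.erase i) (k + 1) x / esym (s.erase i) k x)) := by
      intro i hi
      have hlin : ConcaveOn ℝ (posCone s (k + 1)) (fun x : ι → ℝ => x i) :=
        (LinearMap.proj (R := ℝ) (φ := fun _ : ι => ℝ) i).concaveOn hconv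
      have hq : ConcaveOn ℝ (posCone s (k + 1)) (fun x : ι → ℝ =>
          x i + esym (s.erase i) (k + 1) x / esym (s.erase i) k x) :=
        hlin.add ((ih (s.erase i)).subset (fun x hx => posCone_erase hx hi) hconv)
      refine hlin.sub (convexOn_sq_div (LinearMap.proj (R := ℝ) (φ := fun _ : ι => ℝ) i) hq ?_)
      intro x hx
      have h1 := posCone_esym_pos (posCone_erase hx hi)
      have h2 := posCone_esym_pos hx
      rw [esym_eq_erase hi] at h2
      rw [← mul_div_cancel_right₀ (x i) h1.ne', ← add_div]
      exact div_pos (by linarith) h1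
    have hsum : ∀ t ⊆ s, ConcaveOn ℝ (posCone s (k + 1)) (fun x : ι → ℝ => ∑ i ∈ t,
        (x i - x i ^ 2 / (x i + esym (s.erase i) (k + 1) x / esym (s.erase i) k x))) := by
      intro t
      induction t using Finset.induction_on with
      | empty => intro _; simpa using concaveOn_const 0 hconv
      | insert a t ha iht =>
        intro hts
        simp only [Finset.sum_insert ha]
        exact (hterm a (hts (Finset.mem_insert_self _ _))).add
          (iht ((Finset.subset_insert _ _).trans hts))
    have hfin := (hsum s subset_rfl).smul (show (0 : ℝ) ≤ 1 / (k + 2) by positivity)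
    refine hfin.congr fun x hx => ?_
    have h2 := posCone_esym_pos hx
    have hid := sum_mul_esym_erase s (k + 1) x
    have h3 : ∀ i ∈ s, x i - x i ^ 2 / (x i + esym (s.erase i) (k + 1) x / esym (s.erase i) k x)
        = x i * esym (s.erase i) (k + 1) x / esym s (k + 1) x := by
      intro i hi
      have h1 := posCone_esym_pos (posCone_erase hx hi)
      have h4 := esym_eq_erase hi k x
      have h5 : x i + esym (s.erase i) (k + 1) x / esym (s.erase i) k x
          = esym s (k + 1) x / esym (s.erase i) k x := by
        rw [h4]; field_simp; ring
      rw [h5]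
      field_simp
      rw [h4]; ring
    simp only [smul_eq_mul]
    rw [Finset.sum_congr rfl h3, ← Finset.sum_div, hid]
    push_cast
    field_simp
    ring

lemma convex_posCone (s : Finset ι) (k : ℕ) : Convex ℝ (posCone s k) :=
  (concaveOn_esym_div k s).1

/-- `log e_k` is concave on Gårding's cone `Γ_k`, being the sum of the logarithms of the concave
functions `e_{j+1} / e_j`, `j < k`. -/
theorem concaveOn_log_esym (s : Finset ι) (k : ℕ) :
    ConcaveOn ℝ (posCone s k) (fun x => Real.log (esym s k x)) := by
  induction k with
  | zero => simpa using concaveOn_const 0 (convex_posCone s 0)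
  | succ k ih =>
    have hc := convex_posCone s (k + 1)
    have hsub : posCone s (k + 1) ⊆ posCone s k := posCone_anti s (by omega)
    have h1 := ih.subset hsub hc
    have h2 := (concaveOn_esym_div k s).subset hsub hc
    have hpos : ∀ x ∈ posCone s (k + 1), 0 < esym s (k + 1) x / esym s k x := fun x hx =>
      div_pos (posCone_esym_pos hx) (posCone_esym_pos (hsub hx))
    have h3 : ConcaveOn ℝ (posCone s (k + 1))
        (fun x => Real.log (esym s (k + 1) x / esym s k x)) := by
      refine ⟨hc, fun x hx y hy a b ha hb hab => ?_⟩
      have hcx := strictConcaveOn_log_Ioi.concaveOn.2 (hpos x hx) (hpos y hy) ha hb hab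
      refine hcx.trans (Real.log_le_log ?_ (h2.2 hx hy ha hb hab))
      have := (convex_Ioi (0 : ℝ)) (hpos x hx) (hpos y hy) ha hb hab
      exact this
    refine (h1.add h3).congr fun x hx => ?_
    have e1 := posCone_esym_pos hx
    have e2 := posCone_esym_pos (hsub hx)
    rw [Pi.add_apply, ← Real.log_mul e2.ne' (div_pos e1 e2).ne']
    congr 1
    field_simp

end Garding

/-! ### The spectrum of the induced derivation -/

section Compound

variable {n m : ℕ}

/-- The `m`-th compound matrix, whose entries are the `m × m` minors of `A`; it is the matrix of the
map induced by `A` on the exterior power `⋀ᵐ ℝⁿ`. -/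
def compound (m : ℕ) (A : Matrix (Fin n) (Fin n) ℝ) :
    Matrix (MultiIndex n m) (MultiIndex n m) ℝ :=
  Matrix.of fun α β => (A.submatrix α.entries β.entries).det

/-- Multi-indices as the index type of the standard basis of an exterior power. -/
def multiIndexEquiv (n m : ℕ) : MultiIndex n m ≃ Set.powersetCard (Fin n) m :=
  ⟨fun s => ⟨s.1, s.2⟩, fun s => ⟨s.1, s.2⟩, fun _ => rfl, fun _ => rfl⟩

lemma compound_eq_toMatrix (A : Matrix (Fin n) (Fin n) ℝ) :
    compound m A = (LinearMap.toMatrix ((Pi.basisFun ℝ (Fin n)).exteriorPower m)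
      ((Pi.basisFun ℝ (Fin n)).exteriorPower m)
      (exteriorPower.map m (Matrix.toLin' A))).submatrix
        (multiIndexEquiv n m) (multiIndexEquiv n m) := by
  ext α β
  rw [Matrix.submatrix_apply, LinearMap.toMatrix_apply, exteriorPower.basis_apply,
    exteriorPower.map_apply_ιMulti_family, exteriorPower.basis_repr_apply,
    exteriorPower.ιMulti_family, exteriorPower.ιMultiDual_apply_ιMulti, compound, Matrix.of_apply,
    ← Matrix.det_transpose]
  congr 1
  ext i j
  simp only [Matrix.transpose_apply, Matrix.submatrix_apply, Matrix.of_apply, Function.comp_apply,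
    Module.Basis.coord_apply, Pi.basisFun_repr, Pi.basisFun_apply, Matrix.toLin'_apply,
    Matrix.mulVec_single_one, Matrix.col_apply]
  rfl

/-- The Cauchy–Binet formula. -/
lemma compound_mul (A B : Matrix (Fin n) (Fin n) ℝ) :
    compound m (A * B) = compound m A * compound m B := by
  classical
  rw [compound_eq_toMatrix, compound_eq_toMatrix, compound_eq_toMatrix, Matrix.submatrix_mul_equiv,
    ← LinearMap.toMatrix_comp, ← exteriorPower.map_comp, Matrix.toLin'_mul]

lemma compound_diagonal (d : Fin n → ℝ) :
    compound m (Matrix.diagonal d)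
      = Matrix.diagonal fun α : MultiIndex n m => ∏ i ∈ α.1, d i := by
  ext α β
  rw [compound, Matrix.of_apply, Matrix.diagonal_apply]
  split_ifs with h
  · subst h
    have : (Matrix.diagonal d).submatrix α.entries α.entries
        = Matrix.diagonal fun i => d (α.entries i) :=
      Matrix.submatrix_diagonal d _ (α.1.orderEmbOfFin α.2).injective
    rw [this, Matrix.det_diagonal]
    conv_rhs => rw [← Finset.image_orderEmbOfFin_univ α.1 α.2]
    rw [Finset.prod_image fun i _ j _ hij => (α.1.orderEmbOfFin α.2).injective hij]
    rfl
  · obtain ⟨a, ha, hb⟩ : ∃ a ∈ α.1, a ∉ β.1 := by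
      by_contra! hsub
      exact h (Subtype.ext (Finset.eq_of_subset_of_card_le hsub (by rw [α.2, β.2])))
    obtain ⟨i, hi⟩ : ∃ i, α.entries i = a := by
      have : a ∈ Set.range (α.1.orderEmbOfFin α.2) := by
        rw [Finset.range_orderEmbOfFin]; exact ha
      exact this
    refine Matrix.det_eq_zero_of_row_eq_zero i fun j => ?_
    rw [Matrix.submatrix_apply, Matrix.diagonal_apply_ne]
    intro heq
    apply hb
    rw [← hi, heq]
    exact Finset.orderEmbOfFin_mem β.1 β.2 j

lemma compound_one : compound m (1 : Matrix (Fin n) (Fin n) ℝ) = 1 := by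
  rw [← Matrix.diagonal_one, compound_diagonal]
  simp

lemma hasDerivAt_det_add_smul (X Y : Matrix (Fin m) (Fin m) ℝ) :
    HasDerivAt (fun t : ℝ => (X + t • Y).det) (∑ i, (X.updateRow i (Y i)).det) 0 := by
  simp_rw [Matrix.det_apply]
  rw [Finset.sum_comm]
  refine HasDerivAt.fun_sum fun σ _ => ?_
  rw [← Finset.smul_sum]
  refine HasDerivAt.fun_const_smul _ ?_
  have h1 : ∀ l : Fin m, HasDerivAt (fun t : ℝ => (X + t • Y) (σ l) l) (Y (σ l) l) 0 := by
    intro l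
    simp only [Matrix.add_apply, Matrix.smul_apply, smul_eq_mul]
    simpa using ((hasDerivAt_id (0 : ℝ)).mul_const (Y (σ l) l)).const_add (X (σ l) l)
  have h2 := HasDerivAt.fun_finsetProd (u := Finset.univ) fun l _ => h1 l
  refine h2.congr_deriv ?_
  refine Eq.trans ?_ (Equiv.sum_comp σ _)
  refine Finset.sum_congr rfl fun l _ => ?_
  rw [← Finset.mul_prod_erase _ _ (Finset.mem_univ l), Matrix.updateRow_self, smul_eq_mul, mul_comm]
  congr 1
  refine Finset.prod_congr rfl fun j hj => ?_
  rw [Matrix.updateRow_ne (fun h => (Finset.ne_of_mem_erase hj) (σ.injective h))]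
  simp

/-- The induced derivation is the derivative of the induced map. -/
lemma hasDerivAt_compound (A : Matrix (Fin n) (Fin n) ℝ) (α β : MultiIndex n m) :
    HasDerivAt (fun t : ℝ => compound m (1 + t • A) α β) (wMatrix m A α β) 0 := by
  have h := hasDerivAt_det_add_smul ((1 : Matrix (Fin n) (Fin n) ℝ).submatrix α.entries β.entries)
    (A.submatrix α.entries β.entries)
  refine h.congr_deriv ?_
  rw [wMatrix, Matrix.of_apply]
  refine Finset.sum_congr rfl fun i _ => ?_
  set X := (1 : Matrix (Fin n) (Fin n) ℝ).submatrix α.entries β.entries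
  have hrow : (A.submatrix α.entries β.entries) i
      = ∑ j, A (α.entries i) j • fun l => if j = β.entries l then (1 : ℝ) else 0 := by
    ext l
    simp
  let L : (Fin m → ℝ) →ₗ[ℝ] ℝ :=
    { toFun := fun v => (X.updateRow i v).det
      map_add' := fun v w => Matrix.det_updateRow_add X i v w
      map_smul' := fun c v => Matrix.det_updateRow_smul X i c v }
  change L ((A.submatrix α.entries β.entries) i) = _
  rw [hrow, map_sum]
  refine Finset.sum_congr rfl fun j _ => ?_
  rw [map_smul, smul_eq_mul, genKronecker]
  congr 1
  change (X.updateRow i _).det = _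
  congr 1
  ext a b
  rw [Matrix.of_apply, Matrix.updateRow_apply, Function.update_apply]
  split_ifs <;> simp_all [X, Matrix.one_apply]

lemma wMatrix_diagonal (d : Fin n → ℝ) :
    wMatrix m (Matrix.diagonal d)
      = Matrix.diagonal fun α : MultiIndex n m => ∑ i ∈ α.1, d i := by
  ext α β
  refine (hasDerivAt_compound (Matrix.diagonal d) α β).unique ?_
  have h0 : ∀ t : ℝ, (1 + t • Matrix.diagonal d : Matrix (Fin n) (Fin n) ℝ)
      = Matrix.diagonal fun i => 1 + t * d i := by
    intro t
    ext i j
    by_cases hij : i = j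
    · subst hij; simp
    · simp [hij]
  simp_rw [h0, compound_diagonal, Matrix.diagonal_apply]
  split_ifs with h
  · have h1 : ∀ l ∈ α.1, HasDerivAt (fun t : ℝ => 1 + t * d l) (d l) 0 := by
      intro l _
      simpa using ((hasDerivAt_id (0 : ℝ)).mul_const (d l)).const_add 1
    refine (HasDerivAt.fun_finsetProd h1).congr_deriv ?_
    simp
  · exact hasDerivAt_const _ _

lemma wMatrix_conj {P R : Matrix (Fin n) (Fin n) ℝ} (h : P * R = 1)
    (A : Matrix (Fin n) (Fin n) ℝ) :
    wMatrix m (P * A * R) = compound m P * wMatrix m A * compound m R := by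
  ext α β
  refine (hasDerivAt_compound _ α β).unique ?_
  have h0 : ∀ t : ℝ, 1 + t • (P * A * R) = P * (1 + t • A) * R := by
    intro t
    rw [Matrix.mul_add, Matrix.add_mul, Matrix.mul_one, h, Matrix.mul_smul, Matrix.smul_mul]
  simp_rw [h0, compound_mul, Matrix.mul_apply]
  refine HasDerivAt.fun_sum fun γ _ => HasDerivAt.mul_const ?_ _
  exact HasDerivAt.fun_sum fun γ' _ => HasDerivAt.const_mul _ (hasDerivAt_compound A _ _)

/-- The sums of `m` of the numbers `x 1, …, x n`. -/
def multiSum (m : ℕ) (x : Fin n → ℝ) : MultiIndex n m → ℝ :=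
  fun α => ∑ i ∈ α.1, x i

lemma eigenvalues_wMatrix {A : Matrix (Fin n) (Fin n) ℝ} (hA : A.IsHermitian) :
    eigenvalues (wMatrix m A)
      = (Finset.univ : Finset (MultiIndex n m)).val.map (multiSum m hA.eigenvalues) := by
  set U : Matrix (Fin n) (Fin n) ℝ := (hA.eigenvectorUnitary : Matrix (Fin n) (Fin n) ℝ)
  have hU : U * star U = 1 := Unitary.coe_mul_star_self _
  have hU' : star U * U = 1 := Unitary.coe_star_mul_self _
  have hsp : A = U * Matrix.diagonal hA.eigenvalues * star U := by
    conv_lhs => rw [hA.spectral_theorem, Unitary.conjStarAlgAut_apply]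
    rfl
  have hW : wMatrix m A = compound m U * (wMatrix m (Matrix.diagonal hA.eigenvalues)
      * compound m (star U)) := by
    conv_lhs => rw [hsp]
    rw [wMatrix_conj hU, Matrix.mul_assoc]
  rw [eigenvalues, hW, Matrix.charpoly_mul_comm, Matrix.mul_assoc, ← compound_mul, hU',
    compound_one, Matrix.mul_one, wMatrix_diagonal, Matrix.charpoly_diagonal,
    Polynomial.roots_prod _ _ (Finset.prod_ne_zero_iff.2 fun i _ =>
      Polynomial.X_sub_C_ne_zero _)]
  simp only [Polynomial.roots_X_sub_C, Multiset.bind_singleton]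
  rfl

lemma sigma_wMatrix {A : Matrix (Fin n) (Fin n) ℝ} (hA : A.IsHermitian) (k : ℕ) :
    sigma k (wMatrix m A) = esym Finset.univ k (multiSum m hA.eigenvalues) := by
  rw [sigma, eigenvalues_wMatrix hA, Finset.esymm_map_val]
  rfl

lemma powersetCard_map_sum (x : Fin n → ℝ) :
    (((Finset.univ : Finset (Fin n)).val.map x).powersetCard m).map Multiset.sum
      = (Finset.univ : Finset (MultiIndex n m)).val.map (multiSum m x) := by
  rw [Multiset.powersetCard_map, Multiset.map_map]
  have h1 : Multiset.powersetCard m (Finset.univ : Finset (Fin n)).val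
      = ((Finset.univ : Finset (MultiIndex n m)).val.map Subtype.val).map Finset.val := by
    rw [← Finset.map_val_val_powersetCard]
    congr 1
    have h2 : Finset.powersetCard m (Finset.univ : Finset (Fin n))
        = (Finset.univ : Finset (MultiIndex n m)).map (Function.Embedding.subtype _) := by
      ext s
      simp [Finset.mem_powersetCard]
    rw [h2]
    rfl
  rw [h1, Multiset.map_map, Multiset.map_map]
  rfl

lemma mem_genGardingCone_iff {A : Matrix (Fin n) (Fin n) ℝ} (hA : A.IsHermitian) (k : ℕ) :
    eigenvalues A ∈ genGardingCone m k
      ↔ multiSum m hA.eigenvalues ∈ posCone (Finset.univ : Finset (MultiIndex n m)) k := by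
  have h : eigenvalues A = (Finset.univ : Finset (Fin n)).val.map hA.eigenvalues := by
    rw [eigenvalues, hA.roots_charpoly_eq_eigenvalues]
    rfl
  rw [h]
  change (∀ i : ℕ, 1 ≤ i → i ≤ k → 0 < (Multiset.map Multiset.sum _).esymm i) ↔ _
  rw [powersetCard_map_sum]
  simp_rw [Finset.esymm_map_val]
  rfl

end Compound

/-! ### The operator as a function of the eigenvalues of the Hessian -/

section Operator

variable {n m k : ℕ}

/-- The eigenvalue vectors of admissible Hessians. -/
def admCone (n m k : ℕ) : Set (Fin n → ℝ) :=
  {x | multiSum m x ∈ posCone (Finset.univ : Finset (MultiIndex n m)) k}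

/-- `log S_k` of the `m`-fold sums of `x`. -/
def logOp (m k : ℕ) (x : Fin n → ℝ) : ℝ :=
  Real.log (esym (Finset.univ : Finset (MultiIndex n m)) k (multiSum m x))

/-- `multiSum` as a linear map. -/
def multiSumₗ (n m : ℕ) : (Fin n → ℝ) →ₗ[ℝ] (MultiIndex n m → ℝ) where
  toFun := multiSum m
  map_add' x y := by ext α; simp [multiSum, Finset.sum_add_distrib]
  map_smul' c x := by ext α; simp [multiSum, Finset.mul_sum]

lemma concaveOn_logOp (n m k : ℕ) : ConcaveOn ℝ (admCone n m k) (logOp m k) :=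
  (concaveOn_log_esym (Finset.univ : Finset (MultiIndex n m)) k).comp_linearMap (multiSumₗ n m)

lemma multiSum_smul (c : ℝ) (x : Fin n → ℝ) : multiSum m (c • x) = c • multiSum m x :=
  (multiSumₗ n m).map_smul c x

lemma esym_smul {ι : Type*} (s : Finset ι) (j : ℕ) (c : ℝ) (x : ι → ℝ) :
    esym s j (c • x) = c ^ j * esym s j x := by
  rw [esym, esym, Finset.mul_sum]
  refine Finset.sum_congr rfl fun t ht => ?_
  simp only [Pi.smul_apply, smul_eq_mul]
  rw [Finset.prod_mul_distrib, Finset.prod_const, (Finset.mem_powersetCard.1 ht).2]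

lemma smul_mem_admCone {c : ℝ} (hc : 0 < c) {x : Fin n → ℝ} (hx : x ∈ admCone n m k) :
    c • x ∈ admCone n m k := by
  intro j h1 h2
  rw [multiSum_smul, esym_smul]
  exact mul_pos (pow_pos hc j) (hx j h1 h2)

lemma logOp_smul {c : ℝ} (hc : 0 < c) {x : Fin n → ℝ} (hx : x ∈ admCone n m k) :
    logOp m k (c • x) = k * Real.log c + logOp m k x := by
  rw [logOp, multiSum_smul, esym_smul, Real.log_mul (pow_pos hc k).ne' (posCone_esym_pos hx).ne',
    Real.log_pow, logOp]

lemma esym_multiSum_comp_perm (σ : Equiv.Perm (Fin n)) (j : ℕ) (x : Fin n → ℝ) :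
    esym (Finset.univ : Finset (MultiIndex n m)) j (multiSum m (x ∘ σ))
      = esym (Finset.univ : Finset (MultiIndex n m)) j (multiSum m x) := by
  have h : ∀ y : Fin n → ℝ, esym (Finset.univ : Finset (MultiIndex n m)) j (multiSum m y)
      = ((((Finset.univ : Finset (Fin n)).val.map y).powersetCard m).map
          Multiset.sum).esymm j := by
    intro y
    rw [powersetCard_map_sum, Finset.esymm_map_val]
    rfl
  rw [h, h]
  congr 3
  rw [← Multiset.map_map]
  congr 1
  exact Multiset.map_univ_val_equiv σ

lemma comp_perm_mem_admCone (σ : Equiv.Perm (Fin n)) {x : Fin n → ℝ} (hx : x ∈ admCone n m k) :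
    x ∘ σ ∈ admCone n m k := by
  intro j h1 h2
  rw [esym_multiSum_comp_perm]
  exact hx j h1 h2

/-- By Birkhoff's theorem a doubly stochastic matrix averages over permutations, so that it
preserves the admissible cone and does not decrease a symmetric concave function. -/
lemma logOp_le_of_doublyStochastic {S : Matrix (Fin n) (Fin n) ℝ}
    (hS : S ∈ doublyStochastic ℝ (Fin n)) {x : Fin n → ℝ} (hx : x ∈ admCone n m k) :
    S.mulVec x ∈ admCone n m k ∧ logOp m k x ≤ logOp m k (S.mulVec x) := by
  obtain ⟨w, hw0, hw1, rfl⟩ := exists_eq_sum_perm_of_mem_doublyStochastic hS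
  have h : (∑ σ, w σ • σ.permMatrix ℝ).mulVec x = ∑ σ, w σ • (x ∘ σ) := by
    rw [Matrix.sum_mulVec]
    refine Finset.sum_congr rfl fun σ _ => ?_
    rw [Matrix.smul_mulVec, Matrix.permMatrix_mulVec]
  rw [h]
  have hmem : ∀ σ ∈ (Finset.univ : Finset (Equiv.Perm (Fin n))), x ∘ σ ∈ admCone n m k :=
    fun σ _ => comp_perm_mem_admCone σ hx
  refine ⟨(concaveOn_logOp n m k).1.sum_mem (fun σ _ => hw0 σ) hw1 hmem, ?_⟩
  have := (concaveOn_logOp n m k).le_map_sum (fun σ _ => hw0 σ) hw1 hmem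
  refine le_trans (le_of_eq ?_) this
  have h2 : ∀ σ : Equiv.Perm (Fin n), logOp m k (x ∘ σ) = logOp m k x := by
    intro σ
    rw [logOp, esym_multiSum_comp_perm, logOp]
  simp_rw [h2, smul_eq_mul, ← Finset.sum_mul, hw1, one_mul]

lemma differentiable_esym_multiSum (j : ℕ) :
    Differentiable ℝ fun x : Fin n → ℝ =>
      esym (Finset.univ : Finset (MultiIndex n m)) j (multiSum m x) := by
  unfold esym multiSum
  refine Differentiable.fun_sum fun t _ => ?_
  fun_prop

lemma differentiableAt_logOp {x : Fin n → ℝ} (hx : x ∈ admCone n m k) :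
    DifferentiableAt ℝ (logOp m k) x :=
  (differentiable_esym_multiSum k x).log (posCone_esym_pos hx).ne'

lemma logOp_le_add_fderiv {x y : Fin n → ℝ} (hx : x ∈ admCone n m k) (hy : y ∈ admCone n m k) :
    logOp m k y ≤ logOp m k x + fderiv ℝ (logOp m k) x (y - x) := by
  have hc : ConcaveOn ℝ (Icc 0 1) (fun t : ℝ => logOp m k (AffineMap.lineMap x y t)) := by
    refine ((concaveOn_logOp n m k).comp_affineMap (AffineMap.lineMap x y)).subset ?_
      (convex_Icc 0 1)
    intro t ht
    exact (concaveOn_logOp n m k).1.segment_subset hx hy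
      (by rw [segment_eq_image_lineMap]; exact ⟨t, ht, rfl⟩)
  have hd : HasDerivAt (fun t : ℝ => logOp m k (AffineMap.lineMap x y t))
      (fderiv ℝ (logOp m k) x (y - x)) 0 := by
    have h1 : HasFDerivAt (logOp m k) (fderiv ℝ (logOp m k) x) (AffineMap.lineMap x y (0 : ℝ)) := by
      rw [AffineMap.lineMap_apply_zero]
      exact (differentiableAt_logOp hx).hasFDerivAt
    exact h1.comp_hasDerivAt (0 : ℝ) AffineMap.hasDerivAt_lineMap
  have hs := hc.slope_le_of_hasDerivAt (left_mem_Icc.2 zero_le_one) (right_mem_Icc.2 zero_le_one)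
    zero_lt_one hd
  rw [slope_def_field] at hs
  simp only [AffineMap.lineMap_apply_one, AffineMap.lineMap_apply_zero] at hs
  linarith

/-- Along directions in the admissible cone the gradient of `logOp` is positive, quantitatively. -/
lemma le_fderiv_logOp {x w : Fin n → ℝ} (hx : x ∈ admCone n m k) (hw : w ∈ admCone n m k) {s : ℝ}
    (hs : 0 < s) :
    k * Real.log s + logOp m k w - logOp m k x ≤ s * fderiv ℝ (logOp m k) x w := by
  have h1 := logOp_le_add_fderiv hx (smul_mem_admCone hs hw)
  have h2 := logOp_le_add_fderiv hx (smul_mem_admCone two_pos hx)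
  rw [logOp_smul hs hw, map_sub, map_smul, smul_eq_mul] at h1
  rw [logOp_smul two_pos hx, map_sub, map_smul, smul_eq_mul] at h2
  have h3 : 0 ≤ (k : ℝ) * Real.log 2 := mul_nonneg (Nat.cast_nonneg k) (Real.log_nonneg one_le_two)
  linarith

lemma fderiv_logOp_pos {x w : Fin n → ℝ} (hk : 1 ≤ k) (hx : x ∈ admCone n m k)
    (hw : w ∈ admCone n m k) : 0 < fderiv ℝ (logOp m k) x w := by
  set B := logOp m k x - logOp m k w
  have h := le_fderiv_logOp hx hw (Real.exp_pos (|B| + 1))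
  rw [Real.log_exp] at h
  have hk' : (1 : ℝ) ≤ k := by exact_mod_cast hk
  have h1 : |B| + 1 ≤ k * (|B| + 1) := le_mul_of_one_le_left (by positivity) hk'
  have h2 : 0 < Real.exp (|B| + 1) * fderiv ℝ (logOp m k) x w := by
    have := le_abs_self B
    simp only [B] at *
    linarith
  exact (mul_pos_iff_of_pos_left (Real.exp_pos _)).1 h2

lemma esym_pos_of_support {ι : Type*} {s A : Finset ι} (hA : A ⊆ s) {x : ι → ℝ}
    (h0 : ∀ i ∈ s, 0 ≤ x i) (hpos : ∀ i ∈ A, 0 < x i) {j : ℕ} (hj : j ≤ A.card) :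
    0 < esym s j x := by
  obtain ⟨t, htA, htc⟩ := Finset.exists_subset_card_eq hj
  refine Finset.sum_pos' (fun t' ht' => ?_) ⟨t, ?_, ?_⟩
  · exact Finset.prod_nonneg fun i hi => h0 i ((Finset.mem_powersetCard.1 ht').1 hi)
  · exact Finset.mem_powersetCard.2 ⟨htA.trans hA, htc⟩
  · exact Finset.prod_pos fun i hi => hpos i (htA hi)

lemma choose_le_card_multiIndex (hm : 1 ≤ m) (i : Fin n) :
    (n - 1).choose (m - 1)
      ≤ (Finset.univ.filter fun α : MultiIndex n m => i ∈ α.1).card := by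
  have h1 : (Finset.powersetCard (m - 1) (Finset.univ.erase i)).card
      = (n - 1).choose (m - 1) := by
    rw [Finset.card_powersetCard, Finset.card_erase_of_mem (Finset.mem_univ i), Finset.card_univ,
      Fintype.card_fin]
  rw [← h1]
  refine Finset.card_le_card_of_surjOn (fun α => α.1.erase i) fun t ht => ?_
  obtain ⟨ht1, ht2⟩ := Finset.mem_powersetCard.1 ht
  have hi : i ∉ t := fun h => Finset.notMem_erase i _ (ht1 h)
  have hc : (insert i t).card = m := by
    rw [Finset.card_insert_of_notMem hi, ht2]
    omega
  exact ⟨⟨insert i t, hc⟩, by simp, Finset.erase_insert hi⟩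

lemma const_mem_admCone (hm : 1 ≤ m) (hmn : m ≤ n) (hkn : k ≤ (n - 1).choose (m - 1)) {c : ℝ}
    (hc : 0 < c) : (fun _ => c : Fin n → ℝ) ∈ admCone n m k := by
  have hpos : ∀ α : MultiIndex n m, 0 < multiSum m (fun _ => c : Fin n → ℝ) α := by
    intro α
    refine Finset.sum_pos (fun _ _ => hc) ?_
    rw [← Finset.card_pos, α.2]
    omega
  intro j h1 h2
  refine esym_pos_of_support (Finset.Subset.refl _) (fun α _ => (hpos α).le) (fun α _ => hpos α) ?_
  refine (h2.trans hkn).trans ((choose_le_card_multiIndex hm ⟨0, by omega⟩).trans ?_)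
  exact Finset.card_le_card (Finset.filter_subset _ _)

/-- This is where `k ≤ C(n-1, m-1)` enters: the coordinate directions are interior to the
admissible cone, because `C(n-1, m-1)` of the `m`-fold sums contain a given eigenvalue. -/
lemma exists_single_sub_mem_admCone (hm : 1 ≤ m) (hkn : k ≤ (n - 1).choose (m - 1)) :
    ∃ c : ℝ, 0 < c ∧ ∀ i : Fin n, (Pi.single i 1 - fun _ => c : Fin n → ℝ) ∈ admCone n m k := by
  have h : ∀ i : Fin n, ∀ᶠ c : ℝ in 𝓝 0,
      (Pi.single i 1 - fun _ => c : Fin n → ℝ) ∈ admCone n m k := by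
    intro i
    have h1 : ∀ j ∈ Finset.Icc 1 k, ∀ᶠ c : ℝ in 𝓝 0,
        0 < esym (Finset.univ : Finset (MultiIndex n m)) j
          (multiSum m (Pi.single i 1 - fun _ => c : Fin n → ℝ)) := by
      intro j hj
      have hcont : Continuous fun c : ℝ => esym (Finset.univ : Finset (MultiIndex n m)) j
          (multiSum m (Pi.single i 1 - fun _ => c : Fin n → ℝ)) :=
        (differentiable_esym_multiSum (m := m) j).continuous.comp
          (continuous_const.sub (continuous_pi fun _ => continuous_id))
      refine hcont.continuousAt.eventually (lt_mem_nhds ?_)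
      have h0 : (Pi.single i 1 - fun _ => 0 : Fin n → ℝ) = Pi.single i 1 := by
        ext l; simp
      simp only [h0]
      have hval : ∀ α : MultiIndex n m,
          multiSum m (Pi.single i 1 : Fin n → ℝ) α = if i ∈ α.1 then 1 else 0 := by
        intro α
        simp [multiSum, Pi.single_apply]
      refine esym_pos_of_support
        (A := Finset.univ.filter fun α : MultiIndex n m => i ∈ α.1) (Finset.filter_subset _ _)
        (fun α _ => ?_) (fun α hα => ?_)
        (((Finset.mem_Icc.1 hj).2.trans hkn).trans (choose_le_card_multiIndex hm i))
      · rw [hval]; split_ifs <;> norm_num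
      · rw [hval, if_pos (Finset.mem_filter.1 hα).2]; norm_num
    have h2 := (Finset.eventually_all (Finset.Icc 1 k)).2 h1
    filter_upwards [h2] with c hc j hj1 hj2
    exact hc j (Finset.mem_Icc.2 ⟨hj1, hj2⟩)
  have h3 := (eventually_all.2 h).filter_mono (nhdsWithin_le_nhds (s := Ioi 0))
  obtain ⟨c, hc1, hc2⟩ := (h3.and self_mem_nhdsWithin).exists
  exact ⟨c, hc2, hc1⟩

lemma sum_pos_of_mem_admCone (hk : 1 ≤ k) {x : Fin n → ℝ} (hx : x ∈ admCone n m k) :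
    0 < ∑ i, x i := by
  rcases Nat.eq_zero_or_pos n with rfl | hn
  · exfalso
    have h := hx 1 le_rfl hk
    rw [esym_one] at h
    refine h.ne' (Finset.sum_eq_zero fun α _ => Finset.sum_eq_zero fun i _ => i.elim0)
  have hn' : (0 : ℝ) < n := by exact_mod_cast hn
  -- averaging over all permutations replaces `x` by its mean
  have hS : (Matrix.of fun _ _ => (n : ℝ)⁻¹ : Matrix (Fin n) (Fin n) ℝ)
      ∈ doublyStochastic ℝ (Fin n) := by
    rw [mem_doublyStochastic_iff_sum]
    refine ⟨fun _ _ => by simp, fun _ => ?_, fun _ => ?_⟩ <;> simp [hn'.ne']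
  have h := (logOp_le_of_doublyStochastic hS hx).1 1 le_rfl hk
  have hS2 : (Matrix.of fun _ _ => (n : ℝ)⁻¹ : Matrix (Fin n) (Fin n) ℝ).mulVec x
      = fun _ => (n : ℝ)⁻¹ * ∑ i, x i := by
    ext i
    simp [Matrix.mulVec, dotProduct, Finset.mul_sum]
  rw [hS2, esym_one] at h
  by_contra! hneg
  refine h.not_ge (Finset.sum_nonpos fun α _ => Finset.sum_nonpos fun i _ => ?_)
  exact mul_nonpos_of_nonneg_of_nonpos (by positivity) hneg

/-- The quadratic form of a matrix. -/
def quadForm (A : Matrix (Fin n) (Fin n) ℝ) (v : EuclideanSpace ℝ (Fin n)) : ℝ :=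
  inner ℝ v (Matrix.toEuclideanLin A v)

lemma quadForm_eq_sum {B : Matrix (Fin n) (Fin n) ℝ} (hB : B.IsHermitian)
    (v : EuclideanSpace ℝ (Fin n)) :
    quadForm B v = ∑ l, inner ℝ v (hB.eigenvectorBasis l) ^ 2 * hB.eigenvalues l := by
  rw [quadForm, ← hB.eigenvectorBasis.sum_inner_mul_inner]
  refine Finset.sum_congr rfl fun l _ => ?_
  have hsym := (Matrix.isSymmetric_toEuclideanLin_iff.2 hB) (hB.eigenvectorBasis l) v
  have heig : Matrix.toEuclideanLin B (hB.eigenvectorBasis l)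
      = hB.eigenvalues l • hB.eigenvectorBasis l := by
    have := hB.mulVec_eigenvectorBasis l
    ext i
    exact congrFun this i
  rw [← hsym, heig, real_inner_smul_left, real_inner_comm v]
  ring

lemma quadForm_eigenvectorBasis {A : Matrix (Fin n) (Fin n) ℝ} (hA : A.IsHermitian) (j : Fin n) :
    quadForm A (hA.eigenvectorBasis j) = hA.eigenvalues j := by
  rw [quadForm_eq_sum hA, Finset.sum_eq_single j]
  · simp
  · intro l _ hl
    rw [hA.eigenvectorBasis.inner_eq_zero hl.symm]
    simp
  · simp

/-- The linearization of `log S_k(W)` at an admissible matrix `A`, with its ellipticity: the ratio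
`c` of ellipticity depends on the dimensions only, and the trace is bounded below in terms of an
upper bound for the operator. -/
theorem exists_linearization (hm : 1 ≤ m) (hmn : m ≤ n) (hk : 1 ≤ k)
    (hkn : k ≤ (n - 1).choose (m - 1)) (L : ℝ) :
    ∃ c > 0, ∃ c₀ > 0, ∀ A : Matrix (Fin n) (Fin n) ℝ, A.IsHermitian →
      eigenvalues A ∈ genGardingCone m k → Real.log (sigma k (wMatrix m A)) ≤ L →
      ∃ (q : OrthonormalBasis (Fin n) ℝ (EuclideanSpace ℝ (Fin n))) (F : Fin n → ℝ),
        (∀ j, c * ∑ i, F i ≤ F j) ∧ c₀ ≤ ∑ i, F i ∧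
        ∀ B : Matrix (Fin n) (Fin n) ℝ, B.IsHermitian → eigenvalues B ∈ genGardingCone m k →
          Real.log (sigma k (wMatrix m B)) - Real.log (sigma k (wMatrix m A))
            ≤ ∑ j, F j * (quadForm B (q j) - quadForm A (q j)) := by
  obtain ⟨c, hc, hcmem⟩ := exists_single_sub_mem_admCone hm hkn
  have h1mem := const_mem_admCone (n := n) hm hmn hkn one_pos
  set ℓ := logOp m k (fun _ => 1 : Fin n → ℝ)
  refine ⟨c, hc, Real.exp (-(|L| + |ℓ| + 1)), Real.exp_pos _, fun A hA hAmem hAL => ?_⟩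
  rw [mem_genGardingCone_iff hA] at hAmem
  set μ := hA.eigenvalues with hμ
  have hμmem : μ ∈ admCone n m k := hAmem
  have hval : Real.log (sigma k (wMatrix m A)) = logOp m k μ := by
    rw [sigma_wMatrix hA, logOp]
  set D := fderiv ℝ (logOp m k) μ
  have hsum : ∀ w : Fin n → ℝ, D w = ∑ j, D (Pi.single j 1) * w j := by
    intro w
    conv_lhs => rw [pi_eq_sum_univ' w, map_sum]
    refine Finset.sum_congr rfl fun j _ => ?_
    rw [map_smul, smul_eq_mul, mul_comm]
  have hT : ∑ j, D (Pi.single j 1) = D (fun _ => 1) := by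
    rw [hsum (fun _ => 1)]
    simp
  refine ⟨hA.eigenvectorBasis, fun j => D (Pi.single j 1), fun j => ?_, ?_, ?_⟩
  · have h := fderiv_logOp_pos hk hμmem (hcmem j)
    have hcc : (fun _ => c : Fin n → ℝ) = c • fun _ => 1 := by ext; simp
    rw [map_sub, hcc, map_smul, smul_eq_mul] at h
    rw [hT]
    exact (sub_pos.1 h).le
  · rw [hT]
    have h := le_fderiv_logOp hμmem h1mem (Real.exp_pos (|L| + |ℓ| + 1))
    rw [Real.log_exp] at h
    have hk' : (1 : ℝ) ≤ k := by exact_mod_cast hk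
    have h1 : |L| + |ℓ| + 1 ≤ k * (|L| + |ℓ| + 1) := le_mul_of_one_le_left (by positivity) hk'
    have h2 : 1 ≤ Real.exp (|L| + |ℓ| + 1) * D (fun _ => 1) := by
      have h3 := le_abs_self L
      have h4 := neg_abs_le ℓ
      rw [hval] at hAL
      change _ + ℓ - _ ≤ _ at h
      linarith
    rw [Real.exp_neg, inv_le_iff_one_le_mul₀' (Real.exp_pos _)]
    exact h2
  · intro B hB hBmem
    rw [mem_genGardingCone_iff hB] at hBmem
    have hS : (Matrix.of fun j l => inner ℝ (hA.eigenvectorBasis j) (hB.eigenvectorBasis l) ^ 2 :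
        Matrix (Fin n) (Fin n) ℝ) ∈ doublyStochastic ℝ (Fin n) := by
      rw [mem_doublyStochastic_iff_sum]
      refine ⟨fun _ _ => sq_nonneg _, fun j => ?_, fun l => ?_⟩
      · have := hB.eigenvectorBasis.sum_sq_norm_inner_left (hA.eigenvectorBasis j)
        simpa using this
      · have := hA.eigenvectorBasis.sum_sq_norm_inner_right (hB.eigenvectorBasis l)
        simpa using this
    obtain ⟨hSmem, hSle⟩ := logOp_le_of_doublyStochastic hS (x := hB.eigenvalues) hBmem
    have hdiag : (Matrix.of fun j l => inner ℝ (hA.eigenvectorBasis j) (hB.eigenvectorBasis l) ^ 2 :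
        Matrix (Fin n) (Fin n) ℝ).mulVec hB.eigenvalues
        = fun j => quadForm B (hA.eigenvectorBasis j) := by
      ext j
      rw [quadForm_eq_sum hB]
      rfl
    rw [hdiag] at hSmem hSle
    have hsup := logOp_le_add_fderiv hμmem hSmem
    have hvalB : Real.log (sigma k (wMatrix m B)) = logOp m k hB.eigenvalues := by
      rw [sigma_wMatrix hB, logOp]
    rw [hval, hvalB]
    have hfin : D ((fun j => quadForm B (hA.eigenvectorBasis j)) - μ)
        = ∑ j, D (Pi.single j 1) *
          (quadForm B (hA.eigenvectorBasis j) - quadForm A (hA.eigenvectorBasis j)) := by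
      rw [hsum]
      refine Finset.sum_congr rfl fun j _ => ?_
      rw [quadForm_eigenvectorBasis hA]
      rfl
    rw [← hfin]
    linarith

/-- Since the trace is positive, the Hessian is controlled by its largest eigenvalue. -/
lemma exists_norm_le_quadForm (hk : 1 ≤ k) {A : Matrix (Fin n) (Fin n) ℝ} (hA : A.IsHermitian)
    (hadm : eigenvalues A ∈ genGardingCone m k) :
    ∃ v : EuclideanSpace ℝ (Fin n), ‖v‖ = 1 ∧ ∀ x y : EuclideanSpace ℝ (Fin n),
      |inner ℝ x (Matrix.toEuclideanLin A y)| ≤ 2 * n * quadForm A v * ‖x‖ * ‖y‖ := by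
  rw [mem_genGardingCone_iff hA] at hadm
  have htr := sum_pos_of_mem_admCone hk (x := hA.eigenvalues) hadm
  have hne : (Finset.univ : Finset (Fin n)).Nonempty := by
    by_contra h
    rw [Finset.not_nonempty_iff_eq_empty.1 h, Finset.sum_empty] at htr
    exact lt_irrefl _ htr
  obtain ⟨j, -, hj⟩ := Finset.exists_max_image Finset.univ hA.eigenvalues hne
  have hjpos : 0 ≤ hA.eigenvalues j := by
    by_contra! h
    exact htr.not_ge (Finset.sum_nonpos fun i hi => (hj i hi).trans h.le)
  refine ⟨hA.eigenvectorBasis j, hA.eigenvectorBasis.norm_eq_one j, fun x y => ?_⟩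
  rw [quadForm_eigenvectorBasis hA, ← hA.eigenvectorBasis.sum_inner_mul_inner]
  have habs : ∑ l, |hA.eigenvalues l| ≤ 2 * n * hA.eigenvalues j := by
    have h1 : ∀ l, |hA.eigenvalues l| ≤ 2 * hA.eigenvalues j - hA.eigenvalues l := by
      intro l
      have := hj l (Finset.mem_univ l)
      rw [abs_le]
      constructor <;> linarith
    calc ∑ l, |hA.eigenvalues l| ≤ ∑ l, (2 * hA.eigenvalues j - hA.eigenvalues l) :=
          Finset.sum_le_sum fun l _ => h1 l
      _ = n * (2 * hA.eigenvalues j) - ∑ l, hA.eigenvalues l := by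
          rw [Finset.sum_sub_distrib, Finset.sum_const, Finset.card_univ, Fintype.card_fin,
            nsmul_eq_mul]
      _ ≤ _ := by linarith
  have hterm : ∀ l, |inner ℝ x (hA.eigenvectorBasis l) *
      inner ℝ (hA.eigenvectorBasis l) (Matrix.toEuclideanLin A y)|
        ≤ |hA.eigenvalues l| * (‖x‖ * ‖y‖) := by
    intro l
    have hsym := (Matrix.isSymmetric_toEuclideanLin_iff.2 hA) (hA.eigenvectorBasis l) y
    have heig : Matrix.toEuclideanLin A (hA.eigenvectorBasis l)
        = hA.eigenvalues l • hA.eigenvectorBasis l := by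
      have := hA.mulVec_eigenvectorBasis l
      ext i
      exact congrFun this i
    rw [← hsym, heig, real_inner_smul_left, abs_mul, abs_mul]
    have h1 := abs_real_inner_le_norm x (hA.eigenvectorBasis l)
    have h2 := abs_real_inner_le_norm (hA.eigenvectorBasis l) y
    rw [hA.eigenvectorBasis.norm_eq_one, mul_one] at h1
    rw [hA.eigenvectorBasis.norm_eq_one, one_mul] at h2
    calc _ = |hA.eigenvalues l| * (|inner ℝ x (hA.eigenvectorBasis l)|
          * |inner ℝ (hA.eigenvectorBasis l) y|) := by ring
      _ ≤ _ := by gcongr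
  calc _ ≤ ∑ l, |hA.eigenvalues l| * (‖x‖ * ‖y‖) :=
        (Finset.abs_sum_le_sum_abs _ _).trans (Finset.sum_le_sum fun l _ => hterm l)
    _ = (∑ l, |hA.eigenvalues l|) * (‖x‖ * ‖y‖) := by rw [Finset.sum_mul]
    _ ≤ 2 * n * hA.eigenvalues j * (‖x‖ * ‖y‖) := by gcongr
    _ = _ := by ring

end Operator

/-! ### The domain -/

section Domain

variable {n : ℕ} {Ω : Set (EuclideanSpace ℝ (Fin n))}

lemma tendsto_div_of_hasFDerivAt {ρ : EuclideanSpace ℝ (Fin n) → ℝ}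
    {ρ' : EuclideanSpace ℝ (Fin n) →L[ℝ] ℝ} {p : EuclideanSpace ℝ (Fin n)}
    (h : HasFDerivAt ρ ρ' p) (h0 : ρ p = 0) (v : EuclideanSpace ℝ (Fin n)) :
    Tendsto (fun t : ℝ => t⁻¹ * ρ (p + t • v)) (𝓝[>] 0) (𝓝 (ρ' v)) := by
  have h1 : HasDerivAt (fun t : ℝ => ρ (p + t • v)) (ρ' v) 0 := by
    have h2 : HasFDerivAt ρ ρ' (p + (0 : ℝ) • v) := by simpa using h
    have h3 : HasDerivAt (fun t : ℝ => p + t • v) v 0 := by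
      simpa using ((hasDerivAt_id (0 : ℝ)).smul_const v).const_add p
    exact h2.comp_hasDerivAt 0 h3
  have h4 := (hasDerivAt_iff_tendsto_slope_zero.1 h1).mono_left (nhdsGT_le_nhdsNE 0)
  simpa [h0] using h4

lemma tendsto_add_smul (p v : EuclideanSpace ℝ (Fin n)) :
    Tendsto (fun t : ℝ => p + t • v) (𝓝[>] 0) (𝓝 p) := by
  have : Continuous fun t : ℝ => p + t • v := by fun_prop
  simpa using this.continuousAt.tendsto.mono_left (nhdsWithin_le_nhds (a := (0 : ℝ)) (s := Ioi 0))

lemma eventually_mem_of_fderiv_neg {ρ : EuclideanSpace ℝ (Fin n) → ℝ}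
    {ρ' : EuclideanSpace ℝ (Fin n) →L[ℝ] ℝ} {p v : EuclideanSpace ℝ (Fin n)}
    (h : HasFDerivAt ρ ρ' p) (hmem : ∀ᶠ x in 𝓝 p, (x ∈ Ω ↔ ρ x < 0)) (h0 : ρ p = 0)
    (hv : ρ' v < 0) : ∀ᶠ t in 𝓝[>] (0 : ℝ), p + t • v ∈ Ω := by
  filter_upwards [(tendsto_div_of_hasFDerivAt h h0 v).eventually (gt_mem_nhds hv),
    (tendsto_add_smul p v).eventually hmem, self_mem_nhdsWithin] with t ht1 ht2 ht3
  rw [ht2]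
  exact (pos_iff_neg_of_mul_neg ht1).1 (inv_pos.2 ht3)

lemma eventually_notMem_of_fderiv_pos {ρ : EuclideanSpace ℝ (Fin n) → ℝ}
    {ρ' : EuclideanSpace ℝ (Fin n) →L[ℝ] ℝ} {p v : EuclideanSpace ℝ (Fin n)}
    (h : HasFDerivAt ρ ρ' p) (hmem : ∀ᶠ x in 𝓝 p, (x ∈ Ω ↔ ρ x < 0)) (h0 : ρ p = 0)
    (hv : 0 < ρ' v) : ∀ᶠ t in 𝓝[>] (0 : ℝ), p + t • v ∉ Ω := by
  filter_upwards [(tendsto_div_of_hasFDerivAt h h0 v).eventually (lt_mem_nhds hv),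
    (tendsto_add_smul p v).eventually hmem, self_mem_nhdsWithin] with t ht1 ht2 ht3
  rw [ht2, not_lt]
  exact ((pos_iff_pos_of_mul_pos ht1).1 (inv_pos.2 ht3)).le

lemma eq_zero_of_mem_frontier (hΩ : IsOpen Ω) {ρ : EuclideanSpace ℝ (Fin n) → ℝ}
    {p : EuclideanSpace ℝ (Fin n)} (hp : p ∈ frontier Ω) (hc : ContinuousAt ρ p)
    (hmem : ∀ᶠ x in 𝓝 p, (x ∈ Ω ↔ ρ x < 0)) : ρ p = 0 := by
  rw [hΩ.frontier_eq] at hp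
  refine le_antisymm ?_ (not_lt.1 fun h => hp.2 (hmem.self_of_nhds.2 h))
  by_contra! hpos
  have h1 := mem_closure_iff_frequently.1 hp.1
  obtain ⟨x, ⟨hx1, hx2⟩, hx3⟩ :=
    (h1.and_eventually (hmem.and (hc.eventually (lt_mem_nhds hpos)))).exists.imp
      fun x hx => (⟨⟨hx.1, hx.2.1⟩, hx.2.2⟩ : (x ∈ Ω ∧ (x ∈ Ω ↔ ρ x < 0)) ∧ 0 < ρ x)
  exact absurd (hx2.1 hx1) (not_lt.2 hx3.le)

lemma fderiv_gradient_self {ρ : EuclideanSpace ℝ (Fin n) → ℝ} (p : EuclideanSpace ℝ (Fin n)) :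
    fderiv ℝ ρ p (gradient ρ p) = ‖gradient ρ p‖ ^ 2 := by
  rw [← toDual_gradient, InnerProductSpace.toDual_apply_apply, real_inner_self_eq_norm_sq]

lemma fderiv_eq_inner_gradient {ρ : EuclideanSpace ℝ (Fin n) → ℝ}
    (p v : EuclideanSpace ℝ (Fin n)) : fderiv ℝ ρ p v = inner ℝ (gradient ρ p) v := by
  rw [← toDual_gradient, InnerProductSpace.toDual_apply_apply]

lemma IsLocalDefiningFunction.congr {r : ℕ} {p : EuclideanSpace ℝ (Fin n)}
    {ρ ρ' : EuclideanSpace ℝ (Fin n) → ℝ} (h : IsLocalDefiningFunction r Ω p ρ)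
    (he : ρ' =ᶠ[𝓝 p] ρ) : IsLocalDefiningFunction r Ω p ρ' := by
  refine ⟨h.contDiffAt.congr_of_eventuallyEq he, ?_, ?_⟩
  · rw [gradient, he.fderiv_eq]
    exact h.gradient_ne_zero
  · filter_upwards [he, h.mem_iff] with x hx hx'
    rw [hx', hx]

/-- Local defining functions are glued to a global one by cutting off: near a boundary point all
the summands have the same sign, so that no cancellation occurs. Away from the boundary a negative
function is added. -/
theorem exists_global_defining (hΩ : IsOpen Ω) (hb : Bornology.IsBounded Ω)
    (hC : HasCkBoundary 4 Ω) :
    ∃ ρ : EuclideanSpace ℝ (Fin n) → ℝ, ContDiff ℝ 4 ρ ∧ (∀ x ∈ Ω, ρ x < 0) ∧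
      ∀ p ∈ frontier Ω, ρ p = 0 ∧ IsLocalDefiningFunction 4 Ω p ρ := by
  classical
  choose! r hr using hC
  have hloc : ∀ p ∈ frontier Ω, ∃ R > 0, ∀ x, dist x p < R →
      ContDiffAt ℝ 4 (r p) x ∧ gradient (r p) x ≠ 0 ∧ (x ∈ Ω ↔ r p x < 0) := by
    intro p hp
    have h := hr p hp
    have h1 : ∀ᶠ x in 𝓝 p, ContDiffAt ℝ 4 (r p) x := h.contDiffAt.eventually (by decide)
    have h2 : ContinuousAt (fun x => gradient (r p) x) p := by
      have h3 : ContDiffAt ℝ 3 (fderiv ℝ (r p)) p := h.contDiffAt.fderiv_right (by norm_num)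
      exact (InnerProductSpace.toDual ℝ _).symm.continuous.continuousAt.comp h3.continuousAt
    have h4 := h2.eventually_ne h.gradient_ne_zero
    obtain ⟨R, hR, hball⟩ := Metric.eventually_nhds_iff.1 (h1.and (h4.and h.mem_iff))
    exact ⟨R, hR, fun x hx => hball hx⟩
  choose! R hR hball using hloc
  let χ : ∀ p : frontier Ω, ContDiffBump (p : EuclideanSpace ℝ (Fin n)) := fun p =>
    ⟨R p / 3, R p / 2, by have := hR p p.2; positivity, by have := hR p p.2; linarith⟩
  have hcomp : IsCompact (frontier Ω) :=
    Metric.isCompact_of_isClosed_isBounded isClosed_frontier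
      (hb.closure.subset frontier_subset_closure)
  obtain ⟨t, ht⟩ := hcomp.elim_nhds_subcover' (fun p _ => Metric.ball p (R p / 3))
    (fun p hp => Metric.ball_mem_nhds p (by have := hR p hp; positivity))
  have hin : ∀ p : frontier Ω, ∀ x, χ p x ≠ 0 → dist x p < R p := by
    intro p x hx
    by_contra! h
    refine hx ((χ p).zero_of_le_dist ?_)
    have := hR p p.2
    change R p / 2 ≤ _
    linarith
  let ψ : frontier Ω → EuclideanSpace ℝ (Fin n) → ℝ := fun p x => χ p x * r p x
  have hψ_in : ∀ p, ∀ x ∈ Ω, ψ p x ≤ 0 := by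
    intro p x hx
    by_cases h : χ p x = 0
    · simp [ψ, h]
    · exact mul_nonpos_of_nonneg_of_nonpos (χ p).nonneg
        ((hball p p.2 x (hin p x h)).2.2.1 hx).le
  have hψ_out : ∀ p, ∀ x ∉ Ω, 0 ≤ ψ p x := by
    intro p x hx
    by_cases h : χ p x = 0
    · simp [ψ, h]
    · exact mul_nonneg (χ p).nonneg
        (not_lt.1 fun h' => hx ((hball p p.2 x (hin p x h)).2.2.2 h'))
  have hψ_smooth : ∀ p, ContDiff ℝ 4 (ψ p) := by
    intro p
    rw [contDiff_iff_contDiffAt]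
    intro x
    by_cases h : dist x p < R p
    · exact (χ p).contDiffAt.mul (hball p p.2 x h).1
    · have h1 : ∀ᶠ y in 𝓝 x, ψ p y = 0 := by
        have h2 : ∀ᶠ y in 𝓝 x, R p / 2 < dist y (p : EuclideanSpace ℝ (Fin n)) := by
          refine (continuous_id.dist continuous_const).continuousAt.eventually (lt_mem_nhds ?_)
          have := hR p p.2
          simp only [id]
          linarith
        filter_upwards [h2] with y hy
        have : χ p y = 0 := (χ p).zero_of_le_dist hy.le
        simp [ψ, this]
      exact contDiffAt_const.congr_of_eventuallyEq h1
  set ρ : EuclideanSpace ℝ (Fin n) → ℝ := fun x => ∑ p ∈ t, ψ p x with hρ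
  have hρs : ContDiff ℝ 4 ρ := ContDiff.sum fun p _ => hψ_smooth p
  -- a nonnegative function vanishing near the boundary, positive where all cut-offs vanish
  set σ : EuclideanSpace ℝ (Fin n) → ℝ :=
    fun x => Real.smoothTransition (1 - ∑ p ∈ t, χ p x) with hσ
  have hσs : ContDiff ℝ 4 σ :=
    (Real.smoothTransition.contDiff (n := 4)).comp
      (contDiff_const.sub (ContDiff.sum fun p _ => (χ p).contDiff))
  suffices hmain : ∀ y ∈ frontier Ω,
      ρ y = 0 ∧ IsLocalDefiningFunction 4 Ω y ρ ∧ ∀ᶠ x in 𝓝 y, σ x = 0 by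
    refine ⟨fun x => ρ x - σ x, hρs.sub hσs, fun x hx => ?_, fun y hy => ?_⟩
    · have h1 : ρ x ≤ 0 := Finset.sum_nonpos fun p _ => hψ_in p x hx
      have h2 : 0 ≤ σ x := Real.smoothTransition.nonneg _
      by_cases h : ∃ p ∈ t, χ p x ≠ 0
      · obtain ⟨p, hpt, hp⟩ := h
        have h3 : ψ p x < 0 := mul_neg_of_pos_of_neg (lt_of_le_of_ne (χ p).nonneg hp.symm)
          ((hball p p.2 x (hin p x hp)).2.2.1 hx)
        have h4 : ρ x < 0 := Finset.sum_neg' (fun q _ => hψ_in q x hx) ⟨p, hpt, h3⟩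
        linarith
      · push Not at h
        have h3 : σ x = 1 := by
          simp only [hσ]
          rw [Finset.sum_eq_zero h, sub_zero, Real.smoothTransition.one]
        linarith
    · obtain ⟨h1, h2, h3⟩ := hmain y hy
      refine ⟨by simp [h1, h3.self_of_nhds], h2.congr ?_⟩
      filter_upwards [h3] with x hx
      rw [hx, sub_zero]
  intro y hy
  obtain ⟨p, hp⟩ := mem_iUnion.1 (ht hy)
  obtain ⟨hpt, hyp⟩ := mem_iUnion.1 hp
  -- near `y` the cut-off of the chart at `p` equals one
  have hχ : ∀ᶠ x in 𝓝 y, χ p x = 1 := (χ p).eventuallyEq_one_of_mem_ball hyp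
  have hnear : ∀ᶠ x in 𝓝 y, dist x (p : EuclideanSpace ℝ (Fin n)) < R p := by
    refine (Metric.isOpen_ball.mem_nhds (show y ∈ Metric.ball (p : EuclideanSpace ℝ (Fin n)) (R p)
      from Metric.ball_subset_ball ?_ hyp))
    have := hR p p.2
    linarith
  have hle : ∀ᶠ x in 𝓝 y, x ∈ Ω → ρ x ≤ r p x := by
    filter_upwards [hχ] with x hx hxΩ
    have h1 : ρ x = ψ p x + ∑ q ∈ t.erase p, ψ q x := (Finset.add_sum_erase t _ hpt).symm
    have h2 : ψ p x = r p x := by simp [ψ, hx]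
    have h3 : ∑ q ∈ t.erase p, ψ q x ≤ 0 := Finset.sum_nonpos fun q _ => hψ_in q x hxΩ
    linarith
  have hmem : ∀ᶠ x in 𝓝 y, (x ∈ Ω ↔ ρ x < 0) := by
    filter_upwards [hle, hnear] with x hx1 hx2
    constructor
    · intro hxΩ
      exact (hx1 hxΩ).trans_lt ((hball p p.2 x hx2).2.2.1 hxΩ)
    · intro hneg
      by_contra hxΩ
      exact absurd hneg (not_lt.2 (Finset.sum_nonneg fun q _ => hψ_out q x hxΩ))
  have hρy : ρ y = 0 := eq_zero_of_mem_frontier hΩ hy hρs.continuous.continuousAt hmem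
  have hσy : ∀ᶠ x in 𝓝 y, σ x = 0 := by
    filter_upwards [hχ] with x hx
    refine Real.smoothTransition.zero_of_nonpos ?_
    have : χ p x ≤ ∑ q ∈ t, χ q x :=
      Finset.single_le_sum (f := fun q => χ q x) (fun q _ => (χ q).nonneg) hpt
    linarith
  refine ⟨hρy, ⟨hρs.contDiffAt, fun hgrad => ?_, hmem⟩, hσy⟩
  obtain ⟨hc, hg, -⟩ := hball p p.2 y hnear.self_of_nhds
  have hmem' : ∀ᶠ x in 𝓝 y, (x ∈ Ω ↔ r p x < 0) := by
    filter_upwards [hnear] with x hx using (hball p p.2 x hx).2.2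
  have hpy : r p y = 0 := eq_zero_of_mem_frontier hΩ hy hc.continuousAt hmem'
  have hd : HasFDerivAt (r p) (fderiv ℝ (r p) y) y :=
    (hc.differentiableAt (by norm_num)).hasFDerivAt
  have hdρ : HasFDerivAt ρ (fderiv ℝ ρ y) y :=
    (hρs.contDiffAt.differentiableAt (by norm_num)).hasFDerivAt
  set v := -gradient (r p) y
  have hv : fderiv ℝ (r p) y v < 0 := by
    rw [map_neg, fderiv_gradient_self]
    have : 0 < ‖gradient (r p) y‖ := norm_pos_iff.2 hg
    have := pow_pos this 2
    linarith
  have hv' : fderiv ℝ ρ y v ≤ fderiv ℝ (r p) y v := by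
    refine le_of_tendsto_of_tendsto (tendsto_div_of_hasFDerivAt hdρ hρy v)
      (tendsto_div_of_hasFDerivAt hd hpy v) ?_
    filter_upwards [eventually_mem_of_fderiv_neg hd hmem' hpy hv,
      (tendsto_add_smul y v).eventually hle, self_mem_nhdsWithin] with s hs1 hs2 hs3
    exact mul_le_mul_of_nonneg_left (hs2 hs1) (inv_nonneg.2 (le_of_lt hs3))
  have : fderiv ℝ ρ y v = 0 := by
    rw [fderiv_eq_inner_gradient, hgrad, inner_zero_left]
  linarith

/-- The outer unit normal extends to a vector field of class `C³` on the whole space. -/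
theorem exists_normal_extension (hb : Bornology.IsBounded Ω)
    {ρ : EuclideanSpace ℝ (Fin n) → ℝ} (hρ : ContDiff ℝ 4 ρ)
    (hloc : ∀ p ∈ frontier Ω, IsLocalDefiningFunction 4 Ω p ρ) :
    ∃ c > 0, (∀ p ∈ frontier Ω, c ≤ ‖gradient ρ p‖) ∧
      ∃ N : EuclideanSpace ℝ (Fin n) → EuclideanSpace ℝ (Fin n), ContDiff ℝ 3 N ∧
        ∀ p ∈ frontier Ω, N p = ‖gradient ρ p‖⁻¹ • gradient ρ p := by
  have hcomp : IsCompact (frontier Ω) :=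
    Metric.isCompact_of_isClosed_isBounded isClosed_frontier
      (hb.closure.subset frontier_subset_closure)
  have hgs : ContDiff ℝ 3 (gradient ρ) := by
    have h3 : ContDiff ℝ 3 (fderiv ℝ ρ) := hρ.fderiv_right (by norm_num)
    exact (InnerProductSpace.toDual ℝ (EuclideanSpace ℝ (Fin n))).symm.contDiff.comp h3
  obtain ⟨c, hc, hcle⟩ : ∃ c > 0, ∀ p ∈ frontier Ω, c ≤ ‖gradient ρ p‖ := by
    rcases (frontier Ω).eq_empty_or_nonempty with he | hne
    · exact ⟨1, one_pos, fun p hp => by simp [he] at hp⟩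
    · obtain ⟨p, hp, hmin⟩ := hcomp.exists_isMinOn hne hgs.continuous.norm.continuousOn
      exact ⟨‖gradient ρ p‖, norm_pos_iff.2 (hloc p hp).gradient_ne_zero, fun q hq => hmin hq⟩
  refine ⟨c, hc, hcle, fun x => (Real.smoothTransition (2 * (‖gradient ρ x‖ ^ 2 / c ^ 2) - 1)
    * (Real.sqrt (‖gradient ρ x‖ ^ 2))⁻¹) • gradient ρ x, ?_, fun p hp => ?_⟩
  · have hsq : ContDiff ℝ 3 fun x => ‖gradient ρ x‖ ^ 2 := hgs.norm_sq ℝ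
    rw [contDiff_iff_contDiffAt]
    intro x
    by_cases hx : gradient ρ x = 0
    · have h1 : ∀ᶠ y in 𝓝 x, 2 * (‖gradient ρ y‖ ^ 2 / c ^ 2) - 1 < 0 := by
        have hcont : Continuous fun y => 2 * (‖gradient ρ y‖ ^ 2 / c ^ 2) - 1 :=
          ((hsq.continuous.div_const _).const_mul 2).sub continuous_const
        refine hcont.continuousAt.eventually (gt_mem_nhds ?_)
        simp [hx]
      refine (contDiffAt_const (c := (0 : EuclideanSpace ℝ (Fin n)))).congr_of_eventuallyEq ?_
      filter_upwards [h1] with y hy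
      rw [Real.smoothTransition.zero_of_nonpos hy.le, zero_mul, zero_smul]
    · have hne : ‖gradient ρ x‖ ^ 2 ≠ 0 := by
        have := norm_pos_iff.2 hx
        positivity
      have hne' : Real.sqrt (‖gradient ρ x‖ ^ 2) ≠ 0 := by
        rw [Real.sqrt_sq (norm_nonneg _)]
        exact norm_ne_zero_iff.2 hx
      have hst : ContDiff ℝ 3
          fun y => Real.smoothTransition (2 * (‖gradient ρ y‖ ^ 2 / c ^ 2) - 1) :=
        (Real.smoothTransition.contDiff (n := 3)).comp
          (((hsq.div_const _).const_smul (2 : ℝ)).sub contDiff_const)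
      exact ((hst.contDiffAt).mul ((hsq.contDiffAt.sqrt hne).inv hne')).smul hgs.contDiffAt
  · have h1 : 1 ≤ 2 * (‖gradient ρ p‖ ^ 2 / c ^ 2) - 1 := by
      have h2 : 1 ≤ ‖gradient ρ p‖ ^ 2 / c ^ 2 := by
        rw [one_le_div (by positivity)]
        exact pow_le_pow_left₀ hc.le (hcle p hp) 2
      linarith
    simp only [Real.smoothTransition.one_of_one_le h1, one_mul, Real.sqrt_sq (norm_nonneg _)]

lemma uniqueDiffOn_closure (hΩ : IsOpen Ω) {ρ : EuclideanSpace ℝ (Fin n) → ℝ}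
    (hloc : ∀ p ∈ frontier Ω, ρ p = 0 ∧ IsLocalDefiningFunction 4 Ω p ρ) :
    UniqueDiffOn ℝ (closure Ω) := by
  intro p hp
  by_cases hpΩ : p ∈ Ω
  · exact (hΩ.uniqueDiffWithinAt hpΩ).mono subset_closure
  have hpf : p ∈ frontier Ω := by
    rw [hΩ.frontier_eq]; exact ⟨hp, hpΩ⟩
  obtain ⟨h0, hl⟩ := hloc p hpf
  have hd : HasFDerivAt ρ (fderiv ℝ ρ p) p :=
    (hl.contDiffAt.differentiableAt (by norm_num)).hasFDerivAt
  have hsub : {v | fderiv ℝ ρ p v < 0} ⊆ tangentConeAt ℝ (closure Ω) p := by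
    intro v hv
    refine mem_tangentConeAt_of_add_smul_mem (l := 𝓝[>] (0 : ℝ)) (c := id) ?_ ?_
    · exact tendsto_id'.2 (nhdsGT_le_nhdsNE 0)
    · exact (eventually_mem_of_fderiv_neg hd hl.mem_iff h0 hv).mono fun t ht => subset_closure ht
  have hopen : IsOpen {v | fderiv ℝ ρ p v < 0} :=
    isOpen_lt (fderiv ℝ ρ p).continuous continuous_const
  refine ⟨?_, subset_closure hp⟩
  have htop : Submodule.span ℝ (tangentConeAt ℝ (closure Ω) p) = ⊤ := by
    apply Submodule.eq_top_of_nonempty_interior'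
    refine ⟨-gradient ρ p, mem_interior.2 ⟨_, hsub.trans Submodule.subset_span, hopen, ?_⟩⟩
    change fderiv ℝ ρ p (-gradient ρ p) < 0
    rw [map_neg, fderiv_gradient_self]
    have : 0 < ‖gradient ρ p‖ := norm_pos_iff.2 hl.gradient_ne_zero
    have := pow_pos this 2
    linarith
  rw [htop]
  exact dense_univ

lemma exists_mem_frontier_of_segment (hΩ : IsOpen Ω) {x y : EuclideanSpace ℝ (Fin n)}
    (hx : x ∈ Ω) (hy : y ∉ Ω) : ∃ z ∈ segment ℝ x y, z ∈ frontier Ω := by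
  by_contra! h
  have hpre : IsPreconnected (segment ℝ x y) := (convex_segment x y).isPreconnected
  have hycl : y ∉ closure Ω := fun hc =>
    h y (right_mem_segment ℝ x y) (by rw [hΩ.frontier_eq]; exact ⟨hc, hy⟩)
  obtain ⟨z, -, hz1, hz2⟩ := hpre Ω (closure Ω)ᶜ hΩ isClosed_closure.isOpen_compl
    (fun z hz => by
      by_cases hzΩ : z ∈ Ω
      · exact Or.inl hzΩ
      · exact Or.inr fun hc => h z hz (by rw [hΩ.frontier_eq]; exact ⟨hc, hzΩ⟩))
    ⟨x, left_mem_segment ℝ x y, hx⟩ ⟨y, right_mem_segment ℝ x y, hycl⟩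
  exact hz2 (subset_closure hz1)

/-- The vectors orthogonal to the normal are tangent to the boundary: the segments from
`p + t (τ - η ν)` to `p + t (τ + η ν)` cross it. -/
lemma mem_tangentConeAt_frontier (hΩ : IsOpen Ω) {ρ : EuclideanSpace ℝ (Fin n) → ℝ}
    {p : EuclideanSpace ℝ (Fin n)} (h0 : ρ p = 0) (hl : IsLocalDefiningFunction 4 Ω p ρ)
    {τ : EuclideanSpace ℝ (Fin n)} (hτ : inner ℝ (gradient ρ p) τ = 0) :
    τ ∈ tangentConeAt ℝ (frontier Ω) p := by
  have hd : HasFDerivAt ρ (fderiv ℝ ρ p) p :=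
    (hl.contDiffAt.differentiableAt (by norm_num)).hasFDerivAt
  set g := gradient ρ p
  have hg : 0 < ‖g‖ ^ 2 := pow_pos (norm_pos_iff.2 hl.gradient_ne_zero) 2
  have key : ∀ k : ℕ, ∃ t : ℝ, 0 < t ∧ t < 1 / ((k : ℝ) + 1) ∧ ∃ s : ℝ, |s| ≤ 1 / ((k : ℝ) + 1) ∧
      p + t • (τ + s • g) ∈ frontier Ω := by
    intro k
    have hη : (0 : ℝ) < 1 / ((k : ℝ) + 1) := by positivity
    set η : ℝ := 1 / ((k : ℝ) + 1)
    have h1 : fderiv ℝ ρ p (τ - η • g) < 0 := by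
      rw [map_sub, map_smul, fderiv_gradient_self, fderiv_eq_inner_gradient, hτ, smul_eq_mul]
      nlinarith
    have h2 : 0 < fderiv ℝ ρ p (τ + η • g) := by
      rw [map_add, map_smul, fderiv_gradient_self, fderiv_eq_inner_gradient, hτ, smul_eq_mul]
      nlinarith
    obtain ⟨t, ht1, ht2, ht3⟩ := ((eventually_mem_of_fderiv_neg hd hl.mem_iff h0 h1).and
      ((eventually_notMem_of_fderiv_pos hd hl.mem_iff h0 h2).and (Ioo_mem_nhdsGT hη))).exists
    obtain ⟨z, hz, hzf⟩ := exists_mem_frontier_of_segment hΩ ht1 ht2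
    refine ⟨t, ht3.1, ht3.2, ?_⟩
    rw [segment_eq_image] at hz
    obtain ⟨θ, hθ, rfl⟩ := hz
    refine ⟨(2 * θ - 1) * η, ?_, ?_⟩
    · rw [abs_mul, abs_of_pos hη]
      refine mul_le_of_le_one_left hη.le (abs_le.2 ⟨?_, ?_⟩) <;> linarith [hθ.1, hθ.2]
    · convert! hzf using 1
      module
  choose t ht0 ht1 s hs hmem using key
  have ht : Tendsto t atTop (𝓝 0) :=
    squeeze_zero (fun k => (ht0 k).le) (fun k => (ht1 k).le) tendsto_one_div_add_atTop_nhds_zero_nat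
  have hs0 : Tendsto s atTop (𝓝 0) :=
    squeeze_zero_norm (fun k => hs k) tendsto_one_div_add_atTop_nhds_zero_nat
  have hlim : Tendsto (fun k => τ + s k • g) atTop (𝓝 τ) := by
    simpa using tendsto_const_nhds.add (hs0.smul_const g)
  refine mem_tangentConeAt_of_seq atTop (fun k => (t k)⁻¹) (fun k => t k • (τ + s k • g)) ?_
    (Eventually.of_forall hmem) ?_
  · simpa using ht.smul hlim
  · refine hlim.congr fun k => ?_
    rw [smul_smul, inv_mul_cancel₀ (ht0 k).ne', one_smul]

/-- A function vanishing on the boundary has no tangential derivative. -/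
lemma hasFDerivWithinAt_tangent_eq_zero {F : Type*} [NormedAddCommGroup F] [NormedSpace ℝ F]
    (hΩ : IsOpen Ω) {ρ : EuclideanSpace ℝ (Fin n) → ℝ}
    {p : EuclideanSpace ℝ (Fin n)} (hp : p ∈ frontier Ω) (h0 : ρ p = 0)
    (hl : IsLocalDefiningFunction 4 Ω p ρ) {G : EuclideanSpace ℝ (Fin n) → F}
    {G' : EuclideanSpace ℝ (Fin n) →L[ℝ] F} (hG : HasFDerivWithinAt G G' (closure Ω) p)
    (hzero : ∀ x ∈ frontier Ω, G x = 0) {τ : EuclideanSpace ℝ (Fin n)}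
    (hτ : inner ℝ (gradient ρ p) τ = 0) : G' τ = 0 := by
  have h1 := hG.mono (frontier_subset_closure (s := Ω))
  have h2 : HasFDerivWithinAt G (0 : EuclideanSpace ℝ (Fin n) →L[ℝ] F) (frontier Ω) p :=
    (hasFDerivWithinAt_const (0 : F) p _).congr hzero (hzero p hp)
  simpa using h1.unique_on h2 (mem_tangentConeAt_frontier hΩ h0 hl hτ)

end Domain

/-! ### Second derivatives within a set -/

section SecondDerivative

variable {E F G H : Type*} [NormedAddCommGroup E] [NormedSpace ℝ E] [NormedAddCommGroup F]
  [NormedSpace ℝ F] [NormedAddCommGroup G] [NormedSpace ℝ G] [NormedAddCommGroup H]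
  [NormedSpace ℝ H]

/-- The second derivative within `K`, as a bilinear map. -/
def D₂ (K : Set E) (w : E → F) (x : E) : E →L[ℝ] E →L[ℝ] F :=
  fderivWithin ℝ (fderivWithin ℝ w K) K x

variable {K Ω : Set E} {x : E}

lemma hasFDerivWithinAt_of_contDiffOn {w : E → F} {r : ℕ} (hr : 1 ≤ r) (hw : ContDiffOn ℝ r w K)
    (hx : x ∈ K) : HasFDerivWithinAt w (fderivWithin ℝ w K x) K x :=
  ((hw x hx).differentiableWithinAt (by exact_mod_cast (by omega : r ≠ 0))).hasFDerivWithinAt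

lemma contDiffOn_fderivWithin_two {w : E → F} (hK : UniqueDiffOn ℝ K) (hw : ContDiffOn ℝ 2 w K) :
    ContDiffOn ℝ 1 (fderivWithin ℝ w K) K :=
  hw.fderivWithin hK (by norm_num)

lemma hasFDerivWithinAt_fderivWithin {w : E → F} (hK : UniqueDiffOn ℝ K)
    (hw : ContDiffOn ℝ 2 w K) (hx : x ∈ K) :
    HasFDerivWithinAt (fderivWithin ℝ w K) (D₂ K w x) K x :=
  hasFDerivWithinAt_of_contDiffOn (r := 1) le_rfl
    (by exact_mod_cast contDiffOn_fderivWithin_two hK hw) hx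

/-- The second derivative is determined by the first derivatives in fixed directions. -/
lemma D₂_apply_of_hasFDerivWithinAt {w : E → F} (hK : UniqueDiffOn ℝ K)
    (hw : ContDiffOn ℝ 2 w K) (hx : x ∈ K) (b : E) {L : E →L[ℝ] F}
    (hL : HasFDerivWithinAt (fun y => fderivWithin ℝ w K y b) L K x) (a : E) :
    D₂ K w x a b = L a := by
  have h1 : HasFDerivWithinAt (fun y => fderivWithin ℝ w K y b)
      ((ContinuousLinearMap.apply ℝ F b).comp (D₂ K w x)) K x :=
    (ContinuousLinearMap.apply ℝ F b).hasFDerivAt.comp_hasFDerivWithinAt x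
      (hasFDerivWithinAt_fderivWithin hK hw hx)
  rw [← (hK x hx).eq h1 hL]
  simp

lemma hasFDerivWithinAt_fderivWithin_apply {w : E → F} (hK : UniqueDiffOn ℝ K)
    (hw : ContDiffOn ℝ 2 w K) (hx : x ∈ K) (b : E) :
    HasFDerivWithinAt (fun y => fderivWithin ℝ w K y b)
      ((ContinuousLinearMap.apply ℝ F b).comp (D₂ K w x)) K x :=
  (ContinuousLinearMap.apply ℝ F b).hasFDerivAt.comp_hasFDerivWithinAt x
    (hasFDerivWithinAt_fderivWithin hK hw hx)

lemma D₂_congr {w w' : E → F} (h : EqOn w w' K) (hx : x ∈ K) : D₂ K w x = D₂ K w' x := by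
  refine fderivWithin_congr (fun y hy => ?_) ?_ <;> exact fderivWithin_congr h (h ‹_›)

lemma D₂_const (c : F) : D₂ K (fun _ : E => c) x = 0 := by
  have : fderivWithin ℝ (fun _ : E => c) K = fun _ => 0 := by
    ext y; simp [fderivWithin_fun_const]
  rw [D₂, this, fderivWithin_fun_const]
  rfl

lemma D₂_add {v w : E → F} (hK : UniqueDiffOn ℝ K) (hv : ContDiffOn ℝ 2 v K)
    (hw : ContDiffOn ℝ 2 w K) (hx : x ∈ K) :
    D₂ K (fun y => v y + w y) x = D₂ K v x + D₂ K w x := by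
  have h1 : EqOn (fderivWithin ℝ (fun y => v y + w y) K)
      (fun y => fderivWithin ℝ v K y + fderivWithin ℝ w K y) K := fun y hy =>
    ((hasFDerivWithinAt_of_contDiffOn (r := 2) (by norm_num) hv hy).fun_add
      (hasFDerivWithinAt_of_contDiffOn (r := 2) (by norm_num) hw hy)).fderivWithin (hK y hy)
  rw [D₂, fderivWithin_congr h1 (h1 hx)]
  exact ((hasFDerivWithinAt_fderivWithin hK hv hx).fun_add
    (hasFDerivWithinAt_fderivWithin hK hw hx)).fderivWithin (hK x hx)

/-- The second derivative of a bilinear expression. -/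
lemma D₂_bilin (B : F →L[ℝ] G →L[ℝ] H) {v : E → F} {w : E → G} (hK : UniqueDiffOn ℝ K)
    (hv : ContDiffOn ℝ 2 v K) (hw : ContDiffOn ℝ 2 w K) (hx : x ∈ K) (a b : E) :
    D₂ K (fun y => B (v y) (w y)) x a b
      = B (v x) (D₂ K w x a b) + B (fderivWithin ℝ v K x a) (fderivWithin ℝ w K x b)
        + B (fderivWithin ℝ v K x b) (fderivWithin ℝ w K x a) + B (D₂ K v x a b) (w x) := by
  have hv' := fun y hy => hasFDerivWithinAt_of_contDiffOn (r := 2) (x := y) (by norm_num) hv hy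
  have hw' := fun y hy => hasFDerivWithinAt_of_contDiffOn (r := 2) (x := y) (by norm_num) hw hy
  have h1 : EqOn (fun y => fderivWithin ℝ (fun y => B (v y) (w y)) K y b)
      (fun y => B (v y) (fderivWithin ℝ w K y b) + B (fderivWithin ℝ v K y b) (w y)) K := by
    intro y hy
    have := (B.hasFDerivWithinAt_of_bilinear (hv' y hy) (hw' y hy)).fderivWithin (hK y hy)
    simp only [this]
    simp
  have h2 := (B.hasFDerivWithinAt_of_bilinear (hv' x hx)
    (hasFDerivWithinAt_fderivWithin_apply hK hw hx b)).fun_add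
      (B.hasFDerivWithinAt_of_bilinear (hasFDerivWithinAt_fderivWithin_apply hK hv hx b) (hw' x hx))
  have hB : ContDiffOn ℝ 2 (fun y => B (v y) (w y)) K :=
    B.isBoundedBilinearMap.contDiff.comp_contDiffOn (hv.prodMk hw)
  rw [D₂_apply_of_hasFDerivWithinAt hK hB hx b (h2.congr h1 (h1 hx))]
  simp
  abel

lemma fderivWithin_bilin (B : F →L[ℝ] G →L[ℝ] H) {v : E → F} {w : E → G} (hK : UniqueDiffOn ℝ K)
    (hv : ContDiffOn ℝ 2 v K) (hw : ContDiffOn ℝ 2 w K) (hx : x ∈ K) (a : E) :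
    fderivWithin ℝ (fun y => B (v y) (w y)) K x a
      = B (v x) (fderivWithin ℝ w K x a) + B (fderivWithin ℝ v K x a) (w x) := by
  rw [(B.hasFDerivWithinAt_of_bilinear
    (hasFDerivWithinAt_of_contDiffOn (r := 2) (by norm_num) hv hx)
    (hasFDerivWithinAt_of_contDiffOn (r := 2) (by norm_num) hw hx)).fderivWithin (hK x hx)]
  simp

lemma fderivWithin_add_of_contDiffOn {v w : E → F} (hK : UniqueDiffOn ℝ K)
    (hv : ContDiffOn ℝ 2 v K) (hw : ContDiffOn ℝ 2 w K) (hx : x ∈ K) :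
    fderivWithin ℝ (fun y => v y + w y) K x = fderivWithin ℝ v K x + fderivWithin ℝ w K x :=
  ((hasFDerivWithinAt_of_contDiffOn (r := 2) (by norm_num) hv hx).fun_add
    (hasFDerivWithinAt_of_contDiffOn (r := 2) (by norm_num) hw hx)).fderivWithin (hK x hx)

lemma fderivWithin_comp_apply {S : Set F} {a : F → G} {Y : E → F} (hK : UniqueDiffOn ℝ K)
    (ha : ContDiffOn ℝ 2 a S) (hY : ContDiffOn ℝ 2 Y K) (hmaps : MapsTo Y K S)
    (hx : x ∈ K) (b : E) :
    fderivWithin ℝ (fun y => a (Y y)) K x b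
      = fderivWithin ℝ a S (Y x) (fderivWithin ℝ Y K x b) := by
  have := ((hasFDerivWithinAt_of_contDiffOn (r := 2) (by norm_num) ha (hmaps hx)).comp x
    (hasFDerivWithinAt_of_contDiffOn (r := 2) (by norm_num) hY hx) hmaps).fderivWithin (hK x hx)
  have h2 : fderivWithin ℝ (fun y => a (Y y)) K x = _ := this
  rw [h2]
  rfl

/-- The second derivative of a composition. -/
lemma D₂_comp {S : Set F} {a : F → G} {Y : E → F} (hK : UniqueDiffOn ℝ K) (hS : UniqueDiffOn ℝ S)
    (ha : ContDiffOn ℝ 2 a S) (hY : ContDiffOn ℝ 2 Y K) (hmaps : MapsTo Y K S)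
    (hx : x ∈ K) (b c : E) :
    D₂ K (fun y => a (Y y)) x b c
      = D₂ S a (Y x) (fderivWithin ℝ Y K x b) (fderivWithin ℝ Y K x c)
        + fderivWithin ℝ a S (Y x) (D₂ K Y x b c) := by
  have h1 : EqOn (fun y => fderivWithin ℝ (fun y => a (Y y)) K y c)
      (fun y => fderivWithin ℝ a S (Y y) (fderivWithin ℝ Y K y c)) K := fun y hy =>
    fderivWithin_comp_apply hK ha hY hmaps hy c
  have h2 : HasFDerivWithinAt (fun y => fderivWithin ℝ a S (Y y))
      ((D₂ S a (Y x)).comp (fderivWithin ℝ Y K x)) K x :=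
    (hasFDerivWithinAt_fderivWithin hS ha (hmaps hx)).comp x
      (hasFDerivWithinAt_of_contDiffOn (r := 2) (by norm_num) hY hx) hmaps
  have h3 := h2.clm_apply (hasFDerivWithinAt_fderivWithin_apply hK hY hx c)
  have hcd : ContDiffOn ℝ 2 (fun y => a (Y y)) K := ha.comp hY hmaps
  rw [D₂_apply_of_hasFDerivWithinAt hK hcd hx c (h3.congr h1 (h1 hx))]
  simp
  abel

lemma D₂_clm_comp (L : F →L[ℝ] G) {w : E → F} (hK : UniqueDiffOn ℝ K)
    (hw : ContDiffOn ℝ 2 w K) (hx : x ∈ K) (a b : E) :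
    D₂ K (fun y => L (w y)) x a b = L (D₂ K w x a b) := by
  have h1 : EqOn (fun y => fderivWithin ℝ (fun y => L (w y)) K y b)
      (fun y => L (fderivWithin ℝ w K y b)) K := fun y hy => by
    have := (L.hasFDerivAt.comp_hasFDerivWithinAt y
      (hasFDerivWithinAt_of_contDiffOn (r := 2) (by norm_num) hw hy)).fderivWithin (hK y hy)
    have h2 : fderivWithin ℝ (fun y => L (w y)) K y = _ := this
    simp only [h2]
    rfl
  have h3 := L.hasFDerivAt.comp_hasFDerivWithinAt x
    (hasFDerivWithinAt_fderivWithin_apply hK hw hx b)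
  have hcd : ContDiffOn ℝ 2 (fun y => L (w y)) K := L.contDiff.comp_contDiffOn hw
  rw [D₂_apply_of_hasFDerivWithinAt hK hcd hx b
    (HasFDerivWithinAt.congr h3 h1 (h1 hx))]
  simp

lemma fderivWithin_eq_of_isOpen (hΩ : IsOpen Ω) (h : Ω ⊆ K) (hx : x ∈ Ω) (w : E → F) :
    fderivWithin ℝ w K x = fderivWithin ℝ w Ω x := by
  rw [fderivWithin_of_mem_nhds (mem_of_superset (hΩ.mem_nhds hx) h), fderivWithin_of_isOpen hΩ hx]

lemma D₂_eq_of_isOpen (hΩ : IsOpen Ω) (h : Ω ⊆ K) (hx : x ∈ Ω) (w : E → F) :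
    D₂ K w x = D₂ Ω w x := by
  rw [D₂, D₂, fderivWithin_eq_of_isOpen hΩ h hx]
  exact fderivWithin_congr (fun y hy => fderivWithin_eq_of_isOpen hΩ h hy w)
    (fderivWithin_eq_of_isOpen hΩ h hx w)

lemma D₂_symm {w : E → F} (hK : UniqueDiffOn ℝ K) (hw : ContDiffOn ℝ 2 w K) (hx : x ∈ K)
    (hxi : x ∈ closure (interior K)) (a b : E) : D₂ K w x a b = D₂ K w x b a :=
  (hw x hx).isSymmSndFDerivWithinAt (by simp) hK hxi hx a b

/-- The necessary second order condition at a minimum. -/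
lemma D₂_nonneg_of_isMin {w : E → ℝ} (hΩ : IsOpen Ω) (hw : ContDiffOn ℝ 2 w Ω) (hx : x ∈ Ω)
    (hmin : ∀ y ∈ Ω, w x ≤ w y) (v : E) :
    fderivWithin ℝ w Ω x = 0 ∧ 0 ≤ D₂ Ω w x v v := by
  have hloc : IsLocalMin w x := mem_of_superset (hΩ.mem_nhds hx) hmin
  have h0 : fderivWithin ℝ w Ω x = 0 := by
    rw [fderivWithin_of_isOpen hΩ hx]; exact hloc.fderiv_eq_zero
  refine ⟨h0, ?_⟩
  by_contra! hneg
  set g : ℝ → ℝ := fun t => w (x + t • v)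
  have hc : Continuous fun t : ℝ => x + t • v := by fun_prop
  have hnear : ∀ᶠ t : ℝ in 𝓝 0, x + t • v ∈ Ω :=
    hc.continuousAt.eventually (by simpa using hΩ.mem_nhds hx)
  have hline : ∀ t : ℝ, HasDerivAt (fun t : ℝ => x + t • v) v t := fun t => by
    simpa using ((hasDerivAt_id t).smul_const v).const_add x
  have hg1 : ∀ᶠ t : ℝ in 𝓝 0, deriv g t = fderivWithin ℝ w Ω (x + t • v) v := by
    filter_upwards [hnear] with t ht
    have h1 := (hasFDerivWithinAt_of_contDiffOn (r := 2) (by norm_num) hw ht).hasFDerivAt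
      (hΩ.mem_nhds ht)
    exact (h1.comp_hasDerivAt t (hline t)).deriv
  have hg2 : deriv (deriv g) 0 = D₂ Ω w x v v := by
    rw [EventuallyEq.deriv_eq hg1]
    have h2 := (hasFDerivWithinAt_fderivWithin_apply hΩ.uniqueDiffOn hw hx v).hasFDerivAt
      (hΩ.mem_nhds hx)
    have h3 : HasFDerivAt (fun y => fderivWithin ℝ w Ω y v)
      ((ContinuousLinearMap.apply ℝ ℝ v).comp (D₂ Ω w x)) (x + (0 : ℝ) • v) := by simpa using h2
    have := (h3.comp_hasDerivAt (0 : ℝ) (hline 0)).deriv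
    simpa [Function.comp_def] using this
  have hg0 : deriv g 0 = 0 := by
    rw [hg1.self_of_nhds]
    simp [h0]
  have hgc : ContinuousAt g 0 := by
    have h1 : ContinuousAt w (x + (0 : ℝ) • v) := by
      simpa using (hw x hx).continuousWithinAt.continuousAt (hΩ.mem_nhds hx)
    exact ContinuousAt.comp (f := fun t : ℝ => x + t • v) h1 hc.continuousAt
  have hmax : IsLocalMax g 0 := isLocalMax_of_deriv_deriv_neg (by rw [hg2]; exact hneg) hg0 hgc
  -- a local maximum which is a minimum forces `w` to be constant along the line
  have hconst : ∀ᶠ t in 𝓝 (0 : ℝ), g t = g 0 := by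
    filter_upwards [hmax, hnear] with t ht1 ht2
    refine le_antisymm ht1 ?_
    have := hmin _ ht2
    simpa [g] using this
  have h5 : deriv (deriv g) 0 = 0 := by
    have h6 : ∀ᶠ t in 𝓝 (0 : ℝ), deriv g t = 0 := by
      filter_upwards [hconst.eventually_nhds] with t ht
      have h7 : g =ᶠ[𝓝 t] fun _ => g 0 := ht
      rw [h7.deriv_eq, deriv_const]
    rw [EventuallyEq.deriv_eq h6, deriv_const]
  rw [hg2] at h5
  exact hneg.ne h5

/-- At a maximum over `K`, the derivative in a direction pointing into `K` is nonpositive. -/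
lemma fderivWithin_nonpos_of_isMax {w : E → ℝ} {w' : E →L[ℝ] ℝ} (hw : HasFDerivWithinAt w w' K x)
    (hmax : ∀ y ∈ K, w y ≤ w x) {v : E} (hv : ∀ᶠ t in 𝓝[>] (0 : ℝ), x + t • v ∈ K) :
    w' v ≤ 0 := by
  have h1 : Tendsto (fun t : ℝ => t⁻¹ • (w (x + t • v) - w x)) (𝓝[>] 0) (𝓝 (w' v)) := by
    have hd : Tendsto (fun t : ℝ => t • v) (𝓝[>] 0) (𝓝 0) := by
      have : Continuous fun t : ℝ => t • v := by fun_prop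
      simpa using this.continuousAt.tendsto.mono_left
        (nhdsWithin_le_nhds (a := (0 : ℝ)) (s := Ioi 0))
    refine hw.lim (l := 𝓝[>] (0 : ℝ)) (c := fun t => t⁻¹) (d := fun t => t • v) hd hv ?_
    refine tendsto_const_nhds.congr' ?_
    filter_upwards [self_mem_nhdsWithin] with t ht
    rw [smul_smul, inv_mul_cancel₀ (ne_of_gt ht), one_smul]
  refine le_of_tendsto h1 ?_
  filter_upwards [hv, self_mem_nhdsWithin] with t ht1 ht2
  exact mul_nonpos_of_nonneg_of_nonpos (inv_nonneg.2 (le_of_lt ht2)) (sub_nonpos.2 (hmax _ ht1))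

end SecondDerivative

/-! ### Families of functions controlled by the Hessian of the solution -/

section Tame

/-- Unit vectors `q_j` with nonnegative weights `F_j`, standing for the second order operator
`w ↦ ∑ F_j D²w(q_j, q_j)`. -/
structure WeightedFrame (n : ℕ) (E : Type*) [NormedAddCommGroup E] where
  /-- The weights `F_j`. -/
  weight : Fin n → ℝ
  /-- The vectors `q_j`. -/
  vec : Fin n → E
  weight_nonneg : ∀ j, 0 ≤ weight j
  norm_vec : ∀ j, ‖vec j‖ = 1

namespace WeightedFrame

variable {n : ℕ} {E F : Type*} [NormedAddCommGroup E] [NormedAddCommGroup F] [NormedSpace ℝ F]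

/-- The trace `∑ F_j` of the operator. -/
def trace (fr : WeightedFrame n E) : ℝ := ∑ j, fr.weight j

lemma trace_nonneg (fr : WeightedFrame n E) : 0 ≤ fr.trace :=
  Finset.sum_nonneg fun j _ => fr.weight_nonneg j

lemma norm_sum_weight_le (fr : WeightedFrame n E) {v : Fin n → F} {C : ℝ}
    (h : ∀ j, ‖v j‖ ≤ C) : ‖∑ j, fr.weight j • v j‖ ≤ C * fr.trace := by
  rw [trace, Finset.mul_sum]
  refine (norm_sum_le _ _).trans (Finset.sum_le_sum fun j _ => ?_)
  rw [norm_smul, Real.norm_of_nonneg (fr.weight_nonneg j), mul_comm]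
  exact mul_le_mul_of_nonneg_right (h j) (fr.weight_nonneg j)

end WeightedFrame

variable {I J : Type*} {n : ℕ} {E F G H : Type*} [NormedAddCommGroup E] [NormedSpace ℝ E]
  [NormedAddCommGroup F] [NormedSpace ℝ F] [NormedAddCommGroup G] [NormedSpace ℝ G]
  [NormedAddCommGroup H] [NormedSpace ℝ H]

namespace WeightedFrame

/-- The contraction `∑ F_j b(q_j, q_j)` of a bilinear map. -/
def lin (fr : WeightedFrame n E) (b : E →L[ℝ] E →L[ℝ] F) : F :=
  ∑ j, fr.weight j • b (fr.vec j) (fr.vec j)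

lemma lin_add (fr : WeightedFrame n E) (b c : E →L[ℝ] E →L[ℝ] F) :
    fr.lin (b + c) = fr.lin b + fr.lin c := by
  simp [lin, Finset.sum_add_distrib]

lemma norm_apply_vec_le (fr : WeightedFrame n E) (b : E →L[ℝ] E →L[ℝ] F) (j : Fin n) :
    ‖b (fr.vec j) (fr.vec j)‖ ≤ ‖b‖ := by
  have := b.le_opNorm₂ (fr.vec j) (fr.vec j)
  simpa [fr.norm_vec] using this

lemma norm_lin_le (fr : WeightedFrame n E) (b : E →L[ℝ] E →L[ℝ] F) :
    ‖fr.lin b‖ ≤ ‖b‖ * fr.trace :=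
  fr.norm_sum_weight_le fun j => fr.norm_apply_vec_le b j

end WeightedFrame

/-- A family of functions of class `C²` on `K`, bounded together with their gradients, whose second
derivatives grow at most linearly in `m`, uniformly in the family. -/
def Tame₀ (K : Set E) (m : I → E → ℝ) (w : I → E → F) : Prop :=
  ∃ C, 0 ≤ C ∧ ∀ i, ContDiffOn ℝ 2 (w i) K ∧ ∀ x ∈ K, ‖w i x‖ ≤ C ∧
    ‖fderivWithin ℝ (w i) K x‖ ≤ C ∧ ‖D₂ K (w i) x‖ ≤ C * (1 + m i x)

/-- A family of functions of class `C²` on `K`, bounded, whose gradients grow at most linearly in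
`m`, and such that the operators `fr` applied to them in `Ω` are bounded by a multiple of the trace
which grows at most linearly in `m`, uniformly in the family. -/
def Tame₁ (K Ω : Set E) (m : I → E → ℝ) (fr : I → E → WeightedFrame n E) (w : I → E → F) : Prop :=
  ∃ C, 0 ≤ C ∧ ∀ i, ContDiffOn ℝ 2 (w i) K ∧
    (∀ x ∈ K, ‖w i x‖ ≤ C ∧ ‖fderivWithin ℝ (w i) K x‖ ≤ C * (1 + m i x)) ∧
    ∀ x ∈ Ω, ‖(fr i x).lin (D₂ K (w i) x)‖ ≤ C * ((fr i x).trace * (1 + m i x))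

variable {K Ω : Set E} {m : I → E → ℝ} {fr : I → E → WeightedFrame n E}

lemma Tame₀.congr {w w' : I → E → F} (h : Tame₀ K m w) (he : ∀ i, EqOn (w' i) (w i) K) :
    Tame₀ K m w' := by
  obtain ⟨C, hC, h⟩ := h
  refine ⟨C, hC, fun i => ⟨(h i).1.congr (he i), fun x hx => ?_⟩⟩
  rw [he i hx, fderivWithin_congr (he i) (he i hx), D₂_congr (he i) hx]
  exact (h i).2 x hx

lemma Tame₁.congr {w w' : I → E → F} (hΩK : Ω ⊆ K) (h : Tame₁ K Ω m fr w)
    (he : ∀ i, EqOn (w' i) (w i) K) : Tame₁ K Ω m fr w' := by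
  obtain ⟨C, hC, h⟩ := h
  refine ⟨C, hC, fun i => ⟨(h i).1.congr (he i), fun x hx => ?_, fun x hx => ?_⟩⟩
  · rw [he i hx, fderivWithin_congr (he i) (he i hx)]
    exact (h i).2.1 x hx
  · rw [D₂_congr (he i) (hΩK hx)]
    exact (h i).2.2 x hx

lemma Tame₀.reindex {w : I → E → F} (h : Tame₀ K m w) (π : J → I) :
    Tame₀ K (fun j => m (π j)) (fun j => w (π j)) := by
  obtain ⟨C, hC, h⟩ := h
  exact ⟨C, hC, fun j => h (π j)⟩

lemma Tame₁.reindex {w : I → E → F} (h : Tame₁ K Ω m fr w) (π : J → I) :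
    Tame₁ K Ω (fun j => m (π j)) (fun j => fr (π j)) (fun j => w (π j)) := by
  obtain ⟨C, hC, h⟩ := h
  exact ⟨C, hC, fun j => h (π j)⟩

lemma Tame₀.tame₁ {w : I → E → F} (hΩK : Ω ⊆ K) (hm : ∀ i x, 0 ≤ m i x) (h : Tame₀ K m w) :
    Tame₁ K Ω m fr w := by
  obtain ⟨C, hC, h⟩ := h
  refine ⟨C, hC, fun i => ⟨(h i).1, fun x hx => ?_, fun x hx => ?_⟩⟩
  · obtain ⟨h1, h2, -⟩ := (h i).2 x hx
    exact ⟨h1, h2.trans (le_mul_of_one_le_right hC (by linarith [hm i x]))⟩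
  · obtain ⟨-, -, h3⟩ := (h i).2 x (hΩK hx)
    refine ((fr i x).norm_lin_le _).trans ?_
    calc _ ≤ C * (1 + m i x) * (fr i x).trace :=
          mul_le_mul_of_nonneg_right h3 (fr i x).trace_nonneg
      _ = _ := by ring

lemma tame₀_const (hm : ∀ i x, 0 ≤ m i x) {c : I → F} {C : ℝ} (hc : ∀ i, ‖c i‖ ≤ C) :
    Tame₀ K m (fun i (_ : E) => c i) := by
  refine ⟨max C 0, le_max_right _ _, fun i => ⟨contDiffOn_const, fun x hx =>
    ⟨(hc i).trans (le_max_left _ _), ?_, ?_⟩⟩⟩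
  · rw [fderivWithin_fun_const]
    simp
  · rw [D₂_const]
    have := hm i x
    exact (le_of_eq ContinuousLinearMap.opNorm_zero).trans (by positivity)

/-- A fixed function of class `C²` on a compact set. -/
lemma tame₀_of_contDiffOn (hK : UniqueDiffOn ℝ K) (hKc : IsCompact K) (hm : ∀ i x, 0 ≤ m i x)
    {w : E → F} (hw : ContDiffOn ℝ 2 w K) : Tame₀ K m (fun _ : I => w) := by
  have h1 : ContinuousOn (fderivWithin ℝ w K) K := hw.continuousOn_fderivWithin hK (by norm_num)
  have h2 : ContinuousOn (fderivWithin ℝ (fderivWithin ℝ w K) K) K :=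
    (contDiffOn_fderivWithin_two hK hw).continuousOn_fderivWithin hK (by norm_num)
  obtain ⟨C0, hC0⟩ := hKc.exists_bound_of_continuousOn hw.continuousOn
  obtain ⟨C1, hC1⟩ := hKc.exists_bound_of_continuousOn h1
  obtain ⟨C2, hC2⟩ := hKc.exists_bound_of_continuousOn (E := E →L[ℝ] E →L[ℝ] F)
    (f := D₂ K w) (by exact h2)
  set C := max (max C0 C1) (max C2 0)
  have hC : 0 ≤ C := (le_max_right _ _).trans (le_max_right _ _)
  refine ⟨C, hC, fun i => ⟨hw, fun x hx => ⟨?_, ?_, ?_⟩⟩⟩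
  · exact (hC0 x hx).trans ((le_max_left _ _).trans (le_max_left _ _))
  · exact (hC1 x hx).trans ((le_max_right _ _).trans (le_max_left _ _))
  · have h3 : ‖D₂ K w x‖ ≤ C := (hC2 x hx).trans ((le_max_left _ _).trans (le_max_right _ _))
    refine h3.trans ?_
    exact le_mul_of_one_le_right hC (by linarith [hm i x])

lemma Tame₀.add {v w : I → E → F} (hK : UniqueDiffOn ℝ K) (hv : Tame₀ K m v)
    (hw : Tame₀ K m w) : Tame₀ K m (fun i x => v i x + w i x) := by
  obtain ⟨C, hC, hv⟩ := hv
  obtain ⟨C', hC', hw⟩ := hw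
  refine ⟨C + C', by positivity, fun i => ⟨(hv i).1.add (hw i).1, fun x hx => ?_⟩⟩
  obtain ⟨h1, h2, h3⟩ := (hv i).2 x hx
  obtain ⟨h1', h2', h3'⟩ := (hw i).2 x hx
  rw [fderivWithin_add_of_contDiffOn hK (hv i).1 (hw i).1 hx, D₂_add hK (hv i).1 (hw i).1 hx]
  refine ⟨(norm_add_le _ _).trans (add_le_add h1 h1'), (norm_add_le _ _).trans (add_le_add h2 h2'),
    (norm_add_le (D₂ K (v i) x) (D₂ K (w i) x)).trans ?_⟩
  linarith

lemma Tame₁.add {v w : I → E → F} (hK : UniqueDiffOn ℝ K) (hΩK : Ω ⊆ K) (hv : Tame₁ K Ω m fr v)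
    (hw : Tame₁ K Ω m fr w) : Tame₁ K Ω m fr (fun i x => v i x + w i x) := by
  obtain ⟨C, hC, hv⟩ := hv
  obtain ⟨C', hC', hw⟩ := hw
  refine ⟨C + C', by positivity, fun i => ⟨(hv i).1.add (hw i).1, fun x hx => ?_, fun x hx => ?_⟩⟩
  · obtain ⟨h1, h2⟩ := (hv i).2.1 x hx
    obtain ⟨h1', h2'⟩ := (hw i).2.1 x hx
    rw [fderivWithin_add_of_contDiffOn hK (hv i).1 (hw i).1 hx]
    refine ⟨(norm_add_le _ _).trans (add_le_add h1 h1'), (norm_add_le _ _).trans ?_⟩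
    linarith
  · have h3 := (hv i).2.2 x hx
    have h3' := (hw i).2.2 x hx
    rw [D₂_add hK (hv i).1 (hw i).1 (hΩK hx), WeightedFrame.lin_add]
    refine (norm_add_le _ _).trans ?_
    linarith

lemma Tame₀.bilin (B : F →L[ℝ] G →L[ℝ] H) {v : I → E → F} {w : I → E → G}
    (hK : UniqueDiffOn ℝ K) (hm : ∀ i x, 0 ≤ m i x) (hv : Tame₀ K m v) (hw : Tame₀ K m w) :
    Tame₀ K m (fun i x => B (v i x) (w i x)) := by
  obtain ⟨C, hC, hv⟩ := hv
  obtain ⟨C', hC', hw⟩ := hw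
  have hB := norm_nonneg B
  refine ⟨4 * (‖B‖ * C * C'), by positivity, fun i =>
    ⟨B.isBoundedBilinearMap.contDiff.comp_contDiffOn ((hv i).1.prodMk (hw i).1), fun x hx => ?_⟩⟩
  obtain ⟨h1, h2, h3⟩ := (hv i).2 x hx
  obtain ⟨h1', h2', h3'⟩ := (hw i).2 x hx
  have hmx := hm i x
  have hP : 0 ≤ ‖B‖ * C * C' := by positivity
  have hb : ∀ (a : F) (b : G) (s t : ℝ), ‖a‖ ≤ s → ‖b‖ ≤ t → 0 ≤ s →
      ‖B a b‖ ≤ ‖B‖ * s * t := fun a b s t ha hb hs =>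
    (B.le_opNorm₂ a b).trans (by gcongr)
  refine ⟨?_, ?_, ?_⟩
  · have := hb _ _ _ _ h1 h1' hC
    linarith
  · refine ContinuousLinearMap.opNorm_le_bound _ (by positivity) fun a => ?_
    rw [fderivWithin_bilin B hK (hv i).1 (hw i).1 hx]
    have e1 := hb _ _ _ _ h1 ((fderivWithin ℝ (w i) K x).le_of_opNorm_le h2' a) hC
    have e2 := hb _ _ _ _ ((fderivWithin ℝ (v i) K x).le_of_opNorm_le h2 a) h1' (by positivity)
    refine (norm_add_le _ _).trans ((add_le_add e1 e2).trans ?_)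
    have : 0 ≤ ‖B‖ * C * C' * ‖a‖ := by positivity
    nlinarith
  · refine ContinuousLinearMap.opNorm_le_bound₂ _ (by positivity) fun a b => ?_
    rw [D₂_bilin B hK (hv i).1 (hw i).1 hx]
    have d3 := ContinuousLinearMap.le_of_opNorm₂_le_of_le (D₂ K (v i) x) h3 (le_refl ‖a‖)
      (le_refl ‖b‖)
    have d3' := ContinuousLinearMap.le_of_opNorm₂_le_of_le (D₂ K (w i) x) h3' (le_refl ‖a‖)
      (le_refl ‖b‖)
    have e1 := hb _ _ _ _ h1 d3' hC
    have e2 := hb _ _ _ _ ((fderivWithin ℝ (v i) K x).le_of_opNorm_le h2 a)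
      ((fderivWithin ℝ (w i) K x).le_of_opNorm_le h2' b) (by positivity)
    have e3 := hb _ _ _ _ ((fderivWithin ℝ (v i) K x).le_of_opNorm_le h2 b)
      ((fderivWithin ℝ (w i) K x).le_of_opNorm_le h2' a) (by positivity)
    have e4 := hb _ _ _ _ d3 h1' (by positivity)
    refine (norm_add_le _ _).trans ((add_le_add ((norm_add_le _ _).trans (add_le_add
      ((norm_add_le _ _).trans (add_le_add e1 e2)) e3)) e4).trans ?_)
    have : 0 ≤ ‖B‖ * C * C' * ‖a‖ * ‖b‖ := by positivity
    have : 0 ≤ ‖B‖ * C * C' * ‖a‖ * ‖b‖ * m i x := by positivity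
    nlinarith

/-- In a product with a tame factor the cross terms of the second derivative are harmless. -/
lemma Tame₁.bilin (B : F →L[ℝ] G →L[ℝ] H) {v : I → E → F} {w : I → E → G}
    (hK : UniqueDiffOn ℝ K) (hΩK : Ω ⊆ K) (hm : ∀ i x, 0 ≤ m i x) (hv : Tame₀ K m v)
    (hw : Tame₁ K Ω m fr w) : Tame₁ K Ω m fr (fun i x => B (v i x) (w i x)) := by
  obtain ⟨C, hC, hv⟩ := hv
  obtain ⟨C', hC', hw⟩ := hw
  have hB := norm_nonneg B
  refine ⟨4 * (‖B‖ * C * C'), by positivity, fun i =>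
    ⟨B.isBoundedBilinearMap.contDiff.comp_contDiffOn ((hv i).1.prodMk (hw i).1), fun x hx => ?_, fun x hx => ?_⟩⟩
  all_goals
    have hmx := hm i x
    have hP : 0 ≤ ‖B‖ * C * C' := by positivity
    have hb : ∀ (a : F) (b : G) (s t : ℝ), ‖a‖ ≤ s → ‖b‖ ≤ t → 0 ≤ s →
        ‖B a b‖ ≤ ‖B‖ * s * t := fun a b s t ha hb hs =>
      (B.le_opNorm₂ a b).trans (by gcongr)
  · obtain ⟨h1, h2, h3⟩ := (hv i).2 x hx
    obtain ⟨h1', h2'⟩ := (hw i).2.1 x hx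
    refine ⟨?_, ?_⟩
    · have := hb _ _ _ _ h1 h1' hC
      linarith
    · refine ContinuousLinearMap.opNorm_le_bound _ (by positivity) fun a => ?_
      rw [fderivWithin_bilin B hK (hv i).1 (hw i).1 hx]
      have e1 := hb _ _ _ _ h1 ((fderivWithin ℝ (w i) K x).le_of_opNorm_le h2' a) hC
      have e2 := hb _ _ _ _ ((fderivWithin ℝ (v i) K x).le_of_opNorm_le h2 a) h1' (by positivity)
      refine (norm_add_le _ _).trans ((add_le_add e1 e2).trans ?_)
      have : 0 ≤ ‖B‖ * C * C' * ‖a‖ := by positivity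
      have : 0 ≤ ‖B‖ * C * C' * ‖a‖ * m i x := by positivity
      nlinarith
  · obtain ⟨h1, h2, h3⟩ := (hv i).2 x (hΩK hx)
    obtain ⟨h1', h2'⟩ := (hw i).2.1 x (hΩK hx)
    have h3' := (hw i).2.2 x hx
    have hT := (fr i x).trace_nonneg
    set q := (fr i x).vec
    have hq : ∀ j, ‖q j‖ = 1 := (fr i x).norm_vec
    have hsplit : (fr i x).lin (D₂ K (fun x => B (v i x) (w i x)) x)
        = B (v i x) ((fr i x).lin (D₂ K (w i) x))
          + ∑ j, (fr i x).weight j • (B (fderivWithin ℝ (v i) K x (q j))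
              (fderivWithin ℝ (w i) K x (q j))
            + B (fderivWithin ℝ (v i) K x (q j)) (fderivWithin ℝ (w i) K x (q j))
            + B (D₂ K (v i) x (q j) (q j)) (w i x)) := by
      rw [WeightedFrame.lin, WeightedFrame.lin, map_sum, ← Finset.sum_add_distrib]
      refine Finset.sum_congr rfl fun j _ => ?_
      rw [D₂_bilin B hK (hv i).1 (hw i).1 (hΩK hx), map_smul, ← smul_add]
      congr 1
      abel
    rw [hsplit]
    have e1 := hb _ _ _ _ h1 h3' hC
    have e2 := (fr i x).norm_sum_weight_le (v := fun j => B (fderivWithin ℝ (v i) K x (q j))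
              (fderivWithin ℝ (w i) K x (q j))
            + B (fderivWithin ℝ (v i) K x (q j)) (fderivWithin ℝ (w i) K x (q j))
            + B (D₂ K (v i) x (q j) (q j)) (w i x)) (C := 3 * (‖B‖ * C * C') * (1 + m i x)) (by
      intro j
      have d2 := (fderivWithin ℝ (v i) K x).le_of_opNorm_le h2 (q j)
      have d2' := (fderivWithin ℝ (w i) K x).le_of_opNorm_le h2' (q j)
      have d3 := ((fr i x).norm_apply_vec_le (D₂ K (v i) x) j).trans h3
      rw [hq, mul_one] at d2 d2'
      have f1 := hb _ _ _ _ d2 d2' hC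
      have f2 := hb _ _ _ _ d3 h1' (by positivity)
      refine (norm_add_le _ _).trans ((add_le_add ((norm_add_le _ _).trans (add_le_add f1 f1))
        f2).trans (le_of_eq ?_))
      ring)
    refine (norm_add_le _ _).trans ((add_le_add e1 e2).trans (le_of_eq ?_))
    ring

/-- Composition with functions whose derivatives up to second order are bounded where they are
evaluated. -/
lemma Tame₀.comp {S : Set F} {a : I → F → G} {Y : I → E → F} (hK : UniqueDiffOn ℝ K)
    (hS : UniqueDiffOn ℝ S) (hm : ∀ i x, 0 ≤ m i x) (hY : Tame₀ K m Y)
    (ha : ∀ i, ContDiffOn ℝ 2 (a i) S) (hmaps : ∀ i, MapsTo (Y i) K S) {A : ℝ}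
    (hA : ∀ i, ∀ x ∈ K, ‖a i (Y i x)‖ ≤ A ∧ ‖fderivWithin ℝ (a i) S (Y i x)‖ ≤ A ∧
      ‖D₂ S (a i) (Y i x)‖ ≤ A) : Tame₀ K m (fun i x => a i (Y i x)) := by
  obtain ⟨C, hC, hY⟩ := hY
  have hA0 : 0 ≤ max A 0 := le_max_right _ _
  set A' := max A 0
  have hA' : A ≤ A' := le_max_left _ _
  refine ⟨A' * (1 + C + C ^ 2), by positivity, fun i => ⟨(ha i).comp (hY i).1 (hmaps i),
    fun x hx => ?_⟩⟩
  obtain ⟨h1, h2, h3⟩ := (hY i).2 x hx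
  obtain ⟨a1, a2, a3⟩ := hA i x hx
  have hmx := hm i x
  have hC2 : 0 ≤ A' * C ^ 2 := by positivity
  have hC1 : 0 ≤ A' * C := by positivity
  refine ⟨?_, ?_, ?_⟩
  · linarith
  · refine ContinuousLinearMap.opNorm_le_bound _ (by positivity) fun b => ?_
    rw [fderivWithin_comp_apply hK (ha i) (hY i).1 (hmaps i) hx]
    have e1 := (fderivWithin ℝ (a i) S (Y i x)).le_of_opNorm_le (a2.trans hA')
      (fderivWithin ℝ (Y i) K x b)
    have e2 := (fderivWithin ℝ (Y i) K x).le_of_opNorm_le h2 b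
    calc _ ≤ A' * (C * ‖b‖) := e1.trans (mul_le_mul_of_nonneg_left e2 hA0)
      _ = A' * C * ‖b‖ := by ring
      _ ≤ _ := mul_le_mul_of_nonneg_right (by linarith) (norm_nonneg b)
  · refine ContinuousLinearMap.opNorm_le_bound₂ _ (by positivity) fun b c => ?_
    rw [D₂_comp hK hS (ha i) (hY i).1 (hmaps i) hx]
    have e1 := ContinuousLinearMap.le_of_opNorm₂_le_of_le (D₂ S (a i) (Y i x)) (a3.trans hA')
      ((fderivWithin ℝ (Y i) K x).le_of_opNorm_le h2 b)
      ((fderivWithin ℝ (Y i) K x).le_of_opNorm_le h2 c)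
    have d3 := ContinuousLinearMap.le_of_opNorm₂_le_of_le (D₂ K (Y i) x) h3 (le_refl ‖b‖)
      (le_refl ‖c‖)
    have e2 := (fderivWithin ℝ (a i) S (Y i x)).le_of_opNorm_le (a2.trans hA')
      (D₂ K (Y i) x b c)
    have e3 := e2.trans (mul_le_mul_of_nonneg_left d3 hA0)
    refine (norm_add_le _ _).trans ((add_le_add e1 e3).trans ?_)
    have f1 : 0 ≤ A' * ‖b‖ * ‖c‖ * (1 + m i x) := by positivity
    have f2 : 0 ≤ A' * C ^ 2 * ‖b‖ * ‖c‖ * m i x := by positivity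
    nlinarith

end Tame

/-! ### Differentiating the equation -/

section Symmetry

section Linear

variable {E F G : Type*} [NormedAddCommGroup E] [NormedSpace ℝ E] [NormedAddCommGroup F]
  [NormedSpace ℝ F] [NormedAddCommGroup G] [NormedSpace ℝ G] {K : Set E} {x : E} {w : E → F}

lemma hasFDerivWithinAt_clm_comp (L : F →L[ℝ] G) {w' : E →L[ℝ] F}
    (hw : HasFDerivWithinAt w w' K x) : HasFDerivWithinAt (fun y => L (w y)) (L.comp w') K x :=
  L.hasFDerivAt.comp_hasFDerivWithinAt x hw

lemma contDiffOn_clm_comp (L : F →L[ℝ] G) {r : WithTop ℕ∞} (hw : ContDiffOn ℝ r w K) :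
    ContDiffOn ℝ r (fun y => L (w y)) K :=
  L.contDiff.comp_contDiffOn hw

end Linear

variable {E : Type*} [NormedAddCommGroup E] [NormedSpace ℝ E] {K : Set E} {u : E → ℝ} {x : E}

/-- Evaluation of a bilinear form at a pair of vectors. -/
def evalBilin (a b : E) : (E →L[ℝ] E →L[ℝ] ℝ) →L[ℝ] ℝ :=
  (ContinuousLinearMap.apply ℝ ℝ b).comp (ContinuousLinearMap.apply ℝ (E →L[ℝ] ℝ) a)

@[simp] lemma evalBilin_apply (a b : E) (B : E →L[ℝ] E →L[ℝ] ℝ) : evalBilin a b B = B a b := rfl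

lemma contDiffOn_fderivWithin_of_three (hK : UniqueDiffOn ℝ K) (hu : ContDiffOn ℝ 3 u K) :
    ContDiffOn ℝ 2 (fderivWithin ℝ u K) K :=
  hu.fderivWithin hK (by norm_num)

lemma contDiffOn_D₂_of_three (hK : UniqueDiffOn ℝ K) (hu : ContDiffOn ℝ 3 u K) :
    ContDiffOn ℝ 1 (D₂ K u) K :=
  (contDiffOn_fderivWithin_of_three hK hu).fderivWithin hK (by norm_num)

lemma contDiffOn_D₂_of_four (hK : UniqueDiffOn ℝ K) (hu : ContDiffOn ℝ 4 u K) :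
    ContDiffOn ℝ 2 (D₂ K u) K :=
  (show ContDiffOn ℝ 3 (fderivWithin ℝ u K) K from hu.fderivWithin hK (by norm_num)).fderivWithin
    hK (by norm_num)

lemma hasFDerivWithinAt_D₂ (hK : UniqueDiffOn ℝ K) (hu : ContDiffOn ℝ 3 u K) (hx : x ∈ K) :
    HasFDerivWithinAt (D₂ K u) (D₂ K (fderivWithin ℝ u K) x) K x :=
  hasFDerivWithinAt_fderivWithin hK (contDiffOn_fderivWithin_of_three hK hu) hx

lemma hasFDerivWithinAt_D₂_apply (hK : UniqueDiffOn ℝ K) (hu : ContDiffOn ℝ 3 u K) (hx : x ∈ K)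
    (b c : E) : HasFDerivWithinAt (fun y => D₂ K u y b c)
      ((evalBilin b c).comp (D₂ K (fderivWithin ℝ u K) x)) K x := by
  have := hasFDerivWithinAt_clm_comp (F := E →L[ℝ] E →L[ℝ] ℝ) (w := D₂ K u)
    (w' := D₂ K (fderivWithin ℝ u K) x) (evalBilin b c) (hasFDerivWithinAt_D₂ hK hu hx)
  exact this

lemma third_swap (hK : UniqueDiffOn ℝ K) (hKi : K ⊆ closure (interior K))
    (hu : ContDiffOn ℝ 3 u K) (hx : x ∈ K) (a b c : E) :
    D₂ K (fderivWithin ℝ u K) x a b c = D₂ K (fderivWithin ℝ u K) x a c b := by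
  have h1 := hasFDerivWithinAt_D₂_apply hK hu hx b c
  have h2 := hasFDerivWithinAt_D₂_apply hK hu hx c b
  have he : EqOn (fun y => D₂ K u y b c) (fun y => D₂ K u y c b) K := fun y hy =>
    D₂_symm hK (hu.of_le (by norm_num)) hy (hKi hy) b c
  have h3 := (hK x hx).eq h1 (h2.congr he (he hx))
  exact congrArg (fun L : E →L[ℝ] ℝ => L a) h3

/-- Third derivatives are symmetric. -/
lemma third_rotate (hK : UniqueDiffOn ℝ K) (hKi : K ⊆ closure (interior K))
    (hu : ContDiffOn ℝ 3 u K) (hx : x ∈ K) (a b : E) :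
    D₂ K (fderivWithin ℝ u K) x a b b = D₂ K (fderivWithin ℝ u K) x b b a := by
  rw [D₂_symm hK (contDiffOn_fderivWithin_of_three hK hu) hx (hKi hx) a b,
    third_swap hK hKi hu hx]

/-- Fourth derivatives are symmetric. -/
lemma fourth_rotate (hK : UniqueDiffOn ℝ K) (hKi : K ⊆ closure (interior K))
    (hu : ContDiffOn ℝ 4 u K) (hx : x ∈ K) (a b : E) :
    D₂ K (D₂ K u) x a a b b = D₂ K (D₂ K u) x b b a a := by
  have hu3 : ContDiffOn ℝ 3 u K := hu.of_le (by norm_num)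
  have h2 := contDiffOn_D₂_of_four hK hu
  have hcd : ∀ a b c d : E, D₂ K (D₂ K u) x a b c d = D₂ K (D₂ K u) x a b d c := by
    intro a b c d
    rw [← evalBilin_apply c d, ← D₂_clm_comp (evalBilin c d) hK h2 hx, ← evalBilin_apply d c,
      ← D₂_clm_comp (evalBilin d c) hK h2 hx]
    rw [D₂_congr (fun y hy => ?_) hx]
    exact D₂_symm hK (hu.of_le (by norm_num)) hy (hKi hy) c d
  have hbc : ∀ a b c d : E, D₂ K (D₂ K u) x a b c d = D₂ K (D₂ K u) x a c b d := by
    intro a b c d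
    have hb := hasFDerivWithinAt_clm_comp (evalBilin c d)
      (hasFDerivWithinAt_fderivWithin_apply hK h2 hx b)
    have hc := hasFDerivWithinAt_clm_comp (evalBilin b d)
      (hasFDerivWithinAt_fderivWithin_apply hK h2 hx c)
    have he : EqOn (fun y => evalBilin c d (fderivWithin ℝ (D₂ K u) K y b))
        (fun y => evalBilin b d (fderivWithin ℝ (D₂ K u) K y c)) K := fun y hy =>
      congrArg (fun L : E →L[ℝ] ℝ => L d)
        (D₂_symm hK (contDiffOn_fderivWithin_of_three hK hu3) hy (hKi hy) b c)
    have h3 := (hK x hx).eq hb (hc.congr he (he hx))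
    exact congrArg (fun L : E →L[ℝ] ℝ => L a) h3
  rw [hbc, D₂_symm hK h2 hx (hKi hx), hcd, hbc]

end Symmetry

lemma closure_subset_closure_interior {E : Type*} [TopologicalSpace E] {Ω : Set E}
    (hΩ : IsOpen Ω) : closure Ω ⊆ closure (interior (closure Ω)) :=
  closure_mono (interior_maximal subset_closure hΩ)

section Family

variable {I : Type*} {n : ℕ} {E : Type*} [NormedAddCommGroup E] [InnerProductSpace ℝ E]

/-- The size of the second derivatives of a family of functions. -/
def hessNorm (K : Set E) (u : I → E → ℝ) : I → E → ℝ := fun i x => ‖D₂ K (u i) x‖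

lemma hessNorm_nonneg (K : Set E) (u : I → E → ℝ) (i : I) (x : E) : 0 ≤ hessNorm K u i x :=
  norm_nonneg (D₂ K (u i) x)

/-- A family of functions `u` with uniformly bounded gradients which solve a concave, uniformly
elliptic Hessian equation with right hand side `ψ`. The equation enters only through its
supporting functionals: freezing the linearized operator `fr i x₀` at a point `x₀`, the difference
of its value on `D²u` and of `ψ` is minimal at `x₀`. -/
structure EllipticFamily (Ω : Set E) (u ψ : I → E → ℝ) (fr : I → E → WeightedFrame n E) :
    Prop where
  contDiffOn_interior : ∀ i, ContDiffOn ℝ 4 (u i) Ω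
  contDiffOn : ∀ i, ContDiffOn ℝ 3 (u i) (closure Ω)
  gradient_bounded : ∃ C, 0 ≤ C ∧ ∀ i, ∀ x ∈ closure Ω, ‖fderivWithin ℝ (u i) (closure Ω) x‖ ≤ C
  source : Tame₀ (closure Ω) (hessNorm (closure Ω) u) ψ
  orthonormal : ∀ i, ∀ x ∈ Ω, ∃ q : OrthonormalBasis (Fin n) ℝ E, (fr i x).vec = q
  elliptic : ∃ c, 0 < c ∧ ∀ i, ∀ x ∈ Ω, c ≤ (fr i x).trace ∧
    ∀ j, c * (fr i x).trace ≤ (fr i x).weight j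
  supporting : ∀ i, ∀ x₀ ∈ Ω, ∀ x ∈ Ω, ψ i x - ψ i x₀ ≤
    (fr i x₀).lin (D₂ (closure Ω) (u i) x) - (fr i x₀).lin (D₂ (closure Ω) (u i) x₀)
  hessian_le : ∃ Λ, 0 ≤ Λ ∧ ∀ i, ∀ x ∈ Ω, ∃ v : E, ‖v‖ = 1 ∧
    ‖D₂ (closure Ω) (u i) x‖ ≤ Λ * D₂ (closure Ω) (u i) x v v

variable {Ω : Set E} {u ψ : I → E → ℝ} {fr : I → E → WeightedFrame n E}

/-- The contraction with a weighted frame, as a linear functional. -/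
def WeightedFrame.linCLM (f : WeightedFrame n E) : (E →L[ℝ] E →L[ℝ] ℝ) →L[ℝ] ℝ :=
  ∑ j, f.weight j • evalBilin (f.vec j) (f.vec j)

lemma WeightedFrame.linCLM_apply (f : WeightedFrame n E) (B : E →L[ℝ] E →L[ℝ] ℝ) :
    f.linCLM B = f.lin B := by
  simp [linCLM, lin]

namespace EllipticFamily

/-- First and second derivatives of the equation, from the minimum property. -/
lemma derivatives (h : EllipticFamily Ω u ψ fr) (hΩ : IsOpen Ω)
    (i : I) {x : E} (hx : x ∈ Ω) (ξ : E) :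
    (fr i x).lin (D₂ (closure Ω) (fderivWithin ℝ (u i) (closure Ω)) x) ξ
        = fderivWithin ℝ (ψ i) (closure Ω) x ξ ∧
    D₂ (closure Ω) (ψ i) x ξ ξ
      ≤ (fr i x).lin (D₂ Ω (fun y => D₂ (closure Ω) (u i) y ξ ξ) x) := by
  have hu := h.contDiffOn_interior i
  have hu3 : ContDiffOn ℝ 3 (u i) Ω := hu.of_le (by norm_num)
  have hUD := hΩ.uniqueDiffOn (𝕜 := ℝ)
  have hΩK : Ω ⊆ closure Ω := subset_closure
  have hΩi : Ω ⊆ closure (interior Ω) := by rw [hΩ.interior_eq]; exact hΩK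
  have hD : EqOn (D₂ (closure Ω) (u i)) (D₂ Ω (u i)) Ω := fun y hy => D₂_eq_of_isOpen hΩ hΩK hy _
  have hψ2 : ContDiffOn ℝ 2 (ψ i) Ω := by
    obtain ⟨C, -, hψ⟩ := h.source
    exact (hψ i).1.mono hΩK
  have hD2 : ContDiffOn ℝ 2 (D₂ Ω (u i)) Ω := contDiffOn_D₂_of_four hUD hu
  have hL2 : ContDiffOn ℝ 2 (fun y => (fr i x).linCLM (D₂ Ω (u i) y)) Ω :=
    contDiffOn_clm_comp (fr i x).linCLM hD2
  have hnψ : ContDiffOn ℝ 2 (fun y => -ψ i y) Ω := hψ2.neg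
  set w : E → ℝ := fun y => (fr i x).linCLM (D₂ Ω (u i) y) + -ψ i y
  have hmin : ∀ y ∈ Ω, w x ≤ w y := by
    intro y hy
    have := h.supporting i x hx y hy
    rw [hD hx, hD hy] at this
    simp only [w, WeightedFrame.linCLM_apply]
    linarith
  obtain ⟨hw1, hw2⟩ := D₂_nonneg_of_isMin hΩ (hL2.add hnψ) hx hmin ξ
  constructor
  · have h1 : HasFDerivWithinAt w ((fr i x).linCLM.comp (D₂ Ω (fderivWithin ℝ (u i) Ω) x)
        + -fderivWithin ℝ (ψ i) Ω x) Ω x := by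
      have h0 := hasFDerivWithinAt_clm_comp (F := E →L[ℝ] E →L[ℝ] ℝ) (w := D₂ Ω (u i))
        (w' := D₂ Ω (fderivWithin ℝ (u i) Ω) x) (fr i x).linCLM (hasFDerivWithinAt_D₂ hUD hu3 hx)
      exact h0.fun_add (hasFDerivWithinAt_of_contDiffOn (r := 2) (by norm_num) hψ2 hx).fun_neg
    have h2 := (hUD x hx).eq h1 (by
      have := hasFDerivWithinAt_of_contDiffOn (r := 2) (by norm_num) (hL2.add hnψ) hx
      rwa [show fderivWithin ℝ _ Ω x = 0 from hw1] at this)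
    have h3 := congrArg (fun L : E →L[ℝ] ℝ => L ξ) h2
    simp only [add_apply, ContinuousLinearMap.comp_apply,
      neg_apply, zero_apply,
      WeightedFrame.linCLM_apply] at h3
    rw [fderivWithin_eq_of_isOpen hΩ hΩK hx, D₂_eq_of_isOpen hΩ hΩK hx,
      D₂_congr (fun y hy => fderivWithin_eq_of_isOpen hΩ hΩK hy (u i)) hx]
    rw [← sub_eq_zero, sub_eq_add_neg, ← h3]
    congr 1
    simp only [WeightedFrame.lin, sum_apply, smul_apply]
    refine Finset.sum_congr rfl fun j _ => ?_
    rw [third_rotate hUD hΩi hu3 hx]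
  · have h1 : D₂ Ω w x ξ ξ = (fr i x).linCLM (D₂ Ω (D₂ Ω (u i)) x ξ ξ) - D₂ Ω (ψ i) x ξ ξ := by
      rw [D₂_add hUD hL2 hnψ hx, add_apply, add_apply,
        D₂_clm_comp _ hUD hD2 hx]
      have := D₂_clm_comp (-ContinuousLinearMap.id ℝ ℝ) hUD hψ2 hx ξ ξ
      simp only [neg_apply, ContinuousLinearMap.id_apply] at this
      rw [this, sub_eq_add_neg]
    have h2 : D₂ Ω (fun y => D₂ (closure Ω) (u i) y ξ ξ) x
        = D₂ Ω (fun y => evalBilin ξ ξ (D₂ Ω (u i) y)) x :=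
      D₂_congr (fun y hy => by simp only [hD hy, evalBilin_apply]) hx
    rw [D₂_eq_of_isOpen hΩ hΩK hx, h2]
    rw [show D₂ Ω w x ξ ξ = _ from h1, WeightedFrame.linCLM_apply] at hw2
    refine (sub_nonneg.1 hw2).trans (le_of_eq ?_)
    simp only [WeightedFrame.lin]
    refine Finset.sum_congr rfl fun j _ => ?_
    rw [D₂_clm_comp _ hUD hD2 hx, evalBilin_apply, fourth_rotate hUD hΩi hu hx]

/-- The gradients of the solutions are controlled. -/
lemma tame₁_fderivWithin (h : EllipticFamily Ω u ψ fr) (hΩ : IsOpen Ω)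
    (hK : UniqueDiffOn ℝ (closure Ω)) :
    Tame₁ (closure Ω) Ω (hessNorm (closure Ω) u) fr
      (fun i => fderivWithin ℝ (u i) (closure Ω)) := by
  obtain ⟨C, hC, hb⟩ := h.gradient_bounded
  obtain ⟨C', hC', hψ⟩ := h.source
  obtain ⟨c, hc, he⟩ := h.elliptic
  refine ⟨max (max C 1) (C' / c), by positivity, fun i =>
    ⟨contDiffOn_fderivWithin_of_three hK (h.contDiffOn i), fun x hx => ⟨?_, ?_⟩, fun x hx => ?_⟩⟩
  · exact (hb i x hx).trans ((le_max_left _ _).trans (le_max_left _ _))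
  · have h1 : (1 : ℝ) ≤ max (max C 1) (C' / c) := (le_max_right _ _).trans (le_max_left _ _)
    have h2 := hessNorm_nonneg (closure Ω) u i x
    have h3 : ‖fderivWithin ℝ (fderivWithin ℝ (u i) (closure Ω)) (closure Ω) x‖
      = hessNorm (closure Ω) u i x := rfl
    rw [h3]
    nlinarith
  · have h1 : (fr i x).lin (D₂ (closure Ω) (fderivWithin ℝ (u i) (closure Ω)) x)
        = fderivWithin ℝ (ψ i) (closure Ω) x := by
      ext ξ; exact (h.derivatives hΩ i hx ξ).1
    rw [h1]
    refine (((hψ i).2 x (subset_closure hx)).2.1).trans ?_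
    have h2 := hessNorm_nonneg (closure Ω) u i x
    have h3 := (he i x hx).1
    have h4 : C' ≤ C' / c * (fr i x).trace := by
      rw [div_mul_eq_mul_div, le_div_iff₀ hc]
      gcongr
    calc C' ≤ C' / c * (fr i x).trace * 1 := by rw [mul_one]; exact h4
      _ ≤ C' / c * (fr i x).trace * (1 + hessNorm (closure Ω) u i x) := by
        have := (fr i x).trace_nonneg
        gcongr
        linarith
      _ ≤ max (max C 1) (C' / c) * (fr i x).trace * (1 + hessNorm (closure Ω) u i x) := by
        have := (fr i x).trace_nonneg
        gcongr
        exact le_max_right _ _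
      _ = _ := by ring

/-- By concavity of the equation, pure second derivatives are almost subsolutions of the linearized
equation. -/
lemma neg_le_lin_D₂ (h : EllipticFamily Ω u ψ fr) (hΩ : IsOpen Ω) :
    ∃ C, 0 ≤ C ∧ ∀ i, ∀ x ∈ Ω, ∀ ξ : E, ‖ξ‖ = 1 →
      -(C * ((fr i x).trace * (1 + hessNorm (closure Ω) u i x)))
        ≤ (fr i x).lin (D₂ Ω (fun y => D₂ (closure Ω) (u i) y ξ ξ) x) := by
  obtain ⟨C', hC', hψ⟩ := h.source
  obtain ⟨c, hc, he⟩ := h.elliptic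
  refine ⟨C' / c, by positivity, fun i x hx ξ hξ => ?_⟩
  refine le_trans ?_ (h.derivatives hΩ i hx ξ).2
  have h1 := ((hψ i).2 x (subset_closure hx)).2.2
  have h2 : |D₂ (closure Ω) (ψ i) x ξ ξ| ≤ C' * (1 + hessNorm (closure Ω) u i x) := by
    have := ContinuousLinearMap.le_of_opNorm₂_le_of_le (D₂ (closure Ω) (ψ i) x) h1 hξ.le hξ.le
    simpa using this
  have h3 := (he i x hx).1
  have h4 := hessNorm_nonneg (closure Ω) u i x
  have h5 : C' ≤ C' / c * (fr i x).trace := by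
    rw [div_mul_eq_mul_div, le_div_iff₀ hc]
    gcongr
  have h6 := neg_le_of_abs_le h2
  refine le_trans ?_ h6
  rw [neg_le_neg_iff, ← mul_assoc]
  gcongr

end EllipticFamily

end Family

/-! ### A barrier at the boundary -/

section Barrier

variable {n : ℕ} {Ω : Set (EuclideanSpace ℝ (Fin n))} {ρ : EuclideanSpace ℝ (Fin n) → ℝ}
  {N : EuclideanSpace ℝ (Fin n) → EuclideanSpace ℝ (Fin n)}

/-- A bounded domain with a global defining function `ρ` and an extension `N` of the outer unit
normal. -/
structure DefiningData (Ω : Set (EuclideanSpace ℝ (Fin n))) (ρ : EuclideanSpace ℝ (Fin n) → ℝ)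
    (N : EuclideanSpace ℝ (Fin n) → EuclideanSpace ℝ (Fin n)) : Prop where
  isOpen : IsOpen Ω
  isBounded : Bornology.IsBounded Ω
  contDiff : ContDiff ℝ 4 ρ
  neg : ∀ x ∈ Ω, ρ x < 0
  boundary : ∀ p ∈ frontier Ω, ρ p = 0 ∧ IsLocalDefiningFunction 4 Ω p ρ
  contDiff_normal : ContDiff ℝ 3 N
  normal_eq : ∀ p ∈ frontier Ω, N p = ‖gradient ρ p‖⁻¹ • gradient ρ p

lemma exists_definingData (hΩ : IsOpen Ω) (hb : Bornology.IsBounded Ω) (hC : HasCkBoundary 4 Ω) :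
    ∃ ρ N, DefiningData Ω ρ N := by
  obtain ⟨ρ, h1, h2, h3⟩ := exists_global_defining hΩ hb hC
  obtain ⟨c, -, -, N, h4, h5⟩ := exists_normal_extension hb h1 fun p hp => (h3 p hp).2
  exact ⟨ρ, N, hΩ, hb, h1, h2, h3, h4, h5⟩

namespace DefiningData

lemma uniqueDiffOn (h : DefiningData Ω ρ N) : UniqueDiffOn ℝ (closure Ω) :=
  uniqueDiffOn_closure h.isOpen h.boundary

lemma isCompact_closure (h : DefiningData Ω ρ N) : IsCompact (closure Ω) :=
  h.isBounded.isCompact_closure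

lemma mem_or_mem_frontier (h : DefiningData Ω ρ N) {x : EuclideanSpace ℝ (Fin n)}
    (hx : x ∈ closure Ω) : x ∈ Ω ∨ x ∈ frontier Ω := by
  by_cases hxΩ : x ∈ Ω
  · exact Or.inl hxΩ
  · exact Or.inr (by rw [h.isOpen.frontier_eq]; exact ⟨hx, hxΩ⟩)

lemma nonpos (h : DefiningData Ω ρ N) {x : EuclideanSpace ℝ (Fin n)} (hx : x ∈ closure Ω) :
    ρ x ≤ 0 := by
  rcases h.mem_or_mem_frontier hx with hx | hx
  · exact (h.neg x hx).le
  · exact (h.boundary x hx).1.le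

lemma gradient_pos (h : DefiningData Ω ρ N) {p : EuclideanSpace ℝ (Fin n)}
    (hp : p ∈ frontier Ω) : 0 < ‖gradient ρ p‖ :=
  norm_pos_iff.2 (h.boundary p hp).2.gradient_ne_zero

lemma norm_normal (h : DefiningData Ω ρ N) {p : EuclideanSpace ℝ (Fin n)}
    (hp : p ∈ frontier Ω) : ‖N p‖ = 1 := by
  rw [h.normal_eq p hp, norm_smul, norm_inv, norm_norm]
  exact inv_mul_cancel₀ (h.gradient_pos hp).ne'

lemma fderiv_normal (h : DefiningData Ω ρ N) {p : EuclideanSpace ℝ (Fin n)}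
    (hp : p ∈ frontier Ω) : fderiv ℝ ρ p (N p) = ‖gradient ρ p‖ := by
  rw [h.normal_eq p hp, map_smul, fderiv_gradient_self, smul_eq_mul, sq,
    inv_mul_cancel_left₀ (h.gradient_pos hp).ne']

lemma eventually_mem (h : DefiningData Ω ρ N) {p : EuclideanSpace ℝ (Fin n)}
    (hp : p ∈ frontier Ω) : ∀ᶠ t in 𝓝[>] (0 : ℝ), p + t • (-N p) ∈ closure Ω := by
  obtain ⟨h0, hl⟩ := h.boundary p hp
  have hd : HasFDerivAt ρ (fderiv ℝ ρ p) p :=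
    (hl.contDiffAt.differentiableAt (by norm_num)).hasFDerivAt
  refine (eventually_mem_of_fderiv_neg hd hl.mem_iff h0 ?_).mono fun t ht => subset_closure ht
  rw [map_neg, h.fderiv_normal hp]
  linarith [h.gradient_pos hp]

lemma tangent_eq_zero (h : DefiningData Ω ρ N) {F : Type*} [NormedAddCommGroup F]
    [NormedSpace ℝ F] {p τ : EuclideanSpace ℝ (Fin n)} (hp : p ∈ frontier Ω)
    {G : EuclideanSpace ℝ (Fin n) → F} {G' : EuclideanSpace ℝ (Fin n) →L[ℝ] F}
    (hG : HasFDerivWithinAt G G' (closure Ω) p) (hzero : ∀ x ∈ frontier Ω, G x = 0)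
    (hτ : inner ℝ (N p) τ = 0) : G' τ = 0 := by
  obtain ⟨h0, hl⟩ := h.boundary p hp
  refine hasFDerivWithinAt_tangent_eq_zero h.isOpen hp h0 hl hG hzero ?_
  rw [h.normal_eq p hp, inner_smul_left] at hτ
  rcases mul_eq_zero.1 hτ with h1 | h1
  · exact absurd h1 (by simpa using (h.gradient_pos hp).ne')
  · exact h1

/-- The gradient of the defining function is bounded below near the boundary. -/
lemma exists_gradient_lower (h : DefiningData Ω ρ N) :
    ∃ c > 0, ∀ x ∈ closure Ω, -c < ρ x → c ≤ ‖gradient ρ x‖ := by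
  rcases (closure Ω).eq_empty_or_nonempty with he | hne
  · exact ⟨1, one_pos, fun x hx => by simp [he] at hx⟩
  have hg : Continuous (gradient ρ) :=
    (InnerProductSpace.toDual ℝ _).symm.continuous.comp (h.contDiff.continuous_fderiv (by norm_num))
  have hc : Continuous fun x => -ρ x + ‖gradient ρ x‖ := h.contDiff.continuous.neg.add hg.norm
  obtain ⟨x, hx, hmin⟩ := h.isCompact_closure.exists_isMinOn hne hc.continuousOn
  have hpos : 0 < -ρ x + ‖gradient ρ x‖ := by
    rcases h.mem_or_mem_frontier hx with hx | hx
    · linarith [h.neg x hx, norm_nonneg (gradient ρ x)]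
    · linarith [(h.boundary x hx).1, h.gradient_pos hx]
  refine ⟨(-ρ x + ‖gradient ρ x‖) / 2, by positivity, fun y hy hlt => ?_⟩
  have : -ρ x + ‖gradient ρ x‖ ≤ -ρ y + ‖gradient ρ y‖ := hmin hy
  linarith

end DefiningData

/-- The barrier `1 - e^{ρ/ε}`: it vanishes on the boundary and grows to `1` in a layer of width
comparable to `ε`. -/
def barrier (ρ : EuclideanSpace ℝ (Fin n) → ℝ) (ε : ℝ) (x : EuclideanSpace ℝ (Fin n)) : ℝ :=
  1 - Real.exp (ρ x / ε)

lemma contDiff_barrier (hρ : ContDiff ℝ 4 ρ) (ε : ℝ) : ContDiff ℝ 4 (barrier ρ ε) :=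
  contDiff_const.sub (Real.contDiff_exp.comp (hρ.div_const ε))

lemma hasFDerivAt_barrier (hρ : ContDiff ℝ 4 ρ) (ε : ℝ) (x : EuclideanSpace ℝ (Fin n)) :
    HasFDerivAt (barrier ρ ε) (-(Real.exp (ρ x / ε) * ε⁻¹) • fderiv ℝ ρ x) x := by
  have h1 : HasFDerivAt ρ (fderiv ℝ ρ x) x := (hρ.differentiable (by norm_num) x).hasFDerivAt
  have h2 := ((h1.mul_const ε⁻¹).exp).const_sub 1
  simp only [← div_eq_mul_inv] at h2
  refine h2.congr_fderiv ?_
  rw [smul_smul, neg_smul]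

lemma fderivWithin_barrier (hρ : ContDiff ℝ 4 ρ) (ε : ℝ) {K : Set (EuclideanSpace ℝ (Fin n))}
    (hK : UniqueDiffOn ℝ K) {x : EuclideanSpace ℝ (Fin n)} (hx : x ∈ K) :
    fderivWithin ℝ (barrier ρ ε) K x = -(Real.exp (ρ x / ε) * ε⁻¹) • fderiv ℝ ρ x :=
  (hasFDerivAt_barrier hρ ε x).hasFDerivWithinAt.fderivWithin (hK x hx)

lemma D₂_barrier (hρ : ContDiff ℝ 4 ρ) (ε : ℝ) {K : Set (EuclideanSpace ℝ (Fin n))}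
    (hK : UniqueDiffOn ℝ K) {x : EuclideanSpace ℝ (Fin n)} (hx : x ∈ K)
    (a b : EuclideanSpace ℝ (Fin n)) :
    D₂ K (barrier ρ ε) x a b = -Real.exp (ρ x / ε) *
      (fderiv ℝ ρ x a * fderiv ℝ ρ x b * (ε⁻¹) ^ 2 + fderiv ℝ (fderiv ℝ ρ) x a b * ε⁻¹) := by
  have h1 : HasFDerivAt (fun y => fderiv ℝ ρ y b)
      ((ContinuousLinearMap.apply ℝ ℝ b).comp (fderiv ℝ (fderiv ℝ ρ) x)) x := by
    have h3 : ContDiff ℝ 3 (fderiv ℝ ρ) := hρ.fderiv_right (by norm_num)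
    exact (ContinuousLinearMap.apply ℝ ℝ b).hasFDerivAt.comp x
      (h3.differentiable (by norm_num) x).hasFDerivAt
  have h2 : HasFDerivAt (fun y => barrier ρ ε y - 1) _ x :=
    (hasFDerivAt_barrier hρ ε x).sub_const 1
  have h4 := ((h2.mul_const ε⁻¹).mul h1).hasFDerivWithinAt (s := K)
  have he : EqOn (fun y => fderivWithin ℝ (barrier ρ ε) K y b)
      (fun y => (barrier ρ ε y - 1) * ε⁻¹ * fderiv ℝ ρ y b) K := fun y hy => by
    simp only [fderivWithin_barrier hρ ε hK hy, barrier, smul_apply, smul_eq_mul]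
    ring
  rw [D₂_apply_of_hasFDerivWithinAt hK ((contDiff_barrier hρ ε).of_le (by norm_num)).contDiffOn hx
    b (h4.congr he (he hx))]
  simp [barrier]
  ring

lemma barrier_nonneg (h : DefiningData Ω ρ N) {ε : ℝ} (hε : 0 < ε)
    {x : EuclideanSpace ℝ (Fin n)} (hx : x ∈ closure Ω) : 0 ≤ barrier ρ ε x := by
  rw [barrier, sub_nonneg, Real.exp_le_one_iff]
  exact div_nonpos_of_nonpos_of_nonneg (h.nonpos hx) hε.le

lemma barrier_le_one (ε : ℝ) (x : EuclideanSpace ℝ (Fin n)) : barrier ρ ε x ≤ 1 := by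
  rw [barrier]
  linarith [Real.exp_pos (ρ x / ε)]

lemma barrier_eq_zero (h : DefiningData Ω ρ N) (ε : ℝ) {x : EuclideanSpace ℝ (Fin n)}
    (hx : x ∈ frontier Ω) : barrier ρ ε x = 0 := by
  rw [barrier, (h.boundary x hx).1]
  simp

/-- In a thin layer the barrier is a strict supersolution of every uniformly elliptic operator;
off this layer it is bounded below. -/
lemma exists_barrier (h : DefiningData Ω ρ N) {c : ℝ} (hc : 0 < c) :
    ∃ c₁ > 0, ∃ ε₁ > 0, ∀ ε, 0 < ε → ε ≤ ε₁ → ∀ x ∈ Ω, 1 / 2 ≤ barrier ρ ε x ∨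
      ∀ (f : WeightedFrame n (EuclideanSpace ℝ (Fin n)))
        (q : OrthonormalBasis (Fin n) ℝ (EuclideanSpace ℝ (Fin n))), f.vec = q →
        (∀ j, c * f.trace ≤ f.weight j) →
        f.lin (D₂ (closure Ω) (barrier ρ ε) x) ≤ -(c₁ / ε ^ 2 * f.trace) := by
  obtain ⟨c', hc', hgrad⟩ := h.exists_gradient_lower
  have hcont : Continuous (fderiv ℝ (fderiv ℝ ρ)) :=
    (show ContDiff ℝ 3 (fderiv ℝ ρ) from h.contDiff.fderiv_right (by norm_num)).continuous_fderiv
      (by norm_num)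
  obtain ⟨R, hR⟩ := h.isCompact_closure.exists_bound_of_continuousOn
    (E := EuclideanSpace ℝ (Fin n) →L[ℝ] EuclideanSpace ℝ (Fin n) →L[ℝ] ℝ)
    (f := fderiv ℝ (fderiv ℝ ρ)) (by exact hcont.continuousOn)
  set R' := max R 1
  have hR' : 0 < R' := lt_max_of_lt_right one_pos
  refine ⟨c * c' ^ 2 / 6, by positivity, min c' (c * c' ^ 2 / (2 * R')), by positivity,
    fun ε hε hε1 x hx => ?_⟩
  by_cases hlayer : ρ x ≤ -ε
  · left
    have h1 : ρ x / ε ≤ -1 := by rw [div_le_iff₀ hε]; linarith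
    have h2 : Real.exp (ρ x / ε) ≤ Real.exp (-1) := Real.exp_le_exp.2 h1
    have h3 : Real.exp (-1) ≤ 1 / 2 := by
      rw [Real.exp_neg, inv_le_comm₀ (Real.exp_pos 1) (by norm_num)]
      have := Real.add_one_le_exp (1 : ℝ)
      norm_num at this ⊢
      exact this
    rw [barrier]
    linarith
  right
  push Not at hlayer
  intro f q hq hf
  have hxK : x ∈ closure Ω := subset_closure hx
  have hg := hgrad x hxK (by linarith [hε1.trans (min_le_left _ _)])
  have hεb : ε * (2 * R') ≤ c * c' ^ 2 := by
    rw [← le_div_iff₀ (by positivity)]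
    exact hε1.trans (min_le_right _ _)
  have hT := f.trace_nonneg
  have hsum : c * c' ^ 2 * f.trace ≤ ∑ j, f.weight j * (fderiv ℝ ρ x (f.vec j)) ^ 2 := by
    have h1 : ∑ j, (fderiv ℝ ρ x (f.vec j)) ^ 2 = ‖gradient ρ x‖ ^ 2 := by
      rw [← q.sum_sq_norm_inner_left (gradient ρ x)]
      refine Finset.sum_congr rfl fun j _ => ?_
      rw [fderiv_eq_inner_gradient, hq, Real.norm_eq_abs, sq_abs]
    calc c * c' ^ 2 * f.trace ≤ c * ‖gradient ρ x‖ ^ 2 * f.trace := by gcongr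
      _ = ∑ j, c * f.trace * (fderiv ℝ ρ x (f.vec j)) ^ 2 := by
        rw [← Finset.mul_sum, h1]; ring
      _ ≤ _ := Finset.sum_le_sum fun j _ => mul_le_mul_of_nonneg_right (hf j) (sq_nonneg _)
  have hsec : -(R' * f.trace) ≤ f.lin (fderiv ℝ (fderiv ℝ ρ) x) := by
    have h1 := f.norm_lin_le (fderiv ℝ (fderiv ℝ ρ) x)
    have h2 : ‖fderiv ℝ (fderiv ℝ ρ) x‖ ≤ R' := (hR x hxK).trans (le_max_left _ _)
    have h3 := h1.trans (mul_le_mul_of_nonneg_right h2 hT)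
    exact neg_le_of_abs_le h3
  have hlin : f.lin (D₂ (closure Ω) (barrier ρ ε) x) = -Real.exp (ρ x / ε) *
      ((∑ j, f.weight j * (fderiv ℝ ρ x (f.vec j)) ^ 2) * (ε⁻¹) ^ 2
        + f.lin (fderiv ℝ (fderiv ℝ ρ) x) * ε⁻¹) := by
    simp only [WeightedFrame.lin, smul_eq_mul, D₂_barrier h.contDiff ε h.uniqueDiffOn hxK]
    rw [Finset.sum_mul, Finset.sum_mul, ← Finset.sum_add_distrib, Finset.mul_sum]
    refine Finset.sum_congr rfl fun j _ => ?_
    ring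
  have hexp : 1 / 3 ≤ Real.exp (ρ x / ε) := by
    have h1 : -1 ≤ ρ x / ε := by rw [le_div_iff₀ hε]; linarith
    have h2 := Real.exp_le_exp.2 h1
    have h3 : 1 / 3 ≤ Real.exp (-1) := by
      rw [Real.exp_neg, one_div, inv_le_inv₀ (by norm_num) (Real.exp_pos 1)]
      linarith [Real.exp_one_lt_d9]
    linarith
  rw [hlin, neg_mul, neg_le_neg_iff]
  have hcore : c * c' ^ 2 / 2 * f.trace * (ε⁻¹) ^ 2
      ≤ (∑ j, f.weight j * (fderiv ℝ ρ x (f.vec j)) ^ 2) * (ε⁻¹) ^ 2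
        + f.lin (fderiv ℝ (fderiv ℝ ρ) x) * ε⁻¹ := by
    have hi : 0 < ε⁻¹ := inv_pos.2 hε
    have h1 : R' * f.trace * ε⁻¹ ≤ c * c' ^ 2 / 2 * f.trace * (ε⁻¹) ^ 2 := by
      have : R' ≤ c * c' ^ 2 / 2 * ε⁻¹ := by
        rw [← div_eq_mul_inv, le_div_iff₀ hε]
        linarith
      calc R' * f.trace * ε⁻¹ ≤ (c * c' ^ 2 / 2 * ε⁻¹) * f.trace * ε⁻¹ := by gcongr
        _ = _ := by ring
    have h2 := mul_le_mul_of_nonneg_right hsum (sq_nonneg ε⁻¹)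
    have h3 := mul_le_mul_of_nonneg_right hsec hi.le
    linarith
  have hcore0 : 0 ≤ c * c' ^ 2 / 2 * f.trace * (ε⁻¹) ^ 2 := by positivity
  calc c * c' ^ 2 / 6 / ε ^ 2 * f.trace = 1 / 3 * (c * c' ^ 2 / 2 * f.trace * (ε⁻¹) ^ 2) := by
        rw [div_eq_mul_inv _ (ε ^ 2), inv_pow]; ring
    _ ≤ Real.exp (ρ x / ε) * (c * c' ^ 2 / 2 * f.trace * (ε⁻¹) ^ 2) := by gcongr
    _ ≤ _ := mul_le_mul_of_nonneg_left hcore (Real.exp_pos _).le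

end Barrier

/-! ### The double normal derivative on the boundary -/

section DoubleNormal

section Scalar

variable {E : Type*} [NormedAddCommGroup E] [NormedSpace ℝ E] {K Ω : Set E} {n : ℕ}

lemma D₂_const_mul {w : E → ℝ} (hK : UniqueDiffOn ℝ K) (hw : ContDiffOn ℝ 2 w K) {x : E}
    (hx : x ∈ K) (A : ℝ) : D₂ K (fun y => A * w y) x = A • D₂ K w x := by
  ext a b
  have := D₂_clm_comp (A • ContinuousLinearMap.id ℝ ℝ) hK hw hx a b
  simpa using this

lemma WeightedFrame.lin_smul (f : WeightedFrame n E) (A : ℝ) (b : E →L[ℝ] E →L[ℝ] ℝ) :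
    f.lin (A • b) = A * f.lin b := by
  simp only [lin, smul_apply, smul_eq_mul, Finset.mul_sum]
  exact Finset.sum_congr rfl fun j _ => by ring

lemma fderivWithin_const_mul_of_contDiffOn {w : E → ℝ} (hK : UniqueDiffOn ℝ K)
    (hw : ContDiffOn ℝ 2 w K) {x : E} (hx : x ∈ K) (A : ℝ) :
    fderivWithin ℝ (fun y => A * w y) K x = A • fderivWithin ℝ w K x :=
  ((hasFDerivWithinAt_of_contDiffOn (r := 2) (by norm_num) hw hx).const_mul A).fderivWithin
    (hK x hx)

lemma WeightedFrame.lin_nonneg_of_isMin (f : WeightedFrame n E) {w : E → ℝ} (hΩ : IsOpen Ω)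
    (hw : ContDiffOn ℝ 2 w Ω) {x : E} (hx : x ∈ Ω) (hmin : ∀ y ∈ Ω, w x ≤ w y) :
    0 ≤ f.lin (D₂ Ω w x) :=
  Finset.sum_nonneg fun j _ => mul_nonneg (f.weight_nonneg j)
    (D₂_nonneg_of_isMin hΩ hw hx hmin _).2

variable {I : Type*} {m : I → E → ℝ} {fr : I → E → WeightedFrame n E}

lemma Tame₀.const_mul {w : I → E → ℝ} (hK : UniqueDiffOn ℝ K) (hm : ∀ i x, 0 ≤ m i x) (A : ℝ)
    (hw : Tame₀ K m w) : Tame₀ K m (fun i x => A * w i x) :=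
  (tame₀_const (F := ℝ) hm (c := fun _ => A) (fun _ => le_rfl)).bilin (ContinuousLinearMap.mul ℝ ℝ)
    hK hm hw

lemma Tame₁.const_mul {w : I → E → ℝ} (hK : UniqueDiffOn ℝ K) (hΩK : Ω ⊆ K)
    (hm : ∀ i x, 0 ≤ m i x) (A : ℝ) (hw : Tame₁ K Ω m fr w) :
    Tame₁ K Ω m fr (fun i x => A * w i x) :=
  Tame₁.bilin (ContinuousLinearMap.mul ℝ ℝ) hK hΩK hm
    (tame₀_const (F := ℝ) hm (c := fun _ => A) (fun _ => le_rfl)) hw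

end Scalar

variable {I : Type*} {n : ℕ} {Ω : Set (EuclideanSpace ℝ (Fin n))}
  {ρ : EuclideanSpace ℝ (Fin n) → ℝ} {N : EuclideanSpace ℝ (Fin n) → EuclideanSpace ℝ (Fin n)}
  {u ψ Φ : I → EuclideanSpace ℝ (Fin n) → ℝ}
  {fr : I → EuclideanSpace ℝ (Fin n) → WeightedFrame n (EuclideanSpace ℝ (Fin n))}

/-- A family of solutions of uniformly elliptic equations with the Neumann condition `u_ν = Φ`. -/
structure NeumannFamily (Ω : Set (EuclideanSpace ℝ (Fin n))) (ρ : EuclideanSpace ℝ (Fin n) → ℝ)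
    (N : EuclideanSpace ℝ (Fin n) → EuclideanSpace ℝ (Fin n))
    (u ψ Φ : I → EuclideanSpace ℝ (Fin n) → ℝ)
    (fr : I → EuclideanSpace ℝ (Fin n) → WeightedFrame n (EuclideanSpace ℝ (Fin n))) : Prop where
  domain : DefiningData Ω ρ N
  equation : EllipticFamily Ω u ψ fr
  tame₀ : Tame₀ (closure Ω) (hessNorm (closure Ω) u) Φ
  tame₁ : Tame₁ (closure Ω) Ω (hessNorm (closure Ω) u) fr
    (fun i => fderivWithin ℝ (Φ i) (closure Ω))
  boundary : ∀ i, ∀ p ∈ frontier Ω, fderivWithin ℝ (u i) (closure Ω) p (N p) = Φ i p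

/-- Evaluation `(a, L) ↦ L a`. -/
def evalAt (E : Type*) [NormedAddCommGroup E] [NormedSpace ℝ E] : E →L[ℝ] (E →L[ℝ] ℝ) →L[ℝ] ℝ :=
  (ContinuousLinearMap.id ℝ (E →L[ℝ] ℝ)).flip

@[simp] lemma evalAt_apply {E : Type*} [NormedAddCommGroup E] [NormedSpace ℝ E] (a : E)
    (L : E →L[ℝ] ℝ) : evalAt E a L = L a := rfl

/-- The difference `Du · N - Φ`, which vanishes on the boundary. -/
def normalGap (Ω : Set (EuclideanSpace ℝ (Fin n)))
    (N : EuclideanSpace ℝ (Fin n) → EuclideanSpace ℝ (Fin n))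
    (u Φ : I → EuclideanSpace ℝ (Fin n) → ℝ) (i : I) (x : EuclideanSpace ℝ (Fin n)) : ℝ :=
  evalAt _ (N x) (fderivWithin ℝ (u i) (closure Ω) x) + (-1) * Φ i x

namespace NeumannFamily

lemma gap_eq_zero (h : NeumannFamily Ω ρ N u ψ Φ fr) (i : I) {p : EuclideanSpace ℝ (Fin n)}
    (hp : p ∈ frontier Ω) : normalGap Ω N u Φ i p = 0 := by
  rw [normalGap, evalAt_apply, h.boundary i p hp]
  ring

lemma tame₁_fderivWithin (h : NeumannFamily Ω ρ N u ψ Φ fr) :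
    Tame₁ (closure Ω) Ω (hessNorm (closure Ω) u) fr
      (fun i => fderivWithin ℝ (u i) (closure Ω)) :=
  h.equation.tame₁_fderivWithin h.domain.isOpen h.domain.uniqueDiffOn

lemma contDiffOn_Φ (h : NeumannFamily Ω ρ N u ψ Φ fr) (i : I) :
    ContDiffOn ℝ 2 (Φ i) (closure Ω) := by
  obtain ⟨C, -, hΦ⟩ := h.tame₀
  exact (hΦ i).1

/-- Fixed fields of class `C²` are controlled. -/
lemma tame₀_field (h : NeumannFamily Ω ρ N u ψ Φ fr) {F : Type*} [NormedAddCommGroup F]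
    [NormedSpace ℝ F] {w : EuclideanSpace ℝ (Fin n) → F} (hw : ContDiff ℝ 2 w) :
    Tame₀ (closure Ω) (hessNorm (closure Ω) u) (fun _ : I => w) :=
  tame₀_of_contDiffOn h.domain.uniqueDiffOn h.domain.isCompact_closure (hessNorm_nonneg _ u)
    hw.contDiffOn

lemma tame₁_gap (h : NeumannFamily Ω ρ N u ψ Φ fr) :
    Tame₁ (closure Ω) Ω (hessNorm (closure Ω) u) fr (normalGap Ω N u Φ) := by
  have hm := hessNorm_nonneg (closure Ω) u
  have hK := h.domain.uniqueDiffOn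
  have h1 := Tame₁.bilin (evalAt _) hK subset_closure hm
    (h.tame₀_field (h.domain.contDiff_normal.of_le (by norm_num))) h.tame₁_fderivWithin
  exact h1.add hK subset_closure ((h.tame₀.const_mul hK hm (-1)).tame₁ subset_closure hm)

lemma fderivWithin_gap (h : NeumannFamily Ω ρ N u ψ Φ fr) (i : I) {x : EuclideanSpace ℝ (Fin n)}
    (hx : x ∈ closure Ω) (a : EuclideanSpace ℝ (Fin n)) :
    fderivWithin ℝ (normalGap Ω N u Φ i) (closure Ω) x a
      = D₂ (closure Ω) (u i) x a (N x)
        + fderivWithin ℝ (u i) (closure Ω) x (fderivWithin ℝ N (closure Ω) x a)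
        - fderivWithin ℝ (Φ i) (closure Ω) x a := by
  have hK := h.domain.uniqueDiffOn
  have hu := contDiffOn_fderivWithin_of_three hK (h.equation.contDiffOn i)
  have hN : ContDiffOn ℝ 2 N (closure Ω) :=
    (h.domain.contDiff_normal.of_le (by norm_num)).contDiffOn
  have hΦ := h.contDiffOn_Φ i
  have hb : ContDiffOn ℝ 2 (fun y => evalAt _ (N y) (fderivWithin ℝ (u i) (closure Ω) y))
      (closure Ω) :=
    (evalAt _).isBoundedBilinearMap.contDiff.comp_contDiffOn (hN.prodMk hu)
  have hΦ' : ContDiffOn ℝ 2 (fun y => (-1) * Φ i y) (closure Ω) := contDiffOn_const.mul hΦ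
  have h1 := fderivWithin_add_of_contDiffOn hK hb hΦ' hx
  have h2 : fderivWithin ℝ (normalGap Ω N u Φ i) (closure Ω) x = _ := h1
  rw [h2, add_apply, fderivWithin_bilin _ hK hN hu hx,
    fderivWithin_const_mul_of_contDiffOn hK hΦ hx]
  simp only [evalAt_apply, smul_apply, smul_eq_mul, neg_mul, one_mul]
  rfl

/-- The double normal derivative is bounded by an arbitrarily small multiple of the second
derivatives. -/
lemma double_normal_le (h : NeumannFamily Ω ρ N u ψ Φ fr) {η : ℝ} (hη : 0 < η) :
    ∃ C, 0 ≤ C ∧ ∀ i M, (∀ x ∈ closure Ω, hessNorm (closure Ω) u i x ≤ M) →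
      ∀ p ∈ frontier Ω, D₂ (closure Ω) (u i) p (N p) (N p) ≤ C + η * M := by
  have hK := h.domain.uniqueDiffOn
  have hΩ := h.domain.isOpen
  have hΩK : Ω ⊆ closure Ω := subset_closure
  obtain ⟨Cg, hCg, hgap⟩ := h.tame₁_gap
  obtain ⟨CN, hCN, hN⟩ := h.tame₀_field (h.domain.contDiff_normal.of_le (by norm_num))
  obtain ⟨Cu, hCu, hu⟩ := h.equation.gradient_bounded
  obtain ⟨CΦ, hCΦ, hΦ⟩ := h.tame₀
  obtain ⟨Cρ, hCρ, hρ⟩ := h.tame₀_field (h.domain.contDiff.of_le (by norm_num))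
  obtain ⟨c, hc, hell⟩ := h.equation.elliptic
  obtain ⟨c₁, hc₁, ε₁, hε₁, hbar⟩ := exists_barrier h.domain hc
  set B : ℝ := (Cg + 1) / c₁ with hB
  have hB0 : 0 < B := by positivity
  set ε : ℝ := min ε₁ (η / (B * (Cρ + 1)))
  have hε : 0 < ε := by positivity
  have hεη : ε * (B * (Cρ + 1)) ≤ η := by
    rw [← le_div_iff₀ (by positivity)]; exact min_le_right _ _
  refine ⟨2 * Cg * Cρ / ε + η + Cu * CN + CΦ, by positivity, fun i M hM p hp => ?_⟩
  have hpK : p ∈ closure Ω := frontier_subset_closure hp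
  have hM0 : 0 ≤ M := (hessNorm_nonneg _ u i p).trans (hM p hpK)
  set A : ℝ := 2 * Cg + B * ε ^ 2 * (1 + M) with hA
  have hA0 : 0 ≤ A := by positivity
  have hbc : ContDiffOn ℝ 2 (barrier ρ ε) (closure Ω) :=
    ((contDiff_barrier h.domain.contDiff ε).of_le (by norm_num)).contDiffOn
  have hAbc : ContDiffOn ℝ 2 (fun y => A * barrier ρ ε y) (closure Ω) := contDiffOn_const.mul hbc
  have hgc : ContDiffOn ℝ 2 (normalGap Ω N u Φ i) (closure Ω) := (hgap i).1
  set w : EuclideanSpace ℝ (Fin n) → ℝ := fun y => normalGap Ω N u Φ i y + A * barrier ρ ε y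
  have hwc : ContDiffOn ℝ 2 w (closure Ω) := hgc.add hAbc
  have hwp : ∀ y ∈ frontier Ω, w y = 0 := fun y hy => by
    simp only [w, h.gap_eq_zero i hy, barrier_eq_zero h.domain ε hy]
    ring
  have hw0 : ∀ x ∈ closure Ω, 0 ≤ w x := by
    obtain ⟨x, hx, hmin⟩ := h.domain.isCompact_closure.exists_isMinOn ⟨p, hpK⟩ hwc.continuousOn
    suffices 0 ≤ w x from fun y hy => this.trans (hmin hy)
    rcases h.domain.mem_or_mem_frontier hx with hxΩ | hxf
    · rcases hbar ε hε (min_le_left _ _) x hxΩ with h1 | h1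
      · have h2 := neg_le_of_abs_le (((hgap i).2.1 x hx).1)
        have h3 : A * (1 / 2) ≤ A * barrier ρ ε x := mul_le_mul_of_nonneg_left h1 hA0
        have h4 : 0 ≤ B * ε ^ 2 * (1 + M) := by positivity
        simp only [w]
        linarith
      · exfalso
        obtain ⟨q, hq⟩ := h.equation.orthonormal i x hxΩ
        have h2 := h1 (fr i x) q hq (hell i x hxΩ).2
        have h3 := (fr i x).lin_nonneg_of_isMin hΩ (hwc.mono hΩK) hxΩ fun y hy => hmin (hΩK hy)
        rw [← D₂_eq_of_isOpen hΩ hΩK hxΩ, D₂_add hK hgc hAbc hx, WeightedFrame.lin_add,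
          D₂_const_mul hK hbc hx, WeightedFrame.lin_smul] at h3
        have h4 := (le_abs_self _).trans ((hgap i).2.2 x hxΩ)
        have hT : 0 < (fr i x).trace := hc.trans_le (hell i x hxΩ).1
        have h5 : Cg * ((fr i x).trace * (1 + hessNorm (closure Ω) u i x))
            ≤ Cg * ((fr i x).trace * (1 + M)) := by
          have := hM x hx
          gcongr
        have h6 : A * (fr i x).lin (D₂ (closure Ω) (barrier ρ ε) x)
            ≤ A * -(c₁ / ε ^ 2 * (fr i x).trace) := mul_le_mul_of_nonneg_left h2 hA0
        have h7 : (Cg + 1) * (1 + M) ≤ A * (c₁ / ε ^ 2) := by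
          have : (Cg + 1) * (1 + M) = B * ε ^ 2 * (1 + M) * (c₁ / ε ^ 2) := by
            rw [hB]; field_simp
          rw [this]
          gcongr
          linarith
        have h8 := mul_le_mul_of_nonneg_right h7 hT.le
        have h9 : 0 < (1 + M) * (fr i x).trace := by positivity
        linarith
    · exact (hwp x hxf).ge
  have hmax : ∀ y ∈ closure Ω, (fun y => -w y) y ≤ (fun y => -w y) p := fun y hy => by
    simp only [hwp p hp]
    linarith [hw0 y hy]
  have h1 := fderivWithin_nonpos_of_isMax
    (hasFDerivWithinAt_of_contDiffOn (r := 2) (by norm_num) hwc hpK).fun_neg hmax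
    (h.domain.eventually_mem hp)
  have h2 : fderivWithin ℝ w (closure Ω) p = _ := fderivWithin_add_of_contDiffOn hK hgc hAbc hpK
  rw [h2, fderivWithin_const_mul_of_contDiffOn hK hbc hpK,
    fderivWithin_barrier h.domain.contDiff ε hK hpK, (h.domain.boundary p hp).1] at h1
  simp only [neg_apply, add_apply, smul_apply, map_neg, smul_eq_mul, zero_div, Real.exp_zero,
    h.domain.fderiv_normal hp, h.fderivWithin_gap i hpK, neg_neg] at h1
  have hNp := h.domain.norm_normal hp
  have e1 : |fderivWithin ℝ (u i) (closure Ω) p (fderivWithin ℝ N (closure Ω) p (N p))|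
      ≤ Cu * CN := by
    have := (fderivWithin ℝ (u i) (closure Ω) p).le_of_opNorm_le (hu i p hpK)
      (fderivWithin ℝ N (closure Ω) p (N p))
    refine this.trans ?_
    have h3 := (fderivWithin ℝ N (closure Ω) p).le_of_opNorm_le ((hN i).2 p hpK).2.1 (N p)
    rw [hNp, mul_one] at h3
    gcongr
  have e2 : |fderivWithin ℝ (Φ i) (closure Ω) p (N p)| ≤ CΦ := by
    have := (fderivWithin ℝ (Φ i) (closure Ω) p).le_of_opNorm_le ((hΦ i).2 p hpK).2.1 (N p)
    rwa [hNp, mul_one] at this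
  have e3 : ‖gradient ρ p‖ ≤ Cρ := by
    have h3 : fderivWithin ℝ ρ (closure Ω) p = fderiv ℝ ρ p :=
      (h.domain.contDiff.differentiable (by norm_num) p).hasFDerivAt.hasFDerivWithinAt.fderivWithin
        (hK p hpK)
    have h4 := ((hρ i).2 p hpK).2.1
    rw [h3] at h4
    have h5 := (fderiv ℝ ρ p).le_of_opNorm_le h4 (N p)
    rw [hNp, mul_one, h.domain.fderiv_normal hp, norm_norm] at h5
    exact h5
  have e4 : A * (ε⁻¹ * ‖gradient ρ p‖) ≤ 2 * Cg * Cρ / ε + η * (1 + M) := by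
    calc A * (ε⁻¹ * ‖gradient ρ p‖) ≤ A * (ε⁻¹ * Cρ) := by gcongr
      _ = 2 * Cg * Cρ / ε + ε * (B * Cρ) * (1 + M) := by
        rw [hA]; field_simp
      _ ≤ 2 * Cg * Cρ / ε + ε * (B * (Cρ + 1)) * (1 + M) := by gcongr; linarith
      _ ≤ _ := by gcongr
  have e5 := neg_le_of_abs_le e1
  have e6 := le_of_abs_le e2
  linarith

end NeumannFamily

end DoubleNormal

/-! ### Tangential derivatives of the boundary condition and the auxiliary terms -/

section SquareTerm

variable {I : Type*} {n : ℕ} {E F : Type*} [NormedAddCommGroup E] [NormedSpace ℝ E]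
  [NormedAddCommGroup F] [NormedSpace ℝ F]

/-- The bilinear form `(a, b) ↦ ∑ ℓ(a) ℓ(b)` for finitely many linear forms `ℓ`. -/
def sumMul (ℓ : Fin n → F →L[ℝ] ℝ) : F →L[ℝ] F →L[ℝ] ℝ :=
  ∑ l, (ContinuousLinearMap.mul ℝ ℝ).bilinearComp (ℓ l) (ℓ l)

lemma sumMul_apply (ℓ : Fin n → F →L[ℝ] ℝ) (a b : F) : sumMul ℓ a b = ∑ l, ℓ l a * ℓ l b := by
  simp [sumMul]

/-- A quadratic form in a controlled family: its second derivative contains the square of the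
first derivatives. -/
lemma Tame₁.quadratic {K Ω : Set E} {m : I → E → ℝ} {fr : I → E → WeightedFrame n E}
    (B : F →L[ℝ] F →L[ℝ] ℝ) {v : I → E → F} (hK : UniqueDiffOn ℝ K) (hΩK : Ω ⊆ K)
    (hm : ∀ i x, 0 ≤ m i x) (hv : Tame₁ K Ω m fr v) :
    ∃ C, 0 ≤ C ∧ ∀ i, ContDiffOn ℝ 2 (fun y => B (v i y) (v i y)) K ∧
      (∀ x ∈ K, B (v i x) (v i x) ≤ C ∧ ‖fderivWithin ℝ (fun y => B (v i y) (v i y)) K x‖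
        ≤ C * (1 + m i x)) ∧
      ∀ x ∈ Ω, 2 * ∑ j, (fr i x).weight j * B (fderivWithin ℝ (v i) K x ((fr i x).vec j))
          (fderivWithin ℝ (v i) K x ((fr i x).vec j)) - C * (1 + m i x) * (fr i x).trace
        ≤ (fr i x).lin (D₂ K (fun y => B (v i y) (v i y)) x) := by
  obtain ⟨C, hC, hu⟩ := hv
  have hB := norm_nonneg B
  refine ⟨2 * (‖B‖ * C * C), by positivity, fun i => ?_⟩
  have huc := (hu i).1
  have hb : ∀ (a b : F) (s t : ℝ), ‖a‖ ≤ s → ‖b‖ ≤ t → 0 ≤ s →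
      |B a b| ≤ ‖B‖ * s * t := fun a b s t ha hb hs => (B.le_opNorm₂ a b).trans (by gcongr)
  have hP : 0 ≤ ‖B‖ * C * C := by positivity
  refine ⟨B.isBoundedBilinearMap.contDiff.comp_contDiffOn (huc.prodMk huc),
    fun x hx => ⟨?_, ?_⟩, fun x hx => ?_⟩
  · obtain ⟨h1, -⟩ := (hu i).2.1 x hx
    have := (le_abs_self _).trans (hb _ _ _ _ h1 h1 hC)
    linarith
  · obtain ⟨h1, h2⟩ := (hu i).2.1 x hx
    have hmx := hm i x
    refine ContinuousLinearMap.opNorm_le_bound _ (by positivity) fun a => ?_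
    have h4 := (fderivWithin ℝ (v i) K x).le_of_opNorm_le h2 a
    rw [fderivWithin_bilin B hK huc huc hx a]
    refine (norm_add_le _ _).trans ((add_le_add (hb _ _ _ _ h1 h4 hC)
      (hb _ _ _ _ h4 h1 (by positivity))).trans (le_of_eq ?_))
    ring
  · have hxK : x ∈ K := hΩK hx
    obtain ⟨h1, -⟩ := (hu i).2.1 x hxK
    have h2 := (hu i).2.2 x hx
    have hT := (fr i x).trace_nonneg
    have hmx := hm i x
    have hsplit : (fr i x).lin (D₂ K (fun y => B (v i y) (v i y)) x)
        = B (v i x) ((fr i x).lin (D₂ K (v i) x)) + B ((fr i x).lin (D₂ K (v i) x)) (v i x)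
          + 2 * ∑ j, (fr i x).weight j * B (fderivWithin ℝ (v i) K x ((fr i x).vec j))
          (fderivWithin ℝ (v i) K x ((fr i x).vec j)) := by
      simp only [WeightedFrame.lin, map_sum, map_smul, sum_apply, smul_apply]
      rw [← Finset.sum_add_distrib, Finset.mul_sum, ← Finset.sum_add_distrib]
      refine Finset.sum_congr rfl fun j _ => ?_
      rw [D₂_bilin B hK huc huc hxK]
      simp only [smul_eq_mul]
      ring
    have e1 := neg_le_of_abs_le (hb _ _ _ _ h1 h2 hC)
    have e2 := neg_le_of_abs_le (hb _ _ _ _ h2 h1 (by positivity))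
    rw [hsplit]
    linarith

end SquareTerm

section Auxiliary

variable {I : Type*} {n : ℕ} {Ω : Set (EuclideanSpace ℝ (Fin n))}
  {ρ : EuclideanSpace ℝ (Fin n) → ℝ} {N : EuclideanSpace ℝ (Fin n) → EuclideanSpace ℝ (Fin n)}
  {u ψ Φ : I → EuclideanSpace ℝ (Fin n) → ℝ}
  {fr : I → EuclideanSpace ℝ (Fin n) → WeightedFrame n (EuclideanSpace ℝ (Fin n))}

/-- The component `ξ - ⟨ξ, N⟩ N` of `ξ` tangential to the field `N`. -/
def tang (N : EuclideanSpace ℝ (Fin n) → EuclideanSpace ℝ (Fin n))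
    (ξ y : EuclideanSpace ℝ (Fin n)) : EuclideanSpace ℝ (Fin n) :=
  ξ + (-1 : ℝ) • (inner ℝ ξ (N y) • N y)

lemma inner_tang {ξ y : EuclideanSpace ℝ (Fin n)} (hN : ‖N y‖ = 1) :
    inner ℝ (N y) (tang N ξ y) = 0 := by
  rw [tang, inner_add_right, inner_smul_right, inner_smul_right, real_inner_self_eq_norm_sq, hN,
    real_inner_comm]
  ring

/-- The correction `2 ⟨ξ, N⟩ (DΦ - Du ∘ DN) (ξ - ⟨ξ, N⟩ N)`, which on the boundary equals the
mixed tangential-normal part of `D²u(ξ, ξ)`. -/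
def correction (Ω : Set (EuclideanSpace ℝ (Fin n)))
    (N : EuclideanSpace ℝ (Fin n) → EuclideanSpace ℝ (Fin n))
    (u Φ : I → EuclideanSpace ℝ (Fin n) → ℝ) (i : I) (ξ y : EuclideanSpace ℝ (Fin n)) : ℝ :=
  fderivWithin ℝ (Φ i) (closure Ω) y ((2 * inner ℝ ξ (N y)) • tang N ξ y) +
    (-1) * fderivWithin ℝ (u i) (closure Ω) y
      (fderiv ℝ N y ((2 * inner ℝ ξ (N y)) • tang N ξ y))

/-- The squared length of the gradient. -/
def gradSq (Ω : Set (EuclideanSpace ℝ (Fin n))) (u : I → EuclideanSpace ℝ (Fin n) → ℝ) (i : I)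
    (y : EuclideanSpace ℝ (Fin n)) : ℝ :=
  sumMul (fun l => ContinuousLinearMap.apply ℝ ℝ (EuclideanSpace.basisFun (Fin n) ℝ l))
    (fderivWithin ℝ (u i) (closure Ω) y) (fderivWithin ℝ (u i) (closure Ω) y)

lemma gradSq_nonneg (i : I) (y : EuclideanSpace ℝ (Fin n)) : 0 ≤ gradSq Ω u i y := by
  rw [gradSq, sumMul_apply]
  exact Finset.sum_nonneg fun l _ => mul_self_nonneg _

/-- The operator norm of a bilinear form is at most its Hilbert–Schmidt norm. -/
lemma sq_opNorm_le_sum {E : Type*} [NormedAddCommGroup E] [InnerProductSpace ℝ E]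
    (p q : OrthonormalBasis (Fin n) ℝ E) (B : E →L[ℝ] E →L[ℝ] ℝ) :
    ‖B‖ ^ 2 ≤ ∑ j, ∑ l, (B (p j) (q l)) ^ 2 := by
  set S := ∑ j, ∑ l, (B (p j) (q l)) ^ 2
  have hS : 0 ≤ S := Finset.sum_nonneg fun j _ => Finset.sum_nonneg fun l _ => sq_nonneg _
  have h1 : ‖B‖ ≤ √S := by
    refine ContinuousLinearMap.opNorm_le_bound₂ _ (Real.sqrt_nonneg _) fun x y => ?_
    have hexp : B x y = ∑ z : Fin n × Fin n, B (p z.1) (q z.2) *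
        (inner ℝ (p z.1) x * inner ℝ (q z.2) y) := by
      conv_lhs => rw [← p.sum_repr' x, ← q.sum_repr' y]
      rw [Fintype.sum_prod_type]
      simp only [map_sum, map_smul, sum_apply, smul_apply, smul_eq_mul, Finset.mul_sum]
      rw [Finset.sum_comm]
      refine Finset.sum_congr rfl fun j _ => Finset.sum_congr rfl fun l _ => ?_
      ring
    have hcs := Finset.sum_mul_sq_le_sq_mul_sq Finset.univ
      (fun z : Fin n × Fin n => B (p z.1) (q z.2))
      (fun z => inner ℝ (p z.1) x * inner ℝ (q z.2) y)
    have h2 : ∑ z : Fin n × Fin n, (B (p z.1) (q z.2)) ^ 2 = S := Fintype.sum_prod_type _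
    have h3 : ∑ z : Fin n × Fin n, (inner ℝ (p z.1) x * inner ℝ (q z.2) y) ^ 2
        = ‖x‖ ^ 2 * ‖y‖ ^ 2 := by
      rw [Fintype.sum_prod_type, ← p.sum_sq_norm_inner_right x, ← q.sum_sq_norm_inner_right y,
        Finset.sum_mul_sum]
      refine Finset.sum_congr rfl fun j _ => Finset.sum_congr rfl fun l _ => ?_
      simp only [Real.norm_eq_abs, sq_abs]
      ring
    rw [← hexp, h2, h3] at hcs
    rw [Real.norm_eq_abs]
    refine abs_le_of_sq_le_sq ?_ (by positivity)
    rw [mul_pow, mul_pow, Real.sq_sqrt hS]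
    linarith
  calc ‖B‖ ^ 2 ≤ √S ^ 2 := pow_le_pow_left₀ (norm_nonneg B) h1 2
    _ = S := Real.sq_sqrt hS

namespace NeumannFamily

/-- The tangential components are controlled, uniformly over all unit vectors `ξ`. -/
lemma tame₀_tang (h : NeumannFamily Ω ρ N u ψ Φ fr) :
    Tame₀ (I := I × Metric.sphere (0 : EuclideanSpace ℝ (Fin n)) 1) (closure Ω)
      (fun i => hessNorm (closure Ω) u i.1) (fun i => tang N i.2) ∧
    Tame₀ (I := I × Metric.sphere (0 : EuclideanSpace ℝ (Fin n)) 1) (closure Ω)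
      (fun i => hessNorm (closure Ω) u i.1)
      (fun i y => (2 * inner ℝ (i.2 : EuclideanSpace ℝ (Fin n)) (N y)) • tang N i.2 y) := by
  set J := I × Metric.sphere (0 : EuclideanSpace ℝ (Fin n)) 1
  have hK := h.domain.uniqueDiffOn
  have hm : ∀ (i : J) x, 0 ≤ hessNorm (closure Ω) u i.1 x := fun i => hessNorm_nonneg _ u i.1
  have hN : Tame₀ (closure Ω) (fun i : J => hessNorm (closure Ω) u i.1) (fun _ => N) :=
    (h.tame₀_field (h.domain.contDiff_normal.of_le (by norm_num))).reindex Prod.fst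
  have hξ : Tame₀ (closure Ω) (fun i : J => hessNorm (closure Ω) u i.1)
      (fun i _ => (i.2 : EuclideanSpace ℝ (Fin n))) :=
    tame₀_const hm (C := 1) fun i => (mem_sphere_zero_iff_norm.1 i.2.2).le
  have hc : ∀ a : ℝ, Tame₀ (closure Ω) (fun i : J => hessNorm (closure Ω) u i.1)
      (fun _ _ => a) := fun a => tame₀_const hm (C := ‖a‖) fun _ => le_rfl
  have hs := hξ.bilin (innerSL ℝ) hK hm hN
  have hsm : ∀ {v : J → EuclideanSpace ℝ (Fin n) → ℝ}
      {w : J → EuclideanSpace ℝ (Fin n) → EuclideanSpace ℝ (Fin n)},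
      Tame₀ (closure Ω) (fun i : J => hessNorm (closure Ω) u i.1) v →
      Tame₀ (closure Ω) (fun i : J => hessNorm (closure Ω) u i.1) w →
      Tame₀ (closure Ω) (fun i : J => hessNorm (closure Ω) u i.1) (fun i y => v i y • w i y) :=
    fun hv hw => hv.bilin (ContinuousLinearMap.lsmul ℝ ℝ) hK hm hw
  have ht : Tame₀ (closure Ω) (fun i : J => hessNorm (closure Ω) u i.1) (fun i => tang N i.2) :=
    hξ.add hK (hsm (hc (-1)) (hsm hs hN))
  exact ⟨ht, hsm (hs.const_mul hK hm 2) ht⟩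

lemma tame₁_correction (h : NeumannFamily Ω ρ N u ψ Φ fr) :
    Tame₁ (I := I × Metric.sphere (0 : EuclideanSpace ℝ (Fin n)) 1) (closure Ω) Ω
      (fun i => hessNorm (closure Ω) u i.1) (fun i => fr i.1)
      (fun i => correction Ω N u Φ i.1 i.2) := by
  set J := I × Metric.sphere (0 : EuclideanSpace ℝ (Fin n)) 1
  have hK := h.domain.uniqueDiffOn
  have hm : ∀ (i : J) x, 0 ≤ hessNorm (closure Ω) u i.1 x := fun i => hessNorm_nonneg _ u i.1
  have hζ := h.tame₀_tang.2
  have hΦ : Tame₁ (closure Ω) Ω (fun i : J => hessNorm (closure Ω) u i.1) (fun i => fr i.1)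
      (fun i => fderivWithin ℝ (Φ i.1) (closure Ω)) := h.tame₁.reindex Prod.fst
  have hu : Tame₁ (closure Ω) Ω (fun i : J => hessNorm (closure Ω) u i.1) (fun i => fr i.1)
      (fun i => fderivWithin ℝ (u i.1) (closure Ω)) := h.tame₁_fderivWithin.reindex Prod.fst
  have hDN : Tame₀ (closure Ω) (fun i : J => hessNorm (closure Ω) u i.1)
      (fun _ => fderiv ℝ N) :=
    (h.tame₀_field (h.domain.contDiff_normal.fderiv_right (by norm_num))).reindex Prod.fst
  have h1 := Tame₁.bilin (evalAt _) hK subset_closure hm hζ hΦ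
  have h2 := Tame₁.bilin (evalAt _) hK subset_closure hm
    (hDN.bilin (ContinuousLinearMap.id ℝ _) hK hm hζ) hu
  exact h1.add hK subset_closure (h2.const_mul hK subset_closure hm (-1))

/-- Differentiating the boundary condition twice in a tangential direction. -/
lemma tangential_third_le (h : NeumannFamily Ω ρ N u ψ Φ fr) :
    ∃ C, 0 ≤ C ∧ ∀ i, ∀ p ∈ frontier Ω, ∀ τ, ‖τ‖ = 1 → inner ℝ (N p) τ = 0 →
      D₂ (closure Ω) (fderivWithin ℝ (u i) (closure Ω)) p τ τ (N p)
        ≤ C * (1 + hessNorm (closure Ω) u i p) := by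
  have hK := h.domain.uniqueDiffOn
  obtain ⟨CT, hCT, hT⟩ := h.tame₀_tang.1
  obtain ⟨Cg, hCg, hg⟩ := h.tame₁_gap
  obtain ⟨CN, hCN, hN⟩ := h.tame₀_field (h.domain.contDiff_normal.of_le (by norm_num))
  obtain ⟨Cu, hCu, hu⟩ := h.equation.gradient_bounded
  obtain ⟨CΦ, hCΦ, hΦ⟩ := h.tame₀
  refine ⟨Cg * CT + 2 * CN + Cu * CN + CΦ, by positivity, fun i p hp τ hτ hτN => ?_⟩
  have hpK : p ∈ closure Ω := frontier_subset_closure hp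
  have hgc := (hg i).1
  have huc := contDiffOn_fderivWithin_of_three hK (h.equation.contDiffOn i)
  have hNc : ContDiffOn ℝ 2 N (closure Ω) :=
    (h.domain.contDiff_normal.of_le (by norm_num)).contDiffOn
  have hΦc := h.contDiffOn_Φ i
  set m := hessNorm (closure Ω) u i p
  have hm : 0 ≤ m := hessNorm_nonneg _ u i p
  have htang : tang N τ p = τ := by
    rw [tang, real_inner_comm, hτN]
    simp
  obtain ⟨hTc, hTb⟩ := hT ⟨i, ⟨τ, mem_sphere_zero_iff_norm.2 hτ⟩⟩
  -- the tangential derivative of the boundary condition vanishes along the boundary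
  have hG : HasFDerivWithinAt
      (fun y => fderivWithin ℝ (normalGap Ω N u Φ i) (closure Ω) y (tang N τ y)) _ (closure Ω) p :=
    (hasFDerivWithinAt_fderivWithin hK hgc hpK).clm_apply
      (hasFDerivWithinAt_of_contDiffOn (r := 2) (by norm_num) hTc hpK)
  have hzero := h.domain.tangent_eq_zero hp hG (fun y hy =>
    h.domain.tangent_eq_zero hy (hasFDerivWithinAt_of_contDiffOn (r := 2) (by norm_num) hgc
      (frontier_subset_closure hy)) (fun x hx => h.gap_eq_zero i hx)
      (inner_tang (h.domain.norm_normal hy))) hτN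
  have hzero' : fderivWithin ℝ (normalGap Ω N u Φ i) (closure Ω) p
      (fderivWithin ℝ (tang N τ) (closure Ω) p τ)
      + D₂ (closure Ω) (normalGap Ω N u Φ i) p τ τ = 0 := by
    simpa [htang] using hzero
  have e1 : |fderivWithin ℝ (normalGap Ω N u Φ i) (closure Ω) p
      (fderivWithin ℝ (tang N τ) (closure Ω) p τ)| ≤ Cg * (1 + m) * CT := by
    have h1 := (fderivWithin ℝ (normalGap Ω N u Φ i) (closure Ω) p).le_of_opNorm_le
      (((hg i).2.1 p hpK).2) (fderivWithin ℝ (tang N τ) (closure Ω) p τ)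
    have h2 := (fderivWithin ℝ (tang N τ) (closure Ω) p).le_of_opNorm_le (hTb p hpK).2.1 τ
    rw [hτ, mul_one] at h2
    exact h1.trans (mul_le_mul_of_nonneg_left h2 (by positivity))
  have hb : ContDiffOn ℝ 2 (fun y => evalAt _ (N y) (fderivWithin ℝ (u i) (closure Ω) y))
      (closure Ω) :=
    (evalAt _).isBoundedBilinearMap.contDiff.comp_contDiffOn (hNc.prodMk huc)
  have hΦ' : ContDiffOn ℝ 2 (fun y => (-1) * Φ i y) (closure Ω) := contDiffOn_const.mul hΦc
  have h2 : D₂ (closure Ω) (normalGap Ω N u Φ i) p = _ := D₂_add hK hb hΦ' hpK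
  have h3 : D₂ (closure Ω) (normalGap Ω N u Φ i) p τ τ
      = D₂ (closure Ω) (fderivWithin ℝ (u i) (closure Ω)) p τ τ (N p)
        + 2 * D₂ (closure Ω) (u i) p τ (fderivWithin ℝ N (closure Ω) p τ)
        + fderivWithin ℝ (u i) (closure Ω) p (D₂ (closure Ω) N p τ τ)
        - D₂ (closure Ω) (Φ i) p τ τ := by
    rw [h2, add_apply, add_apply, D₂_bilin _ hK hNc huc hpK, D₂_const_mul hK hΦc hpK]
    simp only [evalAt_apply, smul_apply, smul_eq_mul]
    change _ + D₂ (closure Ω) (u i) p τ (fderivWithin ℝ N (closure Ω) p τ)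
      + D₂ (closure Ω) (u i) p τ (fderivWithin ℝ N (closure Ω) p τ) + _ + _ = _
    ring
  have e2 : |D₂ (closure Ω) (u i) p τ (fderivWithin ℝ N (closure Ω) p τ)| ≤ m * CN := by
    have h4 := (fderivWithin ℝ N (closure Ω) p).le_of_opNorm_le ((hN i).2 p hpK).2.1 τ
    rw [hτ, mul_one] at h4
    have h5 := ContinuousLinearMap.le_of_opNorm₂_le_of_le (D₂ (closure Ω) (u i) p)
      (le_refl m) hτ.le h4
    rwa [mul_one] at h5
  have e3 : |fderivWithin ℝ (u i) (closure Ω) p (D₂ (closure Ω) N p τ τ)|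
      ≤ Cu * (CN * (1 + m)) := by
    have h4 := ContinuousLinearMap.le_of_opNorm₂_le_of_le (D₂ (closure Ω) N p)
      ((hN i).2 p hpK).2.2 hτ.le hτ.le
    rw [mul_one, mul_one] at h4
    exact ((fderivWithin ℝ (u i) (closure Ω) p).le_of_opNorm_le (hu i p hpK) _).trans
      (mul_le_mul_of_nonneg_left h4 hCu)
  have e4 : |D₂ (closure Ω) (Φ i) p τ τ| ≤ CΦ * (1 + m) := by
    have h4 := ContinuousLinearMap.le_of_opNorm₂_le_of_le (D₂ (closure Ω) (Φ i) p)
      ((hΦ i).2 p hpK).2.2 hτ.le hτ.le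
    rwa [mul_one, mul_one] at h4
  have f1 := neg_le_of_abs_le e1
  have f2 := neg_le_of_abs_le e2
  have f3 := neg_le_of_abs_le e3
  have f4 := le_of_abs_le e4
  linarith

/-- The term `|Du|²` produces a good quadratic term. -/
lemma gradSq_bounds (h : NeumannFamily Ω ρ N u ψ Φ fr) :
    ∃ C c, 0 ≤ C ∧ 0 < c ∧ ∀ i, ContDiffOn ℝ 2 (gradSq Ω u i) (closure Ω) ∧
      (∀ x ∈ closure Ω, gradSq Ω u i x ≤ C ∧ ‖fderivWithin ℝ (gradSq Ω u i) (closure Ω) x‖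
        ≤ C * (1 + hessNorm (closure Ω) u i x)) ∧
      ∀ x ∈ Ω, (c * hessNorm (closure Ω) u i x ^ 2 - C * (1 + hessNorm (closure Ω) u i x))
        * (fr i x).trace ≤ (fr i x).lin (D₂ (closure Ω) (gradSq Ω u i) x) := by
  have hK := h.domain.uniqueDiffOn
  have hm := hessNorm_nonneg (closure Ω) u
  obtain ⟨C, hC, hu⟩ := h.tame₁_fderivWithin.quadratic (sumMul fun l =>
    ContinuousLinearMap.apply ℝ ℝ (EuclideanSpace.basisFun (Fin n) ℝ l)) hK subset_closure hm
  obtain ⟨c, hc, hell⟩ := h.equation.elliptic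
  refine ⟨C, 2 * c, hC, by positivity, fun i => ⟨(hu i).1, (hu i).2.1, fun x hx => ?_⟩⟩
  have hT := (fr i x).trace_nonneg
  obtain ⟨q, hq⟩ := h.equation.orthonormal i x hx
  refine le_trans ?_ ((hu i).2.2 x hx)
  have h4 : ∀ j, sumMul (fun l => ContinuousLinearMap.apply ℝ ℝ
        (EuclideanSpace.basisFun (Fin n) ℝ l)) (D₂ (closure Ω) (u i) x ((fr i x).vec j))
        (D₂ (closure Ω) (u i) x ((fr i x).vec j))
      = ∑ l, (D₂ (closure Ω) (u i) x ((fr i x).vec j)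
          (EuclideanSpace.basisFun (Fin n) ℝ l)) ^ 2 := fun j => by
    rw [sumMul_apply]
    exact Finset.sum_congr rfl fun l _ => (sq _).symm
  have hsum : c * (fr i x).trace * hessNorm (closure Ω) u i x ^ 2
      ≤ ∑ j, (fr i x).weight j * sumMul (fun l => ContinuousLinearMap.apply ℝ ℝ
        (EuclideanSpace.basisFun (Fin n) ℝ l)) (D₂ (closure Ω) (u i) x ((fr i x).vec j))
        (D₂ (closure Ω) (u i) x ((fr i x).vec j)) := by
    have h3 := sq_opNorm_le_sum q (EuclideanSpace.basisFun (Fin n) ℝ) (D₂ (closure Ω) (u i) x)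
    calc c * (fr i x).trace * hessNorm (closure Ω) u i x ^ 2
        ≤ c * (fr i x).trace * ∑ j, ∑ l, (D₂ (closure Ω) (u i) x (q j)
            (EuclideanSpace.basisFun (Fin n) ℝ l)) ^ 2 :=
          mul_le_mul_of_nonneg_left h3 (by positivity)
      _ ≤ _ := by
          rw [Finset.mul_sum]
          refine Finset.sum_le_sum fun j _ => ?_
          rw [h4, hq]
          exact mul_le_mul_of_nonneg_right ((hell i x hx).2 j)
            (Finset.sum_nonneg fun l _ => sq_nonneg _)
  have h5 := mul_le_mul_of_nonneg_left hsum (zero_le_two (α := ℝ))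
  change _ ≤ 2 * ∑ j, (fr i x).weight j * sumMul _ (D₂ (closure Ω) (u i) x ((fr i x).vec j))
        (D₂ (closure Ω) (u i) x ((fr i x).vec j)) - _
  linarith

end NeumannFamily

end Auxiliary

/-! ### The maximum principle for the second derivatives -/

section Main

variable {I : Type*} {n : ℕ} {Ω : Set (EuclideanSpace ℝ (Fin n))}
  {ρ : EuclideanSpace ℝ (Fin n) → ℝ} {N : EuclideanSpace ℝ (Fin n) → EuclideanSpace ℝ (Fin n)}
  {u ψ Φ : I → EuclideanSpace ℝ (Fin n) → ℝ}
  {fr : I → EuclideanSpace ℝ (Fin n) → WeightedFrame n (EuclideanSpace ℝ (Fin n))}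

lemma abs_apply_self_le {B : EuclideanSpace ℝ (Fin n) →L[ℝ] EuclideanSpace ℝ (Fin n) →L[ℝ] ℝ}
    {ξ : EuclideanSpace ℝ (Fin n)} (hξ : ‖ξ‖ = 1) : |B ξ ξ| ≤ ‖B‖ := by
  have := B.le_opNorm₂ ξ ξ
  simpa [hξ] using this

namespace NeumannFamily

lemma continuousOn_D₂ (h : NeumannFamily Ω ρ N u ψ Φ fr) (i : I) :
    ContinuousOn (D₂ (closure Ω) (u i)) (closure Ω) :=
  (contDiffOn_D₂_of_three h.domain.uniqueDiffOn (h.equation.contDiffOn i)).continuousOn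

lemma continuousOn_auxiliary (h : NeumannFamily Ω ρ N u ψ Φ fr) (i : I) (κ ε : ℝ) :
    ContinuousOn (fun z : EuclideanSpace ℝ (Fin n) × EuclideanSpace ℝ (Fin n) =>
      -D₂ (closure Ω) (u i) z.1 z.2 z.2 + correction Ω N u Φ i z.2 z.1
        + (-1) * gradSq Ω u i z.1 + κ * barrier ρ ε z.1) (closure Ω ×ˢ univ) := by
  have hK := h.domain.uniqueDiffOn
  have hfst : MapsTo (Prod.fst : EuclideanSpace ℝ (Fin n) × EuclideanSpace ℝ (Fin n) → _)
      (closure Ω ×ˢ univ) (closure Ω) := fun z hz => hz.1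
  have h1 : ContinuousOn (fun z : EuclideanSpace ℝ (Fin n) × EuclideanSpace ℝ (Fin n) =>
      D₂ (closure Ω) (u i) z.1) (closure Ω ×ˢ univ) :=
    (h.continuousOn_D₂ i).comp continuousOn_fst hfst
  have h2 : ContinuousOn (fun z : EuclideanSpace ℝ (Fin n) × EuclideanSpace ℝ (Fin n) =>
      fderivWithin ℝ (Φ i) (closure Ω) z.1) (closure Ω ×ˢ univ) :=
    ((h.contDiffOn_Φ i).continuousOn_fderivWithin hK (by norm_num)).comp continuousOn_fst hfst
  have h3 : ContinuousOn (fun z : EuclideanSpace ℝ (Fin n) × EuclideanSpace ℝ (Fin n) =>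
      fderivWithin ℝ (u i) (closure Ω) z.1) (closure Ω ×ˢ univ) :=
    ((h.equation.contDiffOn i).continuousOn_fderivWithin hK (by norm_num)).comp
      continuousOn_fst hfst
  have h4 : ContinuousOn (fun z : EuclideanSpace ℝ (Fin n) × EuclideanSpace ℝ (Fin n) =>
      gradSq Ω u i z.1) (closure Ω ×ˢ univ) := by
    obtain ⟨C, c, -, -, hg⟩ := h.gradSq_bounds
    exact (hg i).1.continuousOn.comp continuousOn_fst hfst
  have hN : Continuous N := h.domain.contDiff_normal.continuous
  have hDN : Continuous (fderiv ℝ N) := h.domain.contDiff_normal.continuous_fderiv (by norm_num)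
  have h5 : Continuous (fun z : EuclideanSpace ℝ (Fin n) × EuclideanSpace ℝ (Fin n) =>
      (2 * inner ℝ z.2 (N z.1)) • tang N z.2 z.1) := by
    unfold tang
    fun_prop
  have h6 : Continuous (fun z : EuclideanSpace ℝ (Fin n) × EuclideanSpace ℝ (Fin n) =>
      κ * barrier ρ ε z.1) :=
    continuous_const.mul ((contDiff_barrier h.domain.contDiff ε).continuous.comp continuous_fst)
  have h7 : ContinuousOn (fun z : EuclideanSpace ℝ (Fin n) × EuclideanSpace ℝ (Fin n) =>
      correction Ω N u Φ i z.2 z.1) (closure Ω ×ˢ univ) :=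
    (h2.clm_apply h5.continuousOn).add (continuousOn_const.mul
      (h3.clm_apply (((hDN.comp continuous_fst).clm_apply h5).continuousOn)))
  exact ((((h1.clm_apply continuousOn_snd).clm_apply continuousOn_snd).neg.add h7).add
    (continuousOn_const.mul h4)).add h6.continuousOn

/-- On the boundary the correction removes the mixed tangential-normal part of `D²u(ξ, ξ)`. -/
lemma sub_correction_eq (h : NeumannFamily Ω ρ N u ψ Φ fr) (i : I)
    {p : EuclideanSpace ℝ (Fin n)} (hp : p ∈ frontier Ω) (ξ : EuclideanSpace ℝ (Fin n)) :
    D₂ (closure Ω) (u i) p ξ ξ - correction Ω N u Φ i ξ p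
      = D₂ (closure Ω) (u i) p (tang N ξ p) (tang N ξ p)
        + inner ℝ ξ (N p) ^ 2 * D₂ (closure Ω) (u i) p (N p) (N p) := by
  have hK := h.domain.uniqueDiffOn
  have hpK : p ∈ closure Ω := frontier_subset_closure hp
  set τ := tang N ξ p with hτ
  set s := inner ℝ ξ (N p) with hs
  have hξ : ξ = τ + s • N p := by rw [hτ, tang]; module
  have hgc : ContDiffOn ℝ 2 (normalGap Ω N u Φ i) (closure Ω) := by
    obtain ⟨C, -, hg⟩ := h.tame₁_gap
    exact (hg i).1
  have h1 := h.domain.tangent_eq_zero hp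
    (hasFDerivWithinAt_of_contDiffOn (r := 2) (by norm_num) hgc hpK)
    (fun x hx => h.gap_eq_zero i hx) (inner_tang (ξ := ξ) (h.domain.norm_normal hp))
  have h2 : fderivWithin ℝ N (closure Ω) p = fderiv ℝ N p :=
    ((h.domain.contDiff_normal.differentiable (by norm_num) p).hasFDerivAt.hasFDerivWithinAt
      ).fderivWithin (hK p hpK)
  rw [h.fderivWithin_gap i hpK, h2, ← hτ] at h1
  have h3 : correction Ω N u Φ i ξ p = 2 * s * D₂ (closure Ω) (u i) p τ (N p) := by
    rw [correction, ← hτ, ← hs]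
    simp only [map_smul, smul_eq_mul]
    linear_combination (-(2 * s)) * h1
  have hsym : D₂ (closure Ω) (u i) p (N p) τ = D₂ (closure Ω) (u i) p τ (N p) :=
    D₂_symm hK ((h.equation.contDiffOn i).of_le (by norm_num)) hpK
      (closure_subset_closure_interior h.domain.isOpen hpK) _ _
  rw [h3]
  conv_lhs => rw [hξ]
  simp only [map_add, map_smul, add_apply, smul_apply, smul_eq_mul, hsym]
  ring

set_option maxHeartbeats 1000000 in
/-- The global bound for the second derivatives. The quantity
`D²u(ξ, ξ) - v' + |Du|² + κ (1 - e^{ρ/ε})`, with `v'` the correction, is maximized over all points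
and unit vectors. -/
theorem exists_hessNorm_le (h : NeumannFamily Ω ρ N u ψ Φ fr) :
    ∃ C, ∀ i, ∀ x ∈ closure Ω, hessNorm (closure Ω) u i x ≤ C := by
  have hK := h.domain.uniqueDiffOn
  have hΩ := h.domain.isOpen
  have hΩK : Ω ⊆ closure Ω := subset_closure
  have hUD := hΩ.uniqueDiffOn (𝕜 := ℝ)
  obtain ⟨Cv, hCv, hcorr⟩ := h.tame₁_correction
  obtain ⟨Cs, cs, hCs, hcs, hgrad⟩ := h.gradSq_bounds
  obtain ⟨Ch, hCh, hhess⟩ := h.equation.neg_le_lin_D₂ hΩ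
  obtain ⟨Ct, hCt, hthird⟩ := h.tangential_third_le
  obtain ⟨Λ₀, hΛ₀, hmax⟩ := h.equation.hessian_le
  obtain ⟨c, hc, hell⟩ := h.equation.elliptic
  obtain ⟨cρ, hcρ, hρ⟩ := h.domain.exists_gradient_lower
  set Λ := Λ₀ + 1
  have hΛ : 0 < Λ := by positivity
  -- the slope of the barrier at the boundary beats the tangential third derivatives
  set k := (Ct + Cv + Cs + 1) / cρ with hk
  have hk0 : 0 < k := by positivity
  -- a thin layer, so that the barrier itself is small compared with the second derivatives
  set ε := 1 / (2 * Λ * k) with hε_def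
  have hε : 0 < ε := by positivity
  have hΛkε : Λ * (k * ε) = 1 / 2 := by rw [hε_def]; field_simp
  obtain ⟨Cη, hCη, hnn⟩ := h.double_normal_le (η := 1 / (2 * Λ)) (by positivity)
  obtain ⟨Cb, hCb, hbar⟩ := tame₀_of_contDiffOn (I := Unit) (m := fun _ _ => (0 : ℝ)) hK
    h.domain.isCompact_closure (fun _ _ => le_rfl)
    (((contDiff_barrier h.domain.contDiff ε).of_le (by norm_num)).contDiffOn
      (s := closure Ω) (n := 2))
  set Q := Ch + Cv + Cs + k * ε * Cb with hQ
  have hQ0 : 0 ≤ Q := by positivity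
  set b := 2 * Λ * (2 * Cv + Cs) with hb
  have hb0 : 0 ≤ b := by positivity
  refine ⟨max (2 * Λ * (1 + Q * (1 + 2 * Λ + b) / cs) + b)
    (max (2 * Λ * (Cη + Cs + Cv)) (Ct + Cv + Cs)), fun i x hx => ?_⟩
  set m := hessNorm (closure Ω) u i
  have hm0 : ∀ y, 0 ≤ m y := hessNorm_nonneg _ u i
  have hmc : ContinuousOn m (closure Ω) :=
    (continuous_norm (E := EuclideanSpace ℝ (Fin n) →L[ℝ] EuclideanSpace ℝ (Fin n) →L[ℝ] ℝ)
      ).comp_continuousOn (f := D₂ (closure Ω) (u i)) (by exact h.continuousOn_D₂ i)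
  obtain ⟨y, hy, hymax⟩ := h.domain.isCompact_closure.exists_isMaxOn ⟨x, hx⟩ hmc
  set M := m y with hM
  have hmM : ∀ z ∈ closure Ω, m z ≤ M := fun z hz => hymax hz
  have hM0 : 0 ≤ M := hm0 y
  refine (hmM x hx).trans ?_
  set κ := k * M * ε with hκ
  have hκ0 : 0 ≤ κ := by positivity
  -- the function `W` below is the negative of the auxiliary function, to be minimized
  obtain ⟨x₁, hx₁⟩ : Ω.Nonempty := closure_nonempty_iff.1 ⟨x, hx⟩
  obtain ⟨v₁, hv₁, -⟩ := hmax i x₁ hx₁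
  set W : EuclideanSpace ℝ (Fin n) → EuclideanSpace ℝ (Fin n) → ℝ := fun ξ z =>
    -D₂ (closure Ω) (u i) z ξ ξ + correction Ω N u Φ i ξ z + (-1) * gradSq Ω u i z
      + (-κ) * barrier ρ ε z with hW
  obtain ⟨⟨x₀, ξ⟩, ⟨hx₀, hξS⟩, hmin⟩ :=
    (h.domain.isCompact_closure.prod (isCompact_sphere (0 : EuclideanSpace ℝ (Fin n)) 1)
      ).exists_isMinOn ⟨(x, v₁), hx, mem_sphere_zero_iff_norm.2 hv₁⟩
      ((h.continuousOn_auxiliary i (-κ) ε).mono (prod_mono_right (subset_univ _)))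
  have hξ : ‖ξ‖ = 1 := mem_sphere_zero_iff_norm.1 hξS
  have hmin' : ∀ z ∈ closure Ω, ∀ ζ : EuclideanSpace ℝ (Fin n), ‖ζ‖ = 1 → W ξ x₀ ≤ W ζ z :=
    fun z hz ζ hζ => hmin (show (z, ζ) ∈ _ from ⟨hz, mem_sphere_zero_iff_norm.2 hζ⟩)
  have hcorr' : ∀ ζ : EuclideanSpace ℝ (Fin n), ‖ζ‖ = 1 →
      ContDiffOn ℝ 2 (correction Ω N u Φ i ζ) (closure Ω) ∧
      (∀ z ∈ closure Ω, ‖correction Ω N u Φ i ζ z‖ ≤ Cv ∧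
        ‖fderivWithin ℝ (correction Ω N u Φ i ζ) (closure Ω) z‖ ≤ Cv * (1 + m z)) ∧
      ∀ z ∈ Ω, ‖(fr i z).lin (D₂ (closure Ω) (correction Ω N u Φ i ζ) z)‖
        ≤ Cv * ((fr i z).trace * (1 + m z)) := fun ζ hζ =>
    hcorr ⟨i, ⟨ζ, mem_sphere_zero_iff_norm.2 hζ⟩⟩
  -- every second derivative is at most `Λ` times the largest pure one
  have hbound : M ≤ Λ * (-W ξ x₀ + Cv) := by
    have hpt : ∀ z ∈ Ω, m z ≤ Λ * (-W ξ x₀ + Cv) := by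
      intro z hz
      obtain ⟨v, hv, hle⟩ := hmax i z hz
      have h1 := hmin' z (hΩK hz) v hv
      have h2 := (le_abs_self _).trans (((hcorr' v hv).2.1 z (hΩK hz)).1)
      have h3 := gradSq_nonneg (Ω := Ω) (u := u) i z
      have h4 := mul_nonneg hκ0 (barrier_nonneg h.domain hε (hΩK hz))
      have h5 : D₂ (closure Ω) (u i) z v v ≤ -W ξ x₀ + Cv := by
        simp only [hW] at h1 ⊢
        linarith
      have h6 : 0 ≤ -W ξ x₀ + Cv := by
        by_contra! hneg
        have h8 : D₂ (closure Ω) (u i) z v v < 0 := h5.trans_lt hneg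
        have h9 : 0 ≤ Λ₀ * D₂ (closure Ω) (u i) z v v := (hm0 z).trans hle
        have h10 : m z ≤ 0 := hle.trans (mul_nonpos_of_nonneg_of_nonpos hΛ₀ h8.le)
        have h11 := neg_le_of_abs_le (abs_apply_self_le (B := D₂ (closure Ω) (u i) z) hv)
        have h12 : m z = ‖D₂ (closure Ω) (u i) z‖ := rfl
        linarith
      calc m z ≤ Λ₀ * D₂ (closure Ω) (u i) z v v := hle
        _ ≤ Λ₀ * (-W ξ x₀ + Cv) := mul_le_mul_of_nonneg_left h5 hΛ₀
        _ ≤ Λ * (-W ξ x₀ + Cv) := mul_le_mul_of_nonneg_right (by simp [Λ]) h6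
    exact ContinuousWithinAt.closure_le hy ((hmc y hy).mono hΩK) continuousWithinAt_const hpt
  rcases h.domain.mem_or_mem_frontier hx₀ with hxΩ | hxf
  · -- at an interior maximum the quadratic term coming from `|Du|²` has to be absorbed
    refine le_trans ?_ (le_max_left _ _)
    obtain ⟨hcc, hcb, hcl⟩ := hcorr' ξ hξ
    have hu4 := h.equation.contDiffOn_interior i
    have hDc : ContDiffOn ℝ 2 (fun z => D₂ (closure Ω) (u i) z ξ ξ) Ω :=
      (contDiffOn_clm_comp (evalBilin ξ ξ) (contDiffOn_D₂_of_four hUD hu4)).congr fun z hz => by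
        rw [evalBilin_apply, D₂_eq_of_isOpen hΩ hΩK hz]
    have hD1 : ContDiffOn ℝ 2 (fun z => (-1) * D₂ (closure Ω) (u i) z ξ ξ) Ω :=
      contDiffOn_const.mul hDc
    have hcc' := hcc.mono hΩK
    have hgc := ((hgrad i).1.mono hΩK)
    have hg1 : ContDiffOn ℝ 2 (fun z => (-1) * gradSq Ω u i z) Ω := contDiffOn_const.mul hgc
    have hbc : ContDiffOn ℝ 2 (barrier ρ ε) Ω :=
      ((contDiff_barrier h.domain.contDiff ε).of_le (by norm_num)).contDiffOn
    have hb1 : ContDiffOn ℝ 2 (fun z => (-κ) * barrier ρ ε z) Ω := contDiffOn_const.mul hbc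
    have hWe : W ξ = fun z => (-1) * D₂ (closure Ω) (u i) z ξ ξ + correction Ω N u Φ i ξ z
        + (-1) * gradSq Ω u i z + (-κ) * barrier ρ ε z := by
      ext z
      simp only [hW]
      ring
    have h1 := (fr i x₀).lin_nonneg_of_isMin hΩ (w := W ξ)
      (by rw [hWe]; exact ((hD1.add hcc').add hg1).add hb1) hxΩ
      (fun z hz => hmin' z (hΩK hz) ξ hξ)
    rw [hWe, D₂_add hUD ((hD1.add hcc').add hg1) hb1 hxΩ, D₂_add hUD (hD1.add hcc') hg1 hxΩ,
      D₂_add hUD hD1 hcc' hxΩ, D₂_const_mul hUD hDc hxΩ, D₂_const_mul hUD hgc hxΩ,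
      D₂_const_mul hUD hbc hxΩ] at h1
    simp only [WeightedFrame.lin_add, WeightedFrame.lin_smul] at h1
    have e1 := hhess i x₀ hxΩ ξ hξ
    have e2 := (le_abs_self _).trans (hcl x₀ hxΩ)
    have e3 := (hgrad i).2.2 x₀ hxΩ
    have e4 : -(Cb * (fr i x₀).trace) ≤ (fr i x₀).lin (D₂ Ω (barrier ρ ε) x₀) := by
      rw [← D₂_eq_of_isOpen hΩ hΩK hxΩ]
      have h2 := (fr i x₀).norm_lin_le (D₂ (closure Ω) (barrier ρ ε) x₀)
      have h3 := ((hbar ()).2 x₀ hx₀).2.2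
      rw [add_zero, mul_one] at h3
      exact neg_le_of_abs_le (h2.trans (mul_le_mul_of_nonneg_right h3 (fr i x₀).trace_nonneg))
    have hT : 0 < (fr i x₀).trace := hc.trans_le (hell i x₀ hxΩ).1
    rw [D₂_eq_of_isOpen hΩ hΩK hxΩ] at e2 e3
    have e5 := mul_le_mul_of_nonneg_left e4 hκ0
    set m₀ := m x₀ with hm₀
    have hm₀M : m₀ ≤ M := hmM x₀ hx₀
    have hm₀0 : 0 ≤ m₀ := hm0 x₀
    have hquad : cs * m₀ ^ 2 ≤ Q * (1 + M) := by
      have h2 : cs * m₀ ^ 2 * (fr i x₀).trace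
          ≤ ((Ch + Cv + Cs) * (1 + m₀) + κ * Cb) * (fr i x₀).trace := by
        linarith
      have h3 := le_of_mul_le_mul_right h2 hT
      have h4 : (Ch + Cv + Cs) * (1 + m₀) ≤ (Ch + Cv + Cs) * (1 + M) := by gcongr
      have h5 : κ * Cb ≤ k * ε * Cb * (1 + M) := by
        have : 0 ≤ k * ε * Cb := by positivity
        rw [hκ]
        linarith
      rw [hQ]
      linarith
    have hlin : M ≤ 2 * Λ * m₀ + b := by
      have h2 : -W ξ x₀ ≤ m₀ + Cv + Cs + κ := by
        have f1 := (le_abs_self _).trans (abs_apply_self_le (B := D₂ (closure Ω) (u i) x₀) hξ)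
        have f2 := neg_le_of_abs_le ((hcb x₀ hx₀).1)
        have f3 := ((hgrad i).2.1 x₀ hx₀).1
        have f4 := mul_le_of_le_one_right hκ0 (barrier_le_one (ρ := ρ) ε x₀)
        have f5 : m₀ = ‖D₂ (closure Ω) (u i) x₀‖ := rfl
        simp only [hW]
        linarith
      have h3 := hbound.trans (mul_le_mul_of_nonneg_left (add_le_add_left h2 Cv) hΛ.le)
      have h4 : Λ * κ = M / 2 := by
        rw [hκ]
        linear_combination M * hΛkε
      rw [hb]
      linarith
    have hm₀b : m₀ ≤ 1 + Q * (1 + 2 * Λ + b) / cs := by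
      by_cases h2 : m₀ ≤ 1
      · have : 0 ≤ Q * (1 + 2 * Λ + b) / cs := by positivity
        linarith
      · push Not at h2
        have h3 : cs * m₀ ^ 2 ≤ Q * (1 + 2 * Λ + b) * m₀ := by
          refine hquad.trans ?_
          rw [mul_assoc]
          refine mul_le_mul_of_nonneg_left ?_ hQ0
          have : b ≤ b * m₀ := le_mul_of_one_le_right hb0 h2.le
          linarith
        have h4 : m₀ ≤ Q * (1 + 2 * Λ + b) / cs := by
          rw [le_div_iff₀ hcs]
          refine le_of_mul_le_mul_right ?_ (by linarith : 0 < m₀)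
          linarith
        linarith
    refine hlin.trans ?_
    gcongr
  · refine le_trans ?_ (le_max_right _ _)
    have hNp := h.domain.norm_normal hxf
    have hbz := barrier_eq_zero h.domain ε hxf
    set s := inner ℝ ξ (N x₀) with hs
    set τ := tang N ξ x₀ with hτ
    have hpyth : ‖τ‖ ^ 2 + s ^ 2 = 1 := by
      have h1 : ‖ξ‖ ^ 2 = ‖τ + s • N x₀‖ ^ 2 := by
        congr 2
        rw [hτ, tang]
        module
      have h2 := inner_tang (ξ := ξ) hNp
      rw [norm_add_sq_real, inner_smul_right, real_inner_comm, h2, norm_smul, hNp, hξ,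
        Real.norm_eq_abs, mul_one, sq_abs] at h1
      linarith
    have hq := h.sub_correction_eq i hxf ξ
    have hWξ : -W ξ x₀ = D₂ (closure Ω) (u i) x₀ τ τ
        + s ^ 2 * D₂ (closure Ω) (u i) x₀ (N x₀) (N x₀) + gradSq Ω u i x₀ := by
      simp only [hW, hbz]
      linarith
    by_cases hs0 : s = 0
    · -- for tangential `ξ` the slope of the barrier is compared with `u_ξξν`
      refine le_trans ?_ (le_max_right _ _)
      have hd1 := hasFDerivWithinAt_D₂_apply hK (h.equation.contDiffOn i) hx₀ ξ ξ
      obtain ⟨hcc, hcb, -⟩ := hcorr' ξ hξ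
      have hd2 := hasFDerivWithinAt_of_contDiffOn (r := 2) (by norm_num) hcc hx₀
      have hd3 := hasFDerivWithinAt_of_contDiffOn (r := 2) (by norm_num) (hgrad i).1 hx₀
      have hd4 := (hasFDerivAt_barrier h.domain.contDiff ε x₀).hasFDerivWithinAt (s := closure Ω)
      have hd : HasFDerivWithinAt (fun z => -W ξ z) _ (closure Ω) x₀ :=
        (((hd1.fun_neg.fun_add hd2).fun_add (hd3.const_mul (-1))).fun_add
          (hd4.const_mul (-κ))).fun_neg
      have h1 := fderivWithin_nonpos_of_isMax hd
        (fun z hz => neg_le_neg (hmin' z hz ξ hξ)) (h.domain.eventually_mem hxf)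
      simp only [neg_apply, add_apply, smul_apply, map_neg, smul_eq_mul,
        ContinuousLinearMap.comp_apply, evalBilin_apply, (h.domain.boundary x₀ hxf).1, zero_div,
        Real.exp_zero, h.domain.fderiv_normal hxf] at h1
      rw [third_rotate hK (closure_subset_closure_interior hΩ) (h.equation.contDiffOn i) hx₀] at h1
      have e1 := hthird i x₀ hxf ξ hξ (by rw [real_inner_comm]; exact hs0)
      have e2 := (fderivWithin ℝ (correction Ω N u Φ i ξ) (closure Ω) x₀).le_of_opNorm_le
        (hcb x₀ hx₀).2 (N x₀)
      have e3 := (fderivWithin ℝ (gradSq Ω u i) (closure Ω) x₀).le_of_opNorm_le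
        ((hgrad i).2.1 x₀ hx₀).2 (N x₀)
      rw [hNp, mul_one] at e2 e3
      have f2 := neg_le_of_abs_le e2
      have f3 := le_of_abs_le e3
      have hgr : cρ ≤ ‖gradient ρ x₀‖ := hρ x₀ hx₀ (by rw [(h.domain.boundary x₀ hxf).1]; linarith)
      have e4 : (Ct + Cv + Cs + 1) * M ≤ κ * (ε⁻¹ * ‖gradient ρ x₀‖) := by
        calc (Ct + Cv + Cs + 1) * M = k * M * cρ := by rw [hk]; field_simp
          _ ≤ k * M * ‖gradient ρ x₀‖ := by gcongr
          _ = _ := by rw [hκ]; field_simp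
      have e5 : (Ct + Cv + Cs) * (1 + m x₀) ≤ (Ct + Cv + Cs) * (1 + M) := by
        have := hmM x₀ hx₀
        gcongr
      have e6 : hessNorm (closure Ω) u i x₀ = m x₀ := rfl
      simp only [e6] at *
      linarith
    · -- otherwise the normal direction does at least as well as `ξ`
      refine le_trans ?_ (le_max_left _ _)
      have hWn : -W (N x₀) x₀ = D₂ (closure Ω) (u i) x₀ (N x₀) (N x₀) + gradSq Ω u i x₀ := by
        have h1 := h.sub_correction_eq i hxf (N x₀)
        have h2 : tang N (N x₀) x₀ = 0 := by
          rw [tang, real_inner_self_eq_norm_sq, hNp]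
          simp
        rw [h2, real_inner_self_eq_norm_sq, hNp] at h1
        simp only [map_zero, one_pow, one_mul, zero_add] at h1
        simp only [hW, hbz]
        linarith
      have hττ : D₂ (closure Ω) (u i) x₀ τ τ ≤ ‖τ‖ ^ 2 * (-W ξ x₀ - gradSq Ω u i x₀) := by
        by_cases h0 : τ = 0
        · simp [h0]
        have hn : 0 < ‖τ‖ := norm_pos_iff.2 h0
        set τ' := ‖τ‖⁻¹ • τ with hτ'
        have hn' : ‖τ'‖ = 1 := by
          rw [hτ', norm_smul, norm_inv, norm_norm, inv_mul_cancel₀ hn.ne']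
        have h1 := h.sub_correction_eq i hxf τ'
        have h2 : inner ℝ τ' (N x₀) = 0 := by
          rw [hτ', inner_smul_left, real_inner_comm, hτ, inner_tang hNp, mul_zero]
        have h3 : tang N τ' x₀ = τ' := by
          rw [tang, h2]
          simp
        rw [h2, h3] at h1
        have h4 := hmin' x₀ hx₀ τ' hn'
        have h5 : D₂ (closure Ω) (u i) x₀ τ' τ' ≤ -W ξ x₀ - gradSq Ω u i x₀ := by
          simp only [hW, hbz] at h4 ⊢
          linarith
        have h6 : D₂ (closure Ω) (u i) x₀ τ τ = ‖τ‖ ^ 2 * D₂ (closure Ω) (u i) x₀ τ' τ' := by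
          rw [hτ']
          simp only [map_smul, smul_apply, smul_eq_mul]
          field_simp
        rw [h6]
        exact mul_le_mul_of_nonneg_left h5 (sq_nonneg _)
      have hs2 : 0 < s ^ 2 := by positivity
      have h1 : -W ξ x₀ ≤ D₂ (closure Ω) (u i) x₀ (N x₀) (N x₀) + gradSq Ω u i x₀ := by
        have h2 : s ^ 2 * (-W ξ x₀ - gradSq Ω u i x₀)
            ≤ s ^ 2 * D₂ (closure Ω) (u i) x₀ (N x₀) (N x₀) := by
          have h3 : ‖τ‖ ^ 2 = 1 - s ^ 2 := by linarith
          rw [h3] at hττ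
          linarith
        linarith [le_of_mul_le_mul_left h2 hs2]
      have h2 := hnn i M hmM x₀ hxf
      have h3 := ((hgrad i).2.1 x₀ hx₀).1
      have h4 := hbound.trans (mul_le_mul_of_nonneg_left
        (show -W ξ x₀ + Cv ≤ Cη + 1 / (2 * Λ) * M + Cs + Cv by linarith) hΛ.le)
      have h5 : Λ * (1 / (2 * Λ) * M) = M / 2 := by field_simp
      linarith

end NeumannFamily

end Main

/-! ### Composition with the solution -/

section Composition

variable {I : Type*} {n : ℕ} {E F G : Type*} [NormedAddCommGroup E] [NormedSpace ℝ E]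
  [NormedAddCommGroup F] [NormedSpace ℝ F] [NormedAddCommGroup G] [NormedSpace ℝ G]
  {K Ω : Set E} {m : I → E → ℝ} {fr : I → E → WeightedFrame n E}

lemma Tame₀.clm_comp (L : F →L[ℝ] G) {w : I → E → F} (hK : UniqueDiffOn ℝ K)
    (hm : ∀ i x, 0 ≤ m i x) (hw : Tame₀ K m w) : Tame₀ K m (fun i x => L (w i x)) :=
  (tame₀_const hm (c := fun _ => L) fun _ => le_rfl).bilin (ContinuousLinearMap.id ℝ (F →L[ℝ] G))
    hK hm hw

lemma Tame₁.clm_comp (L : F →L[ℝ] G) {w : I → E → F} (hK : UniqueDiffOn ℝ K) (hΩK : Ω ⊆ K)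
    (hm : ∀ i x, 0 ≤ m i x) (hw : Tame₁ K Ω m fr w) : Tame₁ K Ω m fr (fun i x => L (w i x)) :=
  Tame₁.bilin (ContinuousLinearMap.id ℝ (F →L[ℝ] G)) hK hΩK hm
    (tame₀_const hm (c := fun _ => L) fun _ => le_rfl) hw

/-- The gradient of a composition with functions whose derivatives up to third order are bounded
where they are evaluated. -/
lemma Tame₁.fderivWithin_comp {S : Set F} {a : I → F → ℝ} {Y : I → E → F}
    (hK : UniqueDiffOn ℝ K) (hS : UniqueDiffOn ℝ S) (hΩK : Ω ⊆ K) (hm : ∀ i x, 0 ≤ m i x)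
    (hY : Tame₀ K m Y) (hDY : Tame₁ K Ω m fr (fun i => fderivWithin ℝ (Y i) K))
    (ha : ∀ i, ContDiffOn ℝ 3 (a i) S) (hmaps : ∀ i, MapsTo (Y i) K S) {A : ℝ}
    (hA : ∀ i, ∀ x ∈ K, ‖fderivWithin ℝ (a i) S (Y i x)‖ ≤ A ∧ ‖D₂ S (a i) (Y i x)‖ ≤ A ∧
      ‖D₂ S (fderivWithin ℝ (a i) S) (Y i x)‖ ≤ A) :
    Tame₁ K Ω m fr (fun i => fderivWithin ℝ (fun x => a i (Y i x)) K) := by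
  have h1 : Tame₀ K m (fun i x => fderivWithin ℝ (a i) S (Y i x)) :=
    Tame₀.comp hK hS hm hY (fun i => contDiffOn_fderivWithin_of_three hS (ha i)) hmaps hA
  have h2 := Tame₁.bilin (ContinuousLinearMap.compL ℝ E F ℝ) hK hΩK hm h1 hDY
  refine h2.congr hΩK fun i x hx => ?_
  obtain ⟨C, -, hY⟩ := hY
  ext b
  rw [fderivWithin_comp_apply hK ((ha i).of_le (by norm_num)) (hY i).1 (hmaps i) hx]
  rfl

/-- Affine functions of `u`. -/
lemma tame₀_add_clm_comp {u : I → E → ℝ} (A : E →L[ℝ] F) (L : ℝ →L[ℝ] F) (hK : UniqueDiffOn ℝ K)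
    (hKc : IsCompact K) (hm : ∀ i x, 0 ≤ m i x) (hu : Tame₀ K m u) :
    Tame₀ K m (fun i x => A x + L (u i x)) :=
  (tame₀_of_contDiffOn hK hKc hm A.contDiff.contDiffOn).add hK (hu.clm_comp L hK hm)

lemma tame₁_fderivWithin_add_clm_comp {u : I → E → ℝ} (A : E →L[ℝ] F) (L : ℝ →L[ℝ] F)
    (hK : UniqueDiffOn ℝ K) (hΩK : Ω ⊆ K) (hm : ∀ i x, 0 ≤ m i x)
    (hu : ∀ i, ContDiffOn ℝ 2 (u i) K)
    (hDu : Tame₁ K Ω m fr (fun i => fderivWithin ℝ (u i) K)) :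
    Tame₁ K Ω m fr (fun i => fderivWithin ℝ (fun x => A x + L (u i x)) K) := by
  have h1 : Tame₁ K Ω m fr (fun i x => A + (ContinuousLinearMap.compL ℝ E ℝ F L)
      (fderivWithin ℝ (u i) K x)) :=
    ((tame₀_const hm (c := fun _ => A) fun _ => le_rfl).tame₁ hΩK hm).add hK hΩK
      (hDu.clm_comp (ContinuousLinearMap.compL ℝ E ℝ F L) hK hΩK hm)
  refine h1.congr hΩK fun i x hx => ?_
  have h2 := (A.hasFDerivWithinAt (s := K) (x := x)).fun_add (hasFDerivWithinAt_clm_comp L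
    (hasFDerivWithinAt_of_contDiffOn (r := 2) (by norm_num) (hu i) hx))
  rw [h2.fderivWithin (hK x hx)]
  rfl

end Composition

/-! ### From the norms in the hypotheses to controlled families -/

section Norms

lemma norm_iteratedFDerivWithin_le_of_ckNorm_le {E : Type} [NormedAddCommGroup E]
    [NormedSpace ℝ E] {r : ℕ} {g : E → ℝ} {D K : Set E} {Λ : ℝ}
    (h : ckNorm r g D K ≤ ENNReal.ofReal Λ) {j : ℕ} (hj : j ≤ r) {x : E} (hx : x ∈ K) :
    ‖iteratedFDerivWithin ℝ j g D x‖ ≤ max Λ 0 := by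
  have h1 : ‖iteratedFDerivWithin ℝ j g D x‖ₑ ≤ ckNorm r g D K :=
    (le_iSup₂ (f := fun y (_ : y ∈ K) => ‖iteratedFDerivWithin ℝ j g D y‖ₑ) x hx).trans
      (Finset.single_le_sum (f := fun j => ⨆ y ∈ K, ‖iteratedFDerivWithin ℝ j g D y‖ₑ)
        (fun _ _ => zero_le) (Finset.mem_range.2 (Nat.lt_succ_of_le hj)))
  have h2 := h1.trans h
  rw [← ofReal_norm] at h2
  rcases ENNReal.ofReal_le_ofReal_iff'.1 h2 with h3 | h3
  · exact h3.trans (le_max_left _ _)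
  · exact h3.trans (le_max_right _ _)

variable {E F : Type*} [NormedAddCommGroup E] [NormedSpace ℝ E] [NormedAddCommGroup F]
  [NormedSpace ℝ F] {S : Set E} {x : E}

lemma norm_D₂_eq (hS : UniqueDiffOn ℝ S) (hx : x ∈ S) (g : E → F) :
    ‖D₂ S g x‖ = ‖iteratedFDerivWithin ℝ 2 g S x‖ := by
  rw [← norm_iteratedFDerivWithin_fderivWithin (n := 1) hS hx,
    norm_iteratedFDerivWithin_one _ (hS x hx)]
  rfl

lemma norm_D₂_fderivWithin_eq (hS : UniqueDiffOn ℝ S) (hx : x ∈ S) (g : E → F) :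
    ‖D₂ S (fderivWithin ℝ g S) x‖ = ‖iteratedFDerivWithin ℝ 3 g S x‖ := by
  rw [← norm_iteratedFDerivWithin_fderivWithin (n := 2) hS hx]
  exact norm_D₂_eq hS hx _

variable {n : ℕ} {Ω : Set (EuclideanSpace ℝ (Fin n))} {u : EuclideanSpace ℝ (Fin n) → ℝ}

lemma abs_le_supAbs (hb : Bornology.IsBounded Ω) (hu : ContinuousOn u (closure Ω))
    {x : EuclideanSpace ℝ (Fin n)} (hx : x ∈ closure Ω) : |u x| ≤ supAbs u Ω := by
  obtain ⟨C, hC⟩ := hb.isCompact_closure.exists_bound_of_continuousOn hu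
  have hbdd : BddAbove ((fun x => |u x|) '' Ω) :=
    ⟨C, forall_mem_image.2 fun y hy => hC y (subset_closure hy)⟩
  exact ContinuousWithinAt.closure_le hx ((hu.abs x hx).mono subset_closure)
    continuousWithinAt_const fun y hy => le_csSup hbdd (mem_image_of_mem _ hy)

lemma hessian_apply (hΩ : IsOpen Ω) {x : EuclideanSpace ℝ (Fin n)} (hx : x ∈ Ω) (i j : Fin n) :
    hessian u x i j = D₂ (closure Ω) u x (EuclideanSpace.single i 1)
      (EuclideanSpace.single j 1) := by
  rw [D₂_eq_of_isOpen hΩ subset_closure hx, D₂, fderivWithin_of_isOpen hΩ hx,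
    hessian, Matrix.of_apply, iteratedFDeriv_two_apply]
  have h1 : fderivWithin ℝ u Ω =ᶠ[𝓝 x] fderiv ℝ u :=
    eventually_of_mem (hΩ.mem_nhds hx) fun y hy => fderivWithin_of_isOpen hΩ hy
  rw [h1.fderiv_eq]
  rfl

lemma inner_hessian (hΩ : IsOpen Ω) {x : EuclideanSpace ℝ (Fin n)} (hx : x ∈ Ω)
    (a b : EuclideanSpace ℝ (Fin n)) :
    inner ℝ a (Matrix.toEuclideanLin (hessian u x) b) = D₂ (closure Ω) u x a b := by
  have hexp : ∀ v : EuclideanSpace ℝ (Fin n), v = ∑ i, v i • EuclideanSpace.single i (1 : ℝ) := by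
    intro v
    conv_lhs => rw [← (EuclideanSpace.basisFun (Fin n) ℝ).sum_repr v]
    simp
  conv_rhs => rw [hexp a, hexp b]
  simp only [map_sum, map_smul, sum_apply, smul_apply, smul_eq_mul, PiLp.inner_apply,
    Matrix.toLpLin_apply, Matrix.mulVec, dotProduct, hessian_apply hΩ hx]
  simp only [Finset.mul_sum, Finset.sum_mul, RCLike.inner_apply, conj_trivial]
  rw [Finset.sum_comm]
  exact Finset.sum_congr rfl fun i _ => Finset.sum_congr rfl fun j _ => by ring

lemma isHermitian_hessian (hΩ : IsOpen Ω) (hu : ContDiffOn ℝ 4 u Ω)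
    {x : EuclideanSpace ℝ (Fin n)} (hx : x ∈ Ω) : (hessian u x).IsHermitian := by
  ext i j
  rw [Matrix.conjTranspose_apply, star_trivial, hessian_apply hΩ hx, hessian_apply hΩ hx,
    D₂_eq_of_isOpen hΩ subset_closure hx]
  exact D₂_symm hΩ.uniqueDiffOn (hu.of_le (by norm_num)) hx
    (by rw [hΩ.interior_eq]; exact subset_closure hx) _ _

end Norms

/-! ### Solutions with prescribed bounds form a controlled family -/

section Solutions

variable {n m k : ℕ} {Ω : Set (EuclideanSpace ℝ (Fin n))} {M Λf Λφ δ : ℝ}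

/-- Smooth admissible solutions of the Neumann problem with prescribed bounds for the solution and
the data. -/
structure SolutionData (m k : ℕ) (Ω : Set (EuclideanSpace ℝ (Fin n))) (M Λf Λφ δ : ℝ)
    (f φ : EuclideanSpace ℝ (Fin n) × ℝ → ℝ) (u : EuclideanSpace ℝ (Fin n) → ℝ) : Prop where
  contDiffOn_f : ContDiffOn ℝ 2 f (closure Ω ×ˢ univ)
  contDiffOn_φ : ContDiffOn ℝ 3 φ (closure Ω ×ˢ univ)
  contDiffOn_interior : ContDiffOn ℝ 4 u Ω
  contDiffOn : ContDiffOn ℝ 3 u (closure Ω)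
  admissible : IsAdmissible m k Ω u
  solution : IsNeumannSolution m k Ω f φ u
  norm_u : ckNorm 1 u (closure Ω) (closure Ω) ≤ ENNReal.ofReal M
  norm_f : ckNorm 2 f (closure Ω ×ˢ univ)
    (closure Ω ×ˢ Icc (-supAbs u Ω) (supAbs u Ω)) ≤ ENNReal.ofReal Λf
  norm_φ : ckNorm 3 φ (closure Ω ×ˢ univ)
    (closure Ω ×ˢ Icc (-supAbs u Ω) (supAbs u Ω)) ≤ ENNReal.ofReal Λφ
  le_f : ∀ p ∈ closure Ω ×ˢ Icc (-supAbs u Ω) (supAbs u Ω), δ ≤ f p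

namespace SolutionData

variable {f φ : EuclideanSpace ℝ (Fin n) × ℝ → ℝ} {u : EuclideanSpace ℝ (Fin n) → ℝ}

lemma mk_mem (h : SolutionData m k Ω M Λf Λφ δ f φ u) (hb : Bornology.IsBounded Ω)
    {x : EuclideanSpace ℝ (Fin n)} (hx : x ∈ closure Ω) :
    (x, u x) ∈ closure Ω ×ˢ Icc (-supAbs u Ω) (supAbs u Ω) :=
  ⟨hx, abs_le.1 (abs_le_supAbs hb h.contDiffOn.continuousOn hx)⟩

lemma u_le (h : SolutionData m k Ω M Λf Λφ δ f φ u) (hK : UniqueDiffOn ℝ (closure Ω))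
    {x : EuclideanSpace ℝ (Fin n)} (hx : x ∈ closure Ω) :
    ‖u x‖ ≤ max M 0 ∧ ‖fderivWithin ℝ u (closure Ω) x‖ ≤ max M 0 := by
  have h0 := norm_iteratedFDerivWithin_le_of_ckNorm_le h.norm_u (j := 0) (by norm_num) hx
  have h1 := norm_iteratedFDerivWithin_le_of_ckNorm_le h.norm_u (j := 1) (by norm_num) hx
  rw [norm_iteratedFDerivWithin_zero] at h0
  rw [norm_iteratedFDerivWithin_one _ (hK x hx)] at h1
  exact ⟨h0, h1⟩

lemma f_le (h : SolutionData m k Ω M Λf Λφ δ f φ u) (hb : Bornology.IsBounded Ω)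
    (hK : UniqueDiffOn ℝ (closure Ω)) {x : EuclideanSpace ℝ (Fin n)} (hx : x ∈ closure Ω) :
    ‖f (x, u x)‖ ≤ max Λf 0 ∧ ‖fderivWithin ℝ f (closure Ω ×ˢ univ) (x, u x)‖ ≤ max Λf 0 ∧
      ‖D₂ (closure Ω ×ˢ univ) f (x, u x)‖ ≤ max Λf 0 := by
  have hS : UniqueDiffOn ℝ (closure Ω ×ˢ (univ : Set ℝ)) := hK.prod uniqueDiffOn_univ
  have hmem := h.mk_mem hb hx
  have hmem' : (x, u x) ∈ closure Ω ×ˢ (univ : Set ℝ) := ⟨hx, mem_univ _⟩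
  have h0 := norm_iteratedFDerivWithin_le_of_ckNorm_le h.norm_f (j := 0) (by norm_num) hmem
  have h1 := norm_iteratedFDerivWithin_le_of_ckNorm_le h.norm_f (j := 1) (by norm_num) hmem
  have h2 := norm_iteratedFDerivWithin_le_of_ckNorm_le h.norm_f (j := 2) (by norm_num) hmem
  rw [norm_iteratedFDerivWithin_zero] at h0
  rw [norm_iteratedFDerivWithin_one _ (hS _ hmem')] at h1
  exact ⟨h0, h1, (norm_D₂_eq hS hmem' f).le.trans h2⟩

lemma φ_le (h : SolutionData m k Ω M Λf Λφ δ f φ u) (hb : Bornology.IsBounded Ω)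
    (hK : UniqueDiffOn ℝ (closure Ω)) {x : EuclideanSpace ℝ (Fin n)} (hx : x ∈ closure Ω) :
    ‖φ (x, u x)‖ ≤ max Λφ 0 ∧ ‖fderivWithin ℝ φ (closure Ω ×ˢ univ) (x, u x)‖ ≤ max Λφ 0 ∧
      ‖D₂ (closure Ω ×ˢ univ) φ (x, u x)‖ ≤ max Λφ 0 ∧
      ‖D₂ (closure Ω ×ˢ univ) (fderivWithin ℝ φ (closure Ω ×ˢ univ)) (x, u x)‖ ≤ max Λφ 0 := by
  have hS : UniqueDiffOn ℝ (closure Ω ×ˢ (univ : Set ℝ)) := hK.prod uniqueDiffOn_univ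
  have hmem := h.mk_mem hb hx
  have hmem' : (x, u x) ∈ closure Ω ×ˢ (univ : Set ℝ) := ⟨hx, mem_univ _⟩
  have h0 := norm_iteratedFDerivWithin_le_of_ckNorm_le h.norm_φ (j := 0) (by norm_num) hmem
  have h1 := norm_iteratedFDerivWithin_le_of_ckNorm_le h.norm_φ (j := 1) (by norm_num) hmem
  have h2 := norm_iteratedFDerivWithin_le_of_ckNorm_le h.norm_φ (j := 2) (by norm_num) hmem
  have h3 := norm_iteratedFDerivWithin_le_of_ckNorm_le h.norm_φ (j := 3) (by norm_num) hmem
  rw [norm_iteratedFDerivWithin_zero] at h0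
  rw [norm_iteratedFDerivWithin_one _ (hS _ hmem')] at h1
  exact ⟨h0, h1, (norm_D₂_eq hS hmem' φ).le.trans h2,
    (norm_D₂_fderivWithin_eq hS hmem' φ).le.trans h3⟩

/-- The linearized operators of the equation. -/
lemma exists_frame (hm : 1 ≤ m) (hmn : m ≤ n) (hk : 1 ≤ k) (hkn : k ≤ (n - 1).choose (m - 1))
    (hΩ : IsOpen Ω) (hb : Bornology.IsBounded Ω) (hK : UniqueDiffOn ℝ (closure Ω)) (hδ : 0 < δ) :
    ∃ c, 0 < c ∧ ∀ (f φ : EuclideanSpace ℝ (Fin n) × ℝ → ℝ) (u : EuclideanSpace ℝ (Fin n) → ℝ),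
      SolutionData m k Ω M Λf Λφ δ f φ u → ∀ x₀ : EuclideanSpace ℝ (Fin n),
      ∃ fr : WeightedFrame n (EuclideanSpace ℝ (Fin n)), x₀ ∈ Ω →
        (∃ q : OrthonormalBasis (Fin n) ℝ (EuclideanSpace ℝ (Fin n)), fr.vec = q) ∧
        (c ≤ fr.trace ∧ ∀ j, c * fr.trace ≤ fr.weight j) ∧
        ∀ x ∈ Ω, Real.log (f (x, u x)) - Real.log (f (x₀, u x₀)) ≤
          fr.lin (D₂ (closure Ω) u x) - fr.lin (D₂ (closure Ω) u x₀) := by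
  obtain ⟨c, hc, c₀, hc₀, hlin⟩ := exists_linearization hm hmn hk hkn (Real.log (max Λf 0))
  refine ⟨min c c₀, lt_min hc hc₀, fun f φ u h x₀ => ?_⟩
  by_cases hx₀ : x₀ ∈ Ω
  · have hpos : 0 < f (x₀, u x₀) := hδ.trans_le (h.le_f _ (h.mk_mem hb (subset_closure hx₀)))
    obtain ⟨q, F, hF, hF0, hsup⟩ := hlin _ (isHermitian_hessian hΩ h.contDiffOn_interior hx₀)
      (h.admissible x₀ hx₀) (by
        rw [h.solution.equation x₀ hx₀]
        exact Real.log_le_log hpos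
          ((le_abs_self _).trans (h.f_le hb hK (subset_closure hx₀)).1))
    have hF' : 0 ≤ ∑ j, F j := hc₀.le.trans hF0
    refine ⟨⟨F, q, fun j => (mul_nonneg hc.le hF').trans (hF j), fun j => q.norm_eq_one j⟩,
      fun _ => ⟨⟨q, rfl⟩, ⟨(min_le_right _ _).trans hF0, fun j => ?_⟩, fun x hx => ?_⟩⟩
    · exact (mul_le_mul_of_nonneg_right (min_le_left _ _) hF').trans (hF j)
    · have h1 := hsup _ (isHermitian_hessian hΩ h.contDiffOn_interior hx) (h.admissible x hx)
      rw [h.solution.equation x₀ hx₀, h.solution.equation x hx] at h1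
      refine h1.trans (le_of_eq ?_)
      simp only [WeightedFrame.lin, quadForm, inner_hessian hΩ hx, inner_hessian hΩ hx₀,
        smul_eq_mul]
      rw [← Finset.sum_sub_distrib]
      exact Finset.sum_congr rfl fun j _ => mul_sub _ _ _
  · exact ⟨⟨fun _ => 0, EuclideanSpace.basisFun (Fin n) ℝ, fun _ => le_rfl,
      fun j => (EuclideanSpace.basisFun (Fin n) ℝ).norm_eq_one j⟩, fun hx => absurd hx hx₀⟩

/-- The second derivatives of a solution are controlled by the largest one. -/
lemma exists_norm_le (hk : 1 ≤ k) (hΩ : IsOpen Ω) (h : SolutionData m k Ω M Λf Λφ δ f φ u)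
    {x : EuclideanSpace ℝ (Fin n)} (hx : x ∈ Ω) : ∃ v : EuclideanSpace ℝ (Fin n), ‖v‖ = 1 ∧
      ‖D₂ (closure Ω) u x‖ ≤ 2 * n * D₂ (closure Ω) u x v v := by
  obtain ⟨v, hv, hle⟩ := exists_norm_le_quadForm hk
    (isHermitian_hessian hΩ h.contDiffOn_interior hx) (h.admissible x hx)
  simp only [quadForm, inner_hessian hΩ hx] at hle
  refine ⟨v, hv, ContinuousLinearMap.opNorm_le_bound₂ _ ?_ fun a b => hle a b⟩
  have := (abs_nonneg _).trans (hle v v)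
  simpa [hv] using this

/-- All solutions with given bounds form a Neumann family. -/
lemma exists_neumannFamily (hm : 1 ≤ m) (hmn : m ≤ n) (hk : 1 ≤ k)
    (hkn : k ≤ (n - 1).choose (m - 1)) {ρ : EuclideanSpace ℝ (Fin n) → ℝ}
    {N : EuclideanSpace ℝ (Fin n) → EuclideanSpace ℝ (Fin n)} (hd : DefiningData Ω ρ N)
    (hδ : 0 < δ) (I : Type*) (f φ : I → EuclideanSpace ℝ (Fin n) × ℝ → ℝ)
    (u : I → EuclideanSpace ℝ (Fin n) → ℝ)
    (h : ∀ i, SolutionData m k Ω M Λf Λφ δ (f i) (φ i) (u i)) :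
    ∃ fr, NeumannFamily Ω ρ N u (fun i x => Real.log (f i (x, u i x)))
      (fun i x => φ i (x, u i x)) fr := by
  have hK := hd.uniqueDiffOn
  have hb := hd.isBounded
  have hS : UniqueDiffOn ℝ (closure Ω ×ˢ (univ : Set ℝ)) := hK.prod uniqueDiffOn_univ
  have hm0 := hessNorm_nonneg (closure Ω) u
  obtain ⟨c, hc, hfr⟩ :=
    exists_frame (M := M) (Λf := Λf) (Λφ := Λφ) hm hmn hk hkn hd.isOpen hb hK hδ
  choose fr hq hell hsup using fun i => hfr (f i) (φ i) (u i) (h i)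
  have hu0 : Tame₀ (closure Ω) (hessNorm (closure Ω) u) u := by
    refine ⟨max M 1, by positivity, fun i => ⟨(h i).contDiffOn.of_le (by norm_num), fun x hx => ?_⟩⟩
    have hM : max M 0 ≤ max M 1 := max_le_max le_rfl zero_le_one
    refine ⟨((h i).u_le hK hx).1.trans hM, ((h i).u_le hK hx).2.trans hM, ?_⟩
    have h1 : hessNorm (closure Ω) u i x ≤ 1 + hessNorm (closure Ω) u i x := by linarith
    refine (show ‖D₂ (closure Ω) (u i) x‖ ≤ _ from h1).trans ?_
    exact le_mul_of_one_le_left (by linarith [hm0 i x]) (le_max_right _ _)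
  have hY : Tame₀ (closure Ω) (hessNorm (closure Ω) u) (fun i x => (x, u i x)) := by
    refine (tame₀_add_clm_comp (ContinuousLinearMap.inl ℝ _ ℝ) (ContinuousLinearMap.inr ℝ _ ℝ) hK
      hd.isCompact_closure hm0 hu0).congr fun i x _ => ?_
    simp
  have hmaps : ∀ i, MapsTo (fun x => (x, u i x)) (closure Ω) (closure Ω ×ˢ (univ : Set ℝ)) :=
    fun i x hx => ⟨hx, mem_univ _⟩
  have hf0 : Tame₀ (closure Ω) (hessNorm (closure Ω) u) (fun i x => f i (x, u i x)) :=
    Tame₀.comp hK hS hm0 hY (fun i => (h i).contDiffOn_f) hmaps fun i x hx => (h i).f_le hb hK hx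
  have hφ0 : Tame₀ (closure Ω) (hessNorm (closure Ω) u) (fun i x => φ i (x, u i x)) :=
    Tame₀.comp hK hS hm0 hY (fun i => (h i).contDiffOn_φ.of_le (by norm_num)) hmaps fun i x hx =>
      ⟨((h i).φ_le hb hK hx).1, ((h i).φ_le hb hK hx).2.1, ((h i).φ_le hb hK hx).2.2.1⟩
  -- the values of `f` stay in a compact interval on which the logarithm is smooth
  have hlt : δ < max Λf 0 + δ + 1 := by linarith [le_max_right Λf 0]
  have hmapsf : ∀ i, MapsTo (fun x => f i (x, u i x)) (closure Ω) (Icc δ (max Λf 0 + δ + 1)) :=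
    fun i x hx => ⟨(h i).le_f _ ((h i).mk_mem hb hx), by
      linarith [(le_abs_self _).trans ((h i).f_le hb hK hx).1]⟩
  have hlogc : ContDiffOn ℝ 2 Real.log (Icc δ (max Λf 0 + δ + 1)) := fun t ht =>
    (Real.contDiffAt_log.2 (hδ.trans_le ht.1).ne').contDiffWithinAt
  obtain ⟨Cl, hCl, hlog⟩ := tame₀_of_contDiffOn (I := Unit) (m := fun _ _ => (0 : ℝ))
    (uniqueDiffOn_Icc hlt) isCompact_Icc (fun _ _ => le_rfl) hlogc
  have hψ0 : Tame₀ (closure Ω) (hessNorm (closure Ω) u)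
      (fun i x => Real.log (f i (x, u i x))) :=
    Tame₀.comp hK (uniqueDiffOn_Icc hlt) hm0 hf0 (fun _ => hlogc) hmapsf (A := Cl)
      fun i x hx => by
        obtain ⟨h1, h2, h3⟩ := (hlog ()).2 _ (hmapsf i hx)
        rw [add_zero, mul_one] at h3
        exact ⟨h1, h2, h3⟩
  have heq : EllipticFamily Ω u (fun i x => Real.log (f i (x, u i x))) fr :=
    { contDiffOn_interior := fun i => (h i).contDiffOn_interior
      contDiffOn := fun i => (h i).contDiffOn
      gradient_bounded := ⟨max M 0, le_max_right _ _, fun i x hx => ((h i).u_le hK hx).2⟩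
      source := hψ0
      orthonormal := hq
      elliptic := ⟨c, hc, hell⟩
      supporting := hsup
      hessian_le := ⟨2 * n, by positivity, fun i x hx => (h i).exists_norm_le hk hd.isOpen hx⟩ }
  have hDu := heq.tame₁_fderivWithin hd.isOpen hK
  have hDY : Tame₁ (closure Ω) Ω (hessNorm (closure Ω) u) fr
      (fun i => fderivWithin ℝ (fun x => (x, u i x)) (closure Ω)) := by
    have h1 := tame₁_fderivWithin_add_clm_comp (ContinuousLinearMap.inl ℝ _ ℝ)
      (ContinuousLinearMap.inr ℝ (EuclideanSpace ℝ (Fin n)) ℝ) hK subset_closure hm0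
      (fun i => (h i).contDiffOn.of_le (by norm_num)) hDu
    simpa using h1
  refine ⟨fr, hd, heq, hφ0, ?_, fun i p hp => ?_⟩
  · exact Tame₁.fderivWithin_comp hK hS subset_closure hm0 hY hDY (fun i => (h i).contDiffOn_φ)
      hmaps fun i x hx => ((h i).φ_le hb hK hx).2
  · have hloc := (hd.boundary p hp).2
    exact (h i).solution.boundary p hp (N p)
      ⟨ρ, ⟨hloc.contDiffAt.of_le (by norm_num), hloc.gradient_ne_zero, hloc.mem_iff⟩,
        hd.normal_eq p hp⟩

end SolutionData

end Solutions

end HessianNeumann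

end

theorem theorem5p2 (n m k : ℕ) (hm : 2 ≤ m) (hmn : m ≤ n - 1)
    (hk : 2 ≤ k) (hkn : k ≤ (n - 1).choose (m - 1))
    (Ω : Set (EuclideanSpace ℝ (Fin n)))
    (hΩ_open : IsOpen Ω) (hΩ_conn : IsConnected Ω) (hΩ_bdd : Bornology.IsBounded Ω)
    (hΩ_C4 : HessianNeumann.HasCkBoundary 4 Ω)
    (M Λf Λφ δ : ℝ) (hδ : 0 < δ) :
    ∃ C : ℝ, ∀ (f φ : EuclideanSpace ℝ (Fin n) × ℝ → ℝ) (u : EuclideanSpace ℝ (Fin n) → ℝ),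
      ContDiffOn ℝ 2 f (closure Ω ×ˢ univ) →
      (∀ p ∈ closure Ω ×ˢ (univ : Set ℝ), 0 < f p) →
      ContDiffOn ℝ 3 φ (closure Ω ×ˢ univ) →
      (∀ x ∈ frontier Ω, ∀ z : ℝ,
        deriv (fun t => φ (x, t)) z - 2 * HessianNeumann.kappaMin Ω x < 0) →
      ContDiffOn ℝ 4 u Ω →
      ContDiffOn ℝ 3 u (closure Ω) →
      HessianNeumann.IsAdmissible m k Ω u →
      HessianNeumann.IsNeumannSolution m k Ω f φ u →
      HessianNeumann.ckNorm 1 u (closure Ω) (closure Ω) ≤ ENNReal.ofReal M →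
      HessianNeumann.ckNorm 2 f (closure Ω ×ˢ univ)
        (closure Ω ×ˢ Icc (-HessianNeumann.supAbs u Ω) (HessianNeumann.supAbs u Ω))
          ≤ ENNReal.ofReal Λf →
      HessianNeumann.ckNorm 3 φ (closure Ω ×ˢ univ)
        (closure Ω ×ˢ Icc (-HessianNeumann.supAbs u Ω) (HessianNeumann.supAbs u Ω))
          ≤ ENNReal.ofReal Λφ →
      (∀ p ∈ closure Ω ×ˢ Icc (-HessianNeumann.supAbs u Ω) (HessianNeumann.supAbs u Ω),
        δ ≤ f p) →
      ∀ x ∈ closure Ω, ‖iteratedFDerivWithin ℝ 2 u (closure Ω) x‖ ≤ C := by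
  obtain ⟨ρ, N, hd⟩ := HessianNeumann.exists_definingData hΩ_open hΩ_bdd hΩ_C4
  -- the family of all solutions with the given bounds
  let I := {t : (EuclideanSpace ℝ (Fin n) × ℝ → ℝ) × (EuclideanSpace ℝ (Fin n) × ℝ → ℝ) ×
    (EuclideanSpace ℝ (Fin n) → ℝ) //
      HessianNeumann.SolutionData m k Ω M Λf Λφ δ t.1 t.2.1 t.2.2}
  obtain ⟨fr, hfam⟩ := HessianNeumann.SolutionData.exists_neumannFamily (by omega) (by omega)
    (by omega) hkn hd hδ I (fun i => i.1.1) (fun i => i.1.2.1) (fun i => i.1.2.2) fun i => i.2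
  obtain ⟨C, hC⟩ := hfam.exists_hessNorm_le
  refine ⟨C, fun f φ u hf _ hφ _ hu4 hu3 hadm hsol hnu hnf hnφ hlef x hx => ?_⟩
  rw [← HessianNeumann.norm_D₂_eq hd.uniqueDiffOn hx]
  exact hC ⟨(f, φ, u), hf, hφ, hu4, hu3, hadm, hsol, hnu, hnf, hnφ, hlef⟩ x hx
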